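/- **Setting for (1).** Let $X$ be a finite alphabet, $X^*$ the rooted tree of finite words over $X$ (ordered by the prefix relation) and $X^\omega$ the space of right-infinite words with the product topology. A *self-similar group* $(G,X)$ is a group $G$ acting faithfully by automorphisms of the rooted tree $X^*$ such that for all $g\in G$, $x\in X$ there are $h\in G$, $y\in X$ with $g(xw)=y\,h(w)$ for all $w\in X^*$. For every $g\in G$ and $v\in X^*$ there is then a unique $g|_v\in G$ with $g(vw)=g(v)\,g|_v(w)$ for all $w\in X^*$. The group is *contracting* if there is a finite set $\mathcal N\subset G$ such that for every $g\in G$ there exists $n$ with $g|_v\in\mathcal N$ for all $v\in X^*$ of length at least $n$. A *complete antichain* is a finite maximal set of pairwise incomparable words of $X^*$. The group $\mathcal V_G$ consists of all homeomorphisms $g$ of $X^\omega$ for which there are complete antichains $A_1,A_2\subset X^*$, a bijection $\alpha:A_1\to A_2$ and elements $g_v\in G$ ($v\in A_1$) such that $g(vw)=\alpha(v)\,g_v(w)$ for all $v\in A_1$ and $w\in X^\omega$. **Setting for (2).** Let $f:\mathcal M\to\mathcal M$ be a covering map of a compact path-connected metric space. For $t\in\mathcal M$ let $T_t$ be the tree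 with vertex set $\bigsqcup_{n\ge 0}f^{-n}(t)$, in which $v\in f^{-n-1}(t)$ is joined to $f(v)\in f^{-n}(t)$, and let $\partial T_t$ be its boundary, the inverse limit of the discrete sets $f^{-n}(t)$. For a vertex $v$ of $T_t$ regard $\partial T_v$ as the subset of $\partial T_t$ of the infinite paths through $v$. If $\gamma$ is a path in $\mathcal M$ from a vertex $v$ to a vertex $u$ of $T_t$, let $S_\gamma:\partial T_v\to\partial T_u$ be the homeomorphism induced by sending $z\in f^{-k}(v)$ to the end of the lift of $\gamma$ by $f^k$ starting at $z$. The group $\mathcal V_f$ is the group of all homeomorphisms of $\partial T_t$ that are locally equal to homeomorphisms of the form $S_\gamma:\partial T_v\to\partial T_u$. The map $f$ is *expanding* if there exist a metric $|x-y|$ on $\mathcal M$ compatible with its topology, $L>1$, $\epsilon>0$ and a positive integer $n$ such that $|f^n(x)-f^n(y)|\ge L|x-y|$ for all $x,y\in\mathcal M$ with $|x-y|<\epsilon$. **Theorem.** 1. If $(G,X)$ is a contracting self-similar group, then $\mathcal V_G$ is finitely presented. 2. If $f:\mathcal M\to\mathcal M$ is an expanding self-covering of a compact path-connected metric space, then,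 for every basepoint $t\in\mathcal M$, the group $\mathcal V_f$ is finitely presented. -/

import Mathlib

namespace SelfSimilar

/-- Right-infinite sequences `x₁ x₂ …` over the alphabet `X`: the boundary of the tree of
finite words `List X`, ordered by the prefix relation. -/
def InfWord (X : Type*) : Type _ := ℕ → X

/-- The product topology of the discrete topologies on `X`. -/
instance (X : Type*) : TopologicalSpace (InfWord X) :=
  @Pi.topologicalSpace ℕ (fun _ => X) (fun _ => ⊥)

namespace InfWord

variable {X : Type*}

/-- The finite word formed by the first `n` letters. -/
def take (w : InfWord X) (n : ℕ) : List X := List.ofFn fun i : Fin n => w i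

/-- The concatenation `vw` of a finite word `v` and an infinite word `w`. -/
def prepend (v : List X) (w : InfWord X) : InfWord X :=
  fun n => if h : n < v.length then v[n] else w (n - v.length)

@[simp] theorem length_take (w : InfWord X) (n : ℕ) : (w.take n).length = n := by
  simp [take]

theorem getElem_take (w : InfWord X) (n i : ℕ) (h : i < (w.take n).length) :
    (w.take n)[i] = w i := by
  simp [take]

theorem ext_take {w w' : InfWord X} (h : ∀ n, w.take n = w'.take n) : w = w' := by
  funext n
  have h1 := h (n + 1)
  have h2 : (w.take (n + 1))[n]'(by simp) = (w'.take (n + 1))[n]'(by simp) := by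
    simp only [h1]
  rwa [getElem_take, getElem_take] at h2

theorem take_prefix (w : InfWord X) {m n : ℕ} (h : m ≤ n) : w.take m <+: w.take n := by
  rw [List.prefix_iff_eq_take]
  apply List.ext_getElem
  · simp [h]
  · intro i h1 h2
    simp [getElem_take]

theorem take_prepend (v : List X) (w : InfWord X) (n : ℕ) :
    (prepend v w).take (v.length + n) = v ++ w.take n := by
  apply List.ext_getElem
  · simp
  · intro i h1 h2
    rw [getElem_take, List.getElem_append]
    unfold prepend
    split_ifs with h
    · rfl
    · rw [getElem_take]

theorem take_length_prepend (v : List X) (w : InfWord X) :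
    (prepend v w).take v.length = v := by
  have := take_prepend v w 0
  simpa [take] using this

theorem prepend_append (v u : List X) (w : InfWord X) :
    prepend (v ++ u) w = prepend v (prepend u w) := by
  funext n
  unfold prepend
  by_cases h : n < v.length
  · have : n < (v ++ u).length := by simp; omega
    rw [dif_pos this, dif_pos h, List.getElem_append_left h]
  · by_cases h' : n - v.length < u.length
    · have : n < (v ++ u).length := by simp; omega
      rw [dif_pos this, dif_neg h, dif_pos h', List.getElem_append_right (by omega)]
    · have : ¬ n < (v ++ u).length := by simp; omega
      rw [dif_neg this, dif_neg h, dif_neg h', List.length_append, Nat.sub_add_eq]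

@[simp] theorem prepend_nil (w : InfWord X) : prepend [] w = w := by
  funext n
  simp [prepend]

theorem exists_eq_prepend (w : InfWord X) (n : ℕ) :
    ∃ z : InfWord X, w = prepend (w.take n) z := by
  refine ⟨fun k => w (n + k), ?_⟩
  funext i
  unfold prepend
  split_ifs with h
  · rw [getElem_take]
  · simp only [length_take] at h ⊢
    congr 1
    omega

end InfWord

open InfWord

variable (G X : Type*) [Group G] [MulAction G (List X)]

/-- `(G, X)` is a self-similar group: `G` acts faithfully by automorphisms of the rooted tree
`X*` of finite words (the tree whose order is the prefix order), and for all `g ∈ G`, `x ∈ X`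
there are `h ∈ G`, `y ∈ X` with `g(xw) = y h(w)` for all `w ∈ X*`. -/
structure IsSelfSimilar : Prop where
  faithful : FaithfulSMul G (List X)
  prefix_iff : ∀ (g : G) (u v : List X), g • u <+: g • v ↔ u <+: v
  exists_cons : ∀ (g : G) (x : X), ∃ (h : G) (y : X), ∀ w : List X, g • (x :: w) = y :: h • w

variable {G X}

/-- `h` is the section `g|_v` of `g` in `v`, i.e. `g(vw) = g(v) h(w)` for all words `w`. -/
def IsSection (g : G) (v : List X) (h : G) : Prop :=
  ∀ w : List X, g • (v ++ w) = g • v ++ h • w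

variable (G X) in
/-- `(G, X)` is contracting: there is a finite set `N ⊆ G` such that for every `g ∈ G` there
is `n` with `g|_v ∈ N` for all words `v` of length at least `n`. -/
def IsContracting : Prop :=
  ∃ N : Set G, N.Finite ∧ ∀ g : G, ∃ n : ℕ, ∀ v : List X, n ≤ v.length →
    ∃ h ∈ N, IsSection g v h

/-- The action of `g` on infinite words: the first `n + 1` letters of the image are
`g` applied to the first `n + 1` letters. The default value `w n` of `getD` is never used, since
`g` preserves lengths of words, see `take_infAct`. -/
def infAct (g : G) (w : InfWord X) : InfWord X :=
  fun n => (g • w.take (n + 1)).getD n (w n)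

namespace IsSelfSimilar

theorem smul_nil (hG : IsSelfSimilar G X) (g : G) : g • ([] : List X) = [] := by
  have h : g • ([] : List X) <+: g • (g⁻¹ • ([] : List X)) :=
    (hG.prefix_iff g _ _).2 List.nil_prefix
  rw [smul_inv_smul] at h
  exact List.prefix_nil.1 h

theorem length_smul (hG : IsSelfSimilar G X) (g : G) (v : List X) : (g • v).length = v.length := by
  induction v generalizing g with
  | nil => rw [hG.smul_nil]
  | cons x v ih =>
    obtain ⟨h, y, e⟩ := hG.exists_cons g x
    rw [e, List.length_cons, List.length_cons, ih]

theorem exists_section (hG : IsSelfSimilar G X) (g : G) (v : List X) : ∃ h : G, IsSection g v h := by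
  induction v generalizing g with
  | nil => exact ⟨g, fun w => by rw [hG.smul_nil]; rfl⟩
  | cons x v ih =>
    obtain ⟨h, y, e⟩ := hG.exists_cons g x
    obtain ⟨k, hk⟩ := ih h
    exact ⟨k, fun w => by rw [List.cons_append, e, e, hk, List.cons_append]⟩

theorem section_unique (hG : IsSelfSimilar G X) {g : G} {v : List X} {h h' : G} (e : IsSection g v h)
    (e' : IsSection g v h') : h = h' := by
  have := hG.faithful
  refine eq_of_smul_eq_smul (α := List X) fun w => ?_
  exact List.append_cancel_left ((e w).symm.trans (e' w))

theorem take_infAct (hG : IsSelfSimilar G X) (g : G) (w : InfWord X) (n : ℕ) :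
    (infAct g w).take n = g • w.take n := by
  apply List.ext_getElem
  · simp [hG.length_smul]
  · intro i h1 h2
    rw [length_take] at h1
    have h3 : i < (g • w.take (i + 1)).length := by simp [hG.length_smul]
    rw [getElem_take]
    have hp : g • w.take (i + 1) <+: g • w.take n :=
      (hG.prefix_iff g _ _).2 (take_prefix w h1)
    unfold infAct
    rw [← List.getElem_eq_getD (h := h3), hp.getElem h3]

theorem infAct_one (hG : IsSelfSimilar G X) (w : InfWord X) : infAct (1 : G) w = w :=
  ext_take fun n => by rw [hG.take_infAct, one_smul]

theorem infAct_mul (hG : IsSelfSimilar G X) (g h : G) (w : InfWord X) : infAct (g * h) w = infAct g (infAct h w) :=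
  ext_take fun n => by rw [hG.take_infAct, hG.take_infAct, hG.take_infAct, mul_smul]

theorem infAct_prepend (hG : IsSelfSimilar G X) {g : G} {v : List X} {h : G} (e : IsSection g v h) (w : InfWord X) :
    infAct g (prepend v w) = prepend (g • v) (infAct h w) := by
  have key : ∀ n, (infAct g (prepend v w)).take (v.length + n) =
      (prepend (g • v) (infAct h w)).take (v.length + n) := fun n => by
    rw [hG.take_infAct, take_prepend, e]
    conv_rhs => rw [← hG.length_smul g v, take_prepend, hG.take_infAct]
  funext n
  have h1 := key (n + 1)
  have h2 : ((infAct g (prepend v w)).take (v.length + (n + 1)))[n]'(by simp; omega) =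
      ((prepend (g • v) (infAct h w)).take (v.length + (n + 1)))[n]'(by simp; omega) := by
    simp only [h1]
  rwa [getElem_take, getElem_take] at h2

end IsSelfSimilar

/-- A complete antichain of the tree `X*`: a finite antichain (set of pairwise incomparable
words) that is maximal among all antichains. -/
def IsCompleteAntichain (A : Set (List X)) : Prop :=
  A.Finite ∧ IsMaxAntichain (· <+: ·) A

variable (G) in
/-- `g` is given by a table: there are complete antichains `A₁`, `A₂`, a bijection
`α : A₁ → A₂` and elements `c v ∈ G` such that `g(vw) = α(v) (c v)(w)` for all `v ∈ A₁`
and all infinite words `w`. -/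
def HasTable (g : InfWord X ≃ₜ InfWord X) : Prop :=
  ∃ A₁ A₂ : Set (List X), IsCompleteAntichain A₁ ∧ IsCompleteAntichain A₂ ∧
    ∃ (α : A₁ ≃ A₂) (c : A₁ → G), ∀ (v : A₁) (w : InfWord X),
      g (prepend v.1 w) = prepend (α v).1 (infAct (c v) w)

theorem isCompleteAntichain_nil : IsCompleteAntichain ({[]} : Set (List X)) := by
  refine ⟨Set.finite_singleton _, IsAntichain.singleton, fun t ht hs => hs.antisymm fun v hv => ?_⟩
  by_contra hne
  exact ht (hs rfl) hv (fun h => hne h.symm) List.nil_prefix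

theorem isCompleteAntichain_level [Finite X] [Nonempty X] (N : ℕ) :
    IsCompleteAntichain {v : List X | v.length = N} := by
  refine ⟨List.finite_length_eq X N, fun u hu v hv hne hp => ?_,
    fun t ht hs => hs.antisymm fun v hv => ?_⟩
  · exact hne (hp.eq_of_length (hu.trans hv.symm))
  · rcases le_total N v.length with h | h
    · have h1 : v.take N ∈ t := hs (by simp [h])
      have h2 : v.take N = v := by
        by_contra hne
        exact ht h1 hv hne (List.take_prefix _ _)
      rw [← h2]
      simp [h]
    · obtain ⟨x⟩ := ‹Nonempty X›
      have h1 : v ++ List.replicate (N - v.length) x ∈ t := hs (by simp [h])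
      have h2 : v = v ++ List.replicate (N - v.length) x := by
        by_contra hne
        exact ht hv h1 hne (List.prefix_append _ _)
      rw [h2]
      simp [h]

variable (G) in
/-- `g` acts uniformly locally by `vw ↦ u h(w)`; an auxiliary reformulation of `HasTable`. -/
def IsLevelTable (g : InfWord X ≃ₜ InfWord X) (N : ℕ) : Prop :=
  ∀ v : List X, v.length = N → ∃ (u : List X) (h : G), ∀ w : InfWord X,
    g (prepend v w) = prepend u (infAct h w)

theorem HasTable.exists_level (hG : IsSelfSimilar G X) {g : InfWord X ≃ₜ InfWord X}
    (hg : HasTable G g) : ∃ N, IsLevelTable G g N := by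
  obtain ⟨A₁, A₂, ⟨hf, hA⟩, -, α, c, e⟩ := hg
  obtain ⟨N, hN⟩ := (hf.image List.length).bddAbove
  refine ⟨N, fun v hv => ?_⟩
  have hex : ∃ a ∈ A₁, a <+: v := by
    by_contra hno
    push Not at hno
    have hanti : IsAntichain (· <+: ·) (insert v A₁) := by
      refine hA.1.insert (fun b hb hne hp => hno b hb hp) fun b hb hne hp => ?_
      have hb' : b.length ≤ N := hN (Set.mem_image_of_mem _ hb)
      exact hne (hp.eq_of_length (le_antisymm hp.length_le (hv ▸ hb')))
    have hv' : v ∈ A₁ := (hA.2 hanti (Set.subset_insert _ _)).symm ▸ Set.mem_insert _ _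
    exact hno v hv' List.prefix_rfl
  obtain ⟨a, ha, s, rfl⟩ := hex
  obtain ⟨k, hk⟩ := hG.exists_section (c ⟨a, ha⟩) s
  refine ⟨(α ⟨a, ha⟩).1 ++ c ⟨a, ha⟩ • s, k, fun w => ?_⟩
  rw [prepend_append, e ⟨a, ha⟩, hG.infAct_prepend hk, prepend_append]

theorem IsLevelTable.add (hG : IsSelfSimilar G X) {g : InfWord X ≃ₜ InfWord X} {N : ℕ}
    (hg : IsLevelTable G g N) (M : ℕ) (v : List X) (hv : v.length = N + M) :
    ∃ (u : List X) (h : G), M ≤ u.length ∧ ∀ w : InfWord X,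
      g (prepend v w) = prepend u (infAct h w) := by
  obtain ⟨u, h, e⟩ := hg (v.take N) (by simp [hv])
  obtain ⟨k, hk⟩ := hG.exists_section h (v.drop N)
  refine ⟨u ++ h • v.drop N, k, by simp [hG.length_smul, hv], fun w => ?_⟩
  conv_lhs => rw [← List.take_append_drop N v]
  rw [prepend_append, e, hG.infAct_prepend hk, prepend_append]

theorem prefix_or_prefix {v u : List X} {w z : InfWord X} (h : prepend v w = prepend u z) :
    v <+: u ∨ u <+: v := by
  rw [← take_length_prepend v w, ← take_length_prepend u z, ← h]
  rcases le_total v.length u.length with h | h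
  · exact Or.inl (take_prefix _ h)
  · exact Or.inr (take_prefix _ h)

theorem IsLevelTable.hasTable [Finite X] (hG : IsSelfSimilar G X)
    {g : InfWord X ≃ₜ InfWord X} {N : ℕ} (hg : IsLevelTable G g N) : HasTable G g := by
  rcases isEmpty_or_nonempty X with hX | hX
  · exact ⟨{[]}, {[]}, isCompleteAntichain_nil, isCompleteAntichain_nil, Equiv.refl _,
      fun _ => 1, fun _ w => isEmptyElim (w 0)⟩
  choose! u h e using hg
  have z₀ : InfWord X := fun _ => Classical.choice hX
  have key : ∀ v, v.length = N → ∀ v', v'.length = N → u v <+: u v' → v = v' := by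
    rintro v hv v' hv' ⟨s, hs⟩
    have e1 := e v hv (infAct (h v)⁻¹ (prepend s z₀))
    have e2 := e v' hv' (infAct (h v')⁻¹ z₀)
    rw [← hG.infAct_mul, mul_inv_cancel, hG.infAct_one] at e1 e2
    rw [← prepend_append, hs, ← e2] at e1
    rcases prefix_or_prefix (g.injective e1) with hp | hp
    · exact hp.eq_of_length (hv.trans hv'.symm)
    · exact (hp.eq_of_length (hv'.trans hv.symm)).symm
  have hlev := isCompleteAntichain_level (X := X) N
  refine ⟨{v | v.length = N}, u '' {v | v.length = N}, hlev, ⟨hlev.1.image u, ?_, ?_⟩,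
    Equiv.Set.imageOfInjOn u _ ?_, fun v => h v.1, fun v w => e v.1 v.2 w⟩
  · rintro _ ⟨v, hv, rfl⟩ _ ⟨v', hv', rfl⟩ hne hp
    exact hne (congrArg u (key v hv v' hv' hp))
  · refine fun t ht hs => hs.antisymm fun s hst => ?_
    obtain ⟨w, hw⟩ := exists_eq_prepend (g.symm (prepend s z₀)) N
    have hv : ((g.symm (prepend s z₀)).take N).length = N := length_take _ _
    have e1 := e _ hv w
    rw [← hw, g.apply_symm_apply] at e1
    have hmem : u ((g.symm (prepend s z₀)).take N) ∈ u '' {v | v.length = N} :=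
      ⟨_, hv, rfl⟩
    have heq : u ((g.symm (prepend s z₀)).take N) = s := by
      by_contra hne
      rcases prefix_or_prefix e1 with hp | hp
      · exact ht hst (hs hmem) (Ne.symm hne) hp
      · exact ht (hs hmem) hst hne hp
    rwa [heq] at hmem
  · intro v hv v' hv' he
    exact key v hv v' hv' (he ▸ List.prefix_rfl)

/-- The group `V_G` of a self-similar group `(G, X)`: all homeomorphisms of the space of
infinite words that are given by a table. -/
def VG [Finite X] (hG : IsSelfSimilar G X) : Subgroup (InfWord X ≃ₜ InfWord X) where
  carrier := {g | HasTable G g}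
  one_mem' := ⟨{[]}, {[]}, isCompleteAntichain_nil, isCompleteAntichain_nil, Equiv.refl _,
    fun _ => 1, fun v w => by rw [hG.infAct_one]; rfl⟩
  mul_mem' := by
    intro g₁ g₂ h₁ h₂
    obtain ⟨N₁, h₁⟩ := h₁.exists_level hG
    obtain ⟨N₂, h₂⟩ := h₂.exists_level hG
    refine IsLevelTable.hasTable (N := N₂ + N₁) hG fun v hv => ?_
    obtain ⟨u, k, hu, e⟩ := h₂.add hG N₁ v hv
    obtain ⟨u', k', -, e'⟩ := h₁.add hG (u.length - N₁) u (by omega)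
    refine ⟨u', k' * k, fun w => ?_⟩
    rw [Homeomorph.mul_apply, e, e', hG.infAct_mul]
  inv_mem' := by
    rintro g ⟨A₁, A₂, hA₁, hA₂, α, c, e⟩
    refine ⟨A₂, A₁, hA₂, hA₁, α.symm, fun v => (c (α.symm v))⁻¹, fun v w => ?_⟩
    have h := e (α.symm v) (infAct (c (α.symm v))⁻¹ w)
    rw [← hG.infAct_mul, mul_inv_cancel, hG.infAct_one, α.apply_symm_apply] at h
    exact (g.symm_apply_eq).2 h.symm

end SelfSimilar

namespace PreimageTree

open scoped unitInterval

/-- The boundary `∂T_t` of the tree of preimages of `t`, whose `n`-th level is `f⁻ⁿ(t)` and in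
which `f v` is the parent of `v`: the set of infinite paths `w 0 = t, w 1, w 2, …`. -/
@[ext]
structure Boundary {M : Type*} (f : M → M) (t : M) where
  vertex : ℕ → M
  vertex_zero : vertex 0 = t
  map_vertex_succ : ∀ n, f (vertex (n + 1)) = vertex n

variable {M : Type*}

/-- The topology of the inverse limit of the levels `f⁻ⁿ(t)`, taken as discrete sets. -/
instance (f : M → M) (t : M) : TopologicalSpace (Boundary f t) :=
  ⨅ n : ℕ, TopologicalSpace.induced (fun w : Boundary f t => w.vertex n) ⊥

namespace Boundary

variable {f : M → M}

theorem iterate_apply {t : M} (w : Boundary f t) (n k : ℕ) : f^[k] (w.vertex (n + k)) = w.vertex n := by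
  induction k with
  | zero => rfl
  | succ k ih => rw [Function.iterate_succ_apply, ← Nat.add_assoc, w.map_vertex_succ, ih]

theorem iterate_apply_self {t : M} (w : Boundary f t) (k : ℕ) : f^[k] (w.vertex k) = t := by
  have := w.iterate_apply 0 k
  rwa [Nat.zero_add, w.vertex_zero] at this

/-- The inclusion `∂T_v ⊆ ∂T_t` for a vertex `v ∈ f⁻ⁿ(t)` of the `n`-th level of `T_t`: the
infinite path `z` from `v` is extended by the path `t, …, f (f v), f v, v` from the root. -/
def graft {t v : M} (n : ℕ) (hv : f^[n] v = t) (z : Boundary f v) : Boundary f t :=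
  ⟨fun j => f^[n - j] (z.vertex (j - n)), by simpa [z.vertex_zero] using hv, fun j => by
    rw [← Function.iterate_succ_apply' f]
    rcases Nat.lt_or_ge j n with h | h
    · rw [show j + 1 - n = j - n by omega, show (n - (j + 1)).succ = n - j by omega]
    · rw [show n - (j + 1) = 0 by omega, show n - j = 0 by omega,
        show j + 1 - n = (j - n) + 1 by omega]
      exact z.map_vertex_succ _⟩

theorem graft_apply_self {t v : M} (n : ℕ) (hv : f^[n] v = t) (z : Boundary f v) :
    (graft n hv z).vertex n = v := by
  simp [graft, z.vertex_zero]

/-- The part of an infinite path that starts in its `n`-th vertex. -/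
def tail {t : M} (w : Boundary f t) (n : ℕ) : Boundary f (w.vertex n) :=
  ⟨fun k => w.vertex (n + k), rfl, fun k => w.map_vertex_succ (n + k)⟩

theorem graft_tail {t : M} (w : Boundary f t) (n : ℕ) :
    graft n (w.iterate_apply_self n) (w.tail n) = w := by
  apply Boundary.ext
  funext j
  show f^[n - j] (w.vertex (n + (j - n))) = w.vertex j
  rw [show n + (j - n) = j + (n - j) by omega, iterate_apply]

theorem graft_zero {t : M} (w : Boundary f t) : graft 0 rfl w = w :=
  Boundary.ext <| funext fun j => by simp [graft]

theorem graft_graft {t v u : M} {n k m : ℕ} (hv : f^[n] v = t) (hu : f^[k] u = v)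
    (hm : m = n + k) (h : f^[m] u = t) (z : Boundary f u) :
    graft n hv (graft k hu z) = graft m h z := by
  subst hm
  apply Boundary.ext
  funext j
  show f^[n - j] (f^[k - (j - n)] (z.vertex (j - n - k))) = f^[n + k - j] (z.vertex (j - (n + k)))
  rw [← Function.iterate_add_apply, show n - j + (k - (j - n)) = n + k - j by omega,
    Nat.sub_sub]

end Boundary

open Boundary

variable [TopologicalSpace M] {f : M → M}

theorem exists_lift_iterate (hf : IsCoveringMap f) (k : ℕ) (γ : C(I, M)) (z : M)
    (hz : γ 0 = f^[k] z) : ∃ Γ : C(I, M), (∀ s, f^[k] (Γ s) = γ s) ∧ Γ 0 = z := by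
  induction k generalizing z with
  | zero => exact ⟨γ, fun _ => rfl, hz⟩
  | succ k ih =>
    obtain ⟨Γ, h1, h2⟩ := ih (f z) hz
    obtain ⟨Δ, h3, h4⟩ := hf.exists_path_lifts Γ z h2
    refine ⟨Δ, fun s => ?_, h4⟩
    rw [Function.iterate_succ_apply, ← h1]
    exact congrArg _ (congrFun h3 s)

theorem lift_iterate_unique (hf : IsCoveringMap f) (k : ℕ) {Γ Δ : C(I, M)}
    (h : ∀ s, f^[k] (Γ s) = f^[k] (Δ s)) (h0 : Γ 0 = Δ 0) : Γ = Δ := by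
  induction k generalizing Γ Δ with
  | zero => exact ContinuousMap.ext h
  | succ k ih =>
    have hc := hf.continuous
    have h1 := ih (Γ := ⟨fun s => f (Γ s), by fun_prop⟩) (Δ := ⟨fun s => f (Δ s), by fun_prop⟩)
      h (congrArg f h0)
    have h2 := hf.eq_of_comp_eq Γ.continuous Δ.continuous
      (funext fun s => DFunLike.congr_fun h1 s) 0 h0
    exact DFunLike.coe_injective h2

/-- The lift of the path `γ` by the `k`-th iteration of `f` starting in `z`. -/
noncomputable def liftIterate (hf : IsCoveringMap f) (k : ℕ) {v u : M} (γ : Path v u) (z : M)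
    (hz : f^[k] z = v) : C(I, M) :=
  (exists_lift_iterate hf k γ.toContinuousMap z (γ.source.trans hz.symm)).choose

theorem iterate_liftIterate (hf : IsCoveringMap f) (k : ℕ) {v u : M} (γ : Path v u) (z : M)
    (hz : f^[k] z = v) (s : I) : f^[k] (liftIterate hf k γ z hz s) = γ s :=
  (exists_lift_iterate hf k γ.toContinuousMap z (γ.source.trans hz.symm)).choose_spec.1 s

theorem liftIterate_zero (hf : IsCoveringMap f) (k : ℕ) {v u : M} (γ : Path v u) (z : M)
    (hz : f^[k] z = v) : liftIterate hf k γ z hz 0 = z :=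
  (exists_lift_iterate hf k γ.toContinuousMap z (γ.source.trans hz.symm)).choose_spec.2

theorem liftIterate_eq (hf : IsCoveringMap f) (k : ℕ) {v u : M} (γ : Path v u) (z : M)
    (hz : f^[k] z = v) {Γ : C(I, M)} (h : ∀ s, f^[k] (Γ s) = γ s) (h0 : Γ 0 = z) :
    liftIterate hf k γ z hz = Γ :=
  lift_iterate_unique hf k (fun s => (iterate_liftIterate hf k γ z hz s).trans (h s).symm)
    ((liftIterate_zero hf k γ z hz).trans h0.symm)

/-- The map `S_γ : ∂T_v → ∂T_u` for a path `γ` from `v` to `u`: the vertex `z k ∈ f⁻ᵏ(v)` is sent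
to the end of the lift of `γ` by the `k`-th iteration of `f` starting in `z k`. -/
noncomputable def transport (hf : IsCoveringMap f) {v u : M} (γ : Path v u)
    (z : Boundary f v) : Boundary f u :=
  ⟨fun k => liftIterate hf k γ (z.vertex k) (z.iterate_apply_self k) 1,
    (iterate_liftIterate hf 0 γ (z.vertex 0) (z.iterate_apply_self 0) 1).trans γ.target, fun k => by
      have hc := hf.continuous
      have h := liftIterate_eq hf k γ (z.vertex k) (z.iterate_apply_self k)
        (Γ := ⟨fun s => f (liftIterate hf (k + 1) γ _ (z.iterate_apply_self (k + 1)) s),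
          by fun_prop⟩)
        (fun s => iterate_liftIterate hf (k + 1) γ _ (z.iterate_apply_self (k + 1)) s)
        ((congrArg f (liftIterate_zero hf (k + 1) γ _ (z.iterate_apply_self (k + 1)))).trans
          (z.map_vertex_succ k))
      exact (DFunLike.congr_fun h 1).symm⟩

theorem transport_apply (hf : IsCoveringMap f) {v u : M} (γ : Path v u) (z : Boundary f v)
    (k : ℕ) {Γ : C(I, M)} (h : ∀ s, f^[k] (Γ s) = γ s) (h0 : Γ 0 = z.vertex k) :
    (transport hf γ z).vertex k = Γ 1 :=
  DFunLike.congr_fun (liftIterate_eq hf k γ (z.vertex k) (z.iterate_apply_self k) h h0) 1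

theorem transport_refl (hf : IsCoveringMap f) {v : M} (z : Boundary f v) :
    transport hf (Path.refl v) z = z :=
  Boundary.ext <| funext fun k => transport_apply hf _ z k
    (Γ := ContinuousMap.const I (z.vertex k)) (fun _ => z.iterate_apply_self k) rfl

theorem transport_symm (hf : IsCoveringMap f) {v u : M} (γ : Path v u) (z : Boundary f u) :
    transport hf γ (transport hf γ.symm z) = z := by
  refine Boundary.ext <| funext fun k => ?_
  set Γ := liftIterate hf k γ.symm (z.vertex k) (z.iterate_apply_self k) with hΓ
  rw [transport_apply hf γ _ k (Γ := ⟨fun s => Γ (σ s), by fun_prop⟩)]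
  · show Γ (σ 1) = _
    rw [unitInterval.symm_one, hΓ, liftIterate_zero]
  · intro s
    show f^[k] (Γ (σ s)) = γ s
    rw [hΓ, iterate_liftIterate]
    show γ (σ (σ s)) = γ s
    rw [unitInterval.symm_symm]
  · show Γ (σ 0) = _
    rw [unitInterval.symm_zero]
    rfl

theorem transport_trans (hf : IsCoveringMap f) {v u x : M} (γ : Path v u) (δ : Path u x)
    (z : Boundary f v) :
    transport hf (γ.trans δ) z = transport hf δ (transport hf γ z) := by
  refine Boundary.ext <| funext fun k => ?_
  let y := transport hf γ z
  let Γ : Path (z.vertex k) (y.vertex k) :=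
    ⟨liftIterate hf k γ (z.vertex k) (z.iterate_apply_self k), liftIterate_zero .., rfl⟩
  let Δ : Path (y.vertex k) ((transport hf δ y).vertex k) :=
    ⟨liftIterate hf k δ (y.vertex k) (y.iterate_apply_self k), liftIterate_zero .., rfl⟩
  rw [transport_apply hf (γ.trans δ) z k (Γ := (Γ.trans Δ).toContinuousMap)]
  · exact (Γ.trans Δ).target
  · intro s
    show f^[k] ((Γ.trans Δ) s) = (γ.trans δ) s
    rw [Path.trans_apply, Path.trans_apply]
    split_ifs
    · exact iterate_liftIterate hf k γ _ (z.iterate_apply_self k) _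
    · exact iterate_liftIterate hf k δ _ (y.iterate_apply_self k) _
  · exact (Γ.trans Δ).source

theorem transport_graft (hf : IsCoveringMap f) {v u v' u' : M} (γ : Path v u) (γ' : Path v' u')
    (k : ℕ) (hv : f^[k] v' = v) (hu : f^[k] u' = u) (h : ∀ s, f^[k] (γ' s) = γ s)
    (z : Boundary f v') :
    transport hf γ (graft k hv z) = graft k hu (transport hf γ' z) := by
  refine Boundary.ext <| funext fun j => ?_
  set Γ := liftIterate hf (j - k) γ' (z.vertex (j - k)) (z.iterate_apply_self (j - k)) with hΓ
  have hc : Continuous f^[k - j] := hf.continuous.iterate _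
  rw [transport_apply hf γ _ j (Γ := ⟨fun s => f^[k - j] (Γ s), by fun_prop⟩)]
  · rfl
  · intro s
    show f^[j] (f^[k - j] (Γ s)) = γ s
    rw [← Function.iterate_add_apply, show j + (k - j) = k + (j - k) by omega,
      Function.iterate_add_apply, hΓ, iterate_liftIterate, h]
  · show f^[k - j] (Γ 0) = f^[k - j] (z.vertex (j - k))
    rw [hΓ, liftIterate_zero]

/-- On `∂T_v ⊆ ∂T_t`, where `v` is a vertex of level `n` of `T_t`, the map `g` is equal to
`S_γ : ∂T_v → ∂T_u ⊆ ∂T_t`, where `γ` is a path from `v` to a vertex `u` of level `m` of `T_t`. -/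
def EqTransportOn (hf : IsCoveringMap f) {t : M} (g : Boundary f t → Boundary f t)
    {n m : ℕ} {v u : M} (hv : f^[n] v = t) (hu : f^[m] u = t) (γ : Path v u) : Prop :=
  ∀ z : Boundary f v, g (graft n hv z) = graft m hu (transport hf γ z)

/-- `g` is locally equal to maps of the form `S_γ`: every `w ∈ ∂T_t` lies in a set `∂T_v` on
which `g` is equal to `S_γ : ∂T_v → ∂T_u` for a path `γ` between vertices `v`, `u` of `T_t`. -/
def IsLocallyTransport (hf : IsCoveringMap f) {t : M} (g : Boundary f t → Boundary f t) : Prop :=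
  ∀ w : Boundary f t, ∃ (n m : ℕ) (v u : M) (hv : f^[n] v = t) (hu : f^[m] u = t)
    (γ : Path v u), w ∈ Set.range (graft n hv) ∧ EqTransportOn hf g hv hu γ

theorem EqTransportOn.restrict {hf : IsCoveringMap f} {t : M} {g : Boundary f t → Boundary f t}
    {n m : ℕ} {v u : M} {hv : f^[n] v = t} {hu : f^[m] u = t} {γ : Path v u}
    (h : EqTransportOn hf g hv hu γ) (k : ℕ) {v' : M} (hk : f^[k] v' = v) {n' m' : ℕ}
    (hn : n' = n + k) (hm : m' = m + k) (hv' : f^[n'] v' = t) :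
    ∃ (u' : M) (hu' : f^[m'] u' = t) (γ' : Path v' u'), EqTransportOn hf g hv' hu' γ' := by
  let Γ := liftIterate hf k γ v' hk
  have hku : f^[k] (Γ 1) = u := (iterate_liftIterate hf k γ v' hk 1).trans γ.target
  have hu' : f^[m'] (Γ 1) = t := by rw [hm, Function.iterate_add_apply, hku, hu]
  let γ' : Path v' (Γ 1) := ⟨Γ, liftIterate_zero .., rfl⟩
  refine ⟨Γ 1, hu', γ', fun z => ?_⟩
  rw [← graft_graft hv hk hn hv', h, transport_graft hf γ γ' k hk hku
    (iterate_liftIterate hf k γ v' hk), graft_graft hu hku hm hu']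

/-- The group `V_f`: all homeomorphisms of `∂T_t` that are locally equal to homeomorphisms of the
form `S_γ : ∂T_v → ∂T_u`, where `γ` is a path connecting two vertices `v`, `u` of `T_t`. -/
def VF (hf : IsCoveringMap f) (t : M) : Subgroup (Boundary f t ≃ₜ Boundary f t) where
  carrier := {g | IsLocallyTransport hf g}
  one_mem' := fun w => ⟨0, 0, t, t, rfl, rfl, Path.refl t, ⟨w, graft_zero w⟩, fun z => by
    rw [transport_refl]; rfl⟩
  mul_mem' := by
    intro g₁ g₂ h₁ h₂ w
    obtain ⟨n₂, m₂, v₂, u₂, hv₂, hu₂, γ₂, ⟨z₂, rfl⟩, e₂⟩ := h₂ w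
    obtain ⟨n₁, m₁, v₁, u₁, hv₁, hu₁, γ₁, ⟨z₁, hz₁⟩, e₁⟩ := h₁ (g₂ (graft n₂ hv₂ z₂))
    have hk₂ := z₂.iterate_apply_self n₁
    have hk₁ := z₁.iterate_apply_self m₂
    have hv₂' : f^[n₂ + n₁] (z₂.vertex n₁) = t := by rw [Function.iterate_add_apply, hk₂, hv₂]
    have hv₁' : f^[n₁ + m₂] (z₁.vertex m₂) = t := by rw [Function.iterate_add_apply, hk₁, hv₁]
    obtain ⟨x₂, hx₂, δ₂, d₂⟩ := e₂.restrict n₁ hk₂ rfl (Nat.add_comm n₁ m₂) hv₂'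
    obtain ⟨x₁, hx₁, δ₁, d₁⟩ := e₁.restrict m₂ hk₁ rfl rfl hv₁'
    have hw₂ : graft (n₂ + n₁) hv₂' (z₂.tail n₁) = graft n₂ hv₂ z₂ := by
      rw [← graft_graft hv₂ hk₂ rfl hv₂', graft_tail]
    have hw₁ : graft (n₁ + m₂) hv₁' (z₁.tail m₂) = g₂ (graft n₂ hv₂ z₂) := by
      rw [← graft_graft hv₁ hk₁ rfl hv₁', graft_tail, hz₁]
    have hx : x₂ = z₁.vertex m₂ := by
      rw [← hw₂, d₂] at hw₁
      have := congrArg (fun y : Boundary f t => y.vertex (n₁ + m₂)) hw₁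
      simp only [graft_apply_self] at this
      exact this.symm
    subst hx
    refine ⟨_, _, _, _, hv₂', hx₁, δ₂.trans δ₁, ⟨_, hw₂⟩, fun z => ?_⟩
    rw [Homeomorph.mul_apply, d₂, d₁, transport_trans]
  inv_mem' := by
    intro g h w
    obtain ⟨n, m, v, u, hv, hu, γ, ⟨z, hz⟩, e⟩ := h (g.symm w)
    refine ⟨m, n, u, v, hu, hv, γ.symm, ⟨transport hf γ z, ?_⟩, fun y => ?_⟩
    · rw [← e, hz, g.apply_symm_apply]
    · have := e (transport hf γ.symm y)
      rw [transport_symm] at this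
      exact (g.symm_apply_eq).2 this.symm

/-- `f` is expanding: there are a metric on `M` (compatible with its topology), `L > 1`, `ε > 0`
and a positive integer `n` such that `|fⁿ(x) - fⁿ(y)| ≥ L |x - y|` whenever `|x - y| < ε`. -/
def IsExpanding (f : M → M) : Prop :=
  ∃ d : MetricSpace M, d.toUniformSpace.toTopologicalSpace = ‹TopologicalSpace M› ∧
    ∃ (L ε : ℝ) (n : ℕ), 1 < L ∧ 0 < ε ∧ 0 < n ∧
      ∀ x y : M, d.dist x y < ε → L * d.dist x y ≤ d.dist (f^[n] x) (f^[n] y)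

end PreimageTree

/-!
Both groups are treated as groups of permutations of a set `Ω` with a coding `e : X × Ω ≃ Ω` by a
finite alphabet `X`: the letters act by injections `Ω → Ω` whose images partition `Ω`, a word `v`
acts by `w ↦ vw`, and its image is the cone of `v`. A table consists of two finite partitions `A`,
`B` of `Ω` into cones and of rules `vw ↦ u m(w)`, `v ∈ A`, `u ∈ B`, where the label `m` is a
permutation of `Ω`. For infinite words the coding is the obvious one; for the boundary `∂T_t` of
the tree of preimages the alphabet is `f⁻¹(t)`, and the letter `x` acts by `S_ℓ : ∂T_t → ∂T_x`,
where `ℓ` is a chosen path from `t` to `x`.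

Contraction makes the labels finite. If `𝒢` is a contracting self-similar group of permutations,
then all sufficiently deep labels of a given element belong to a finite set `N` which contains `1`
and is closed under inverses and under passing to labels (`exists_isLabelSet_finite`), so every
element of the group is given by a table with labels in `N`. As `N` is not closed under products,
a product of tables with labels in `N` is only considered if its labels lie in `N` as well; any
two elements of the group have a product of this form after passing to finer partitions
(`exists_composable`).

The presentation is the partial multiplication table of the finite set of all tables with a fixed
large number of rows, `|A| = |B| = n`. By `Group.isFinitelyPresented_of_extends` it is enough to
extend a map `ψ`, multiplicative on tables with `n` rows, to a multiplicative map on tables with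
`n' = n + |X| - 1` rows, and so on. A table with `n'` rows that acts by one rule `pw ↦ q m(w)`, `m
∈ N`, on the parent `p` of a caret `{px | x ∈ X} ⊆ A` is also a table with `n` rows. A general
table `C → C`, for a partition `C` with many carets, is a product of two factors that fix a caret
each. The value of `ψ` on the product does not depend on the factorization, because there is
always a further caret that is disjoint from all carets in question and through which two
factorizations can be compared. The argument takes place in the permutational wreath product
(`LPerm.exists_extension`) and respects the restriction to labels in `N`, as the left factor can
be chosen without labels outside one caret. Finally, the tables `A → B` are carried to tables `C →
C` by charts without labels (`ConeTable.IsMultAt.exists_extension`). The same factorizations show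
that the tables with `n` rows generate (`ConeTable.tables_subset_closure`).

For an expanding covering `f` the group `𝒢` consists of the maps `S_γ` given by loops `γ` at `t`.
In a metric for which `f` itself is expanding, lifts of a path by high iterations of `f` are short
(`exists_hasShortLifts`), and every word is realized by a path whose lifts by a fixed iteration
`f^K` are uniformly short (`exists_isWordPath_hasShortLifts`). Therefore a deep label of `S_γ` is
given by one of finitely many paths, a short path, and the inverse of one of finitely many paths;
and `S_σ` depends only on the endpoints of a short path `σ` (`transport_eq_of_short`).
-/

/-! ### A criterion for finite presentability -/

/-- A group is finitely presented as soon as it is generated by a finite set `F` such that every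
map on `F` that respects the products that stay inside `F` extends to a homomorphism: the group is
then presented by its partial multiplication table on `F`. -/
theorem Group.isFinitelyPresented_of_extends.{u} {Γ : Type u} [Group Γ] {F : Set Γ}
    (hF : F.Finite) (hgen : Subgroup.closure F = ⊤)
    (hext : ∀ (H : Type u) [Group H] (ψ : Γ → H),
      (∀ a ∈ F, ∀ b ∈ F, a * b ∈ F → ψ (a * b) = ψ a * ψ b) →
        ∃ Ψ : Γ →* H, ∀ a ∈ F, Ψ a = ψ a) :
    Group.IsFinitelyPresented Γ := by
  classical
  have := hF.to_subtype
  let rel : F × F → FreeGroup F := fun p =>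
    if h : p.1.1 * p.2.1 ∈ F then
      .of p.1 * .of p.2 * (.of ⟨p.1.1 * p.2.1, h⟩)⁻¹ else 1
  have : Finite (Set.range rel) := Set.finite_range rel
  have hlift : ∀ r ∈ Set.range rel, FreeGroup.lift (fun a : F => a.1) r = 1 := by
    rintro _ ⟨p, rfl⟩
    by_cases h : p.1.1 * p.2.1 ∈ F <;> simp [rel, h]
  let π : PresentedGroup (Set.range rel) →* Γ := PresentedGroup.toGroup hlift
  obtain ⟨Ψ, hΨ⟩ := hext (PresentedGroup (Set.range rel))
    (fun a => if h : a ∈ F then PresentedGroup.of ⟨a, h⟩ else 1) (by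
      intro a ha b hb hab
      rw [dif_pos ha, dif_pos hb, dif_pos hab, eq_comm, ← mul_inv_eq_one]
      have : rel (⟨a, ha⟩, ⟨b, hb⟩) ∈ Set.range rel := ⟨_, rfl⟩
      have h1 := PresentedGroup.one_of_mem this
      simpa [rel, hab, PresentedGroup.of] using h1)
  have hleft : Ψ.comp π = MonoidHom.id _ := by
    ext a
    simp [π, hΨ a.1 a.2]
  have hsurj : Function.Surjective π := by
    rw [← MonoidHom.range_eq_top, eq_top_iff, ← hgen, Subgroup.closure_le]
    exact fun a ha => ⟨PresentedGroup.of ⟨a, ha⟩, by simp [π]⟩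
  have hinj : Function.Injective π :=
    Function.LeftInverse.injective (g := Ψ) fun x => DFunLike.congr_fun hleft x
  exact Group.IsFinitelyPresented.equiv (MulEquiv.ofBijective π ⟨hinj, hsurj⟩)

/-! ### Labelled permutations -/

/-- A permutation of `S` whose arrows carry labels in `𝒢`; an element of the permutational wreath
product of `𝒢` with the symmetric group of `S`. -/
@[ext]
structure LPerm (S 𝒢 : Type*) where
  perm : Equiv.Perm S
  lab : S → 𝒢

namespace LPerm

variable {S 𝒢 H I : Type*}

/-- `g` and `h` agree on `T`, including the labels. -/
def AgreeOn (g h : LPerm S 𝒢) (T : Finset S) : Prop :=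
  ∀ s ∈ T, g.perm s = h.perm s ∧ g.lab s = h.lab s

theorem AgreeOn.symm {g h : LPerm S 𝒢} {T : Finset S} (hgh : g.AgreeOn h T) : h.AgreeOn g T :=
  fun s hs => ⟨(hgh s hs).1.symm, (hgh s hs).2.symm⟩

theorem AgreeOn.trans {g h k : LPerm S 𝒢} {T : Finset S} (hgh : g.AgreeOn h T)
    (hhk : h.AgreeOn k T) : g.AgreeOn k T :=
  fun s hs => ⟨(hgh s hs).1.trans (hhk s hs).1, (hgh s hs).2.trans (hhk s hs).2⟩

theorem AgreeOn.mono {g h : LPerm S 𝒢} {T T' : Finset S} (hgh : g.AgreeOn h T) (hT : T' ⊆ T) :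
    g.AgreeOn h T' := fun s hs => hgh s (hT hs)

variable [Group 𝒢] [Group H]

instance : Mul (LPerm S 𝒢) := ⟨fun g h => ⟨g.perm * h.perm, fun s => g.lab (h.perm s) * h.lab s⟩⟩

instance : One (LPerm S 𝒢) := ⟨⟨1, fun _ => 1⟩⟩

instance : Inv (LPerm S 𝒢) := ⟨fun g => ⟨g.perm⁻¹, fun s => (g.lab (g.perm.symm s))⁻¹⟩⟩

@[simp] theorem mul_perm (g h : LPerm S 𝒢) : (g * h).perm = g.perm * h.perm := rfl

@[simp] theorem mul_lab (g h : LPerm S 𝒢) (s : S) :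
    (g * h).lab s = g.lab (h.perm s) * h.lab s := rfl

@[simp] theorem one_perm : (1 : LPerm S 𝒢).perm = 1 := rfl

@[simp] theorem one_lab (s : S) : (1 : LPerm S 𝒢).lab s = 1 := rfl

@[simp] theorem inv_perm (g : LPerm S 𝒢) : g⁻¹.perm = g.perm⁻¹ := rfl

@[simp] theorem inv_lab (g : LPerm S 𝒢) (s : S) : g⁻¹.lab s = (g.lab (g.perm.symm s))⁻¹ := rfl

instance : Group (LPerm S 𝒢) :=
  Group.ofLeftAxioms
    (fun g h k => LPerm.ext (mul_assoc _ _ _) (funext fun s => by simp [mul_assoc]))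
    (fun g => LPerm.ext (one_mul _) (funext fun s => by simp))
    (fun g => LPerm.ext (inv_mul_cancel _) (funext fun s => by simp))

/-- The labels of `g` lie in `N`. -/
def LabelsIn (N : Set 𝒢) (g : LPerm S 𝒢) : Prop := ∀ s, g.lab s ∈ N

/-- `g` fixes all points of `T` and has trivial labels there. -/
def TrivOn (g : LPerm S 𝒢) (T : Finset S) : Prop := ∀ s ∈ T, g.perm s = s ∧ g.lab s = 1

theorem TrivOn.mono {g : LPerm S 𝒢} {T T' : Finset S} (h : g.TrivOn T) (hT : T' ⊆ T) :
    g.TrivOn T' := fun s hs => h s (hT hs)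

theorem TrivOn.mul {g h : LPerm S 𝒢} {T : Finset S} (hg : g.TrivOn T) (hh : h.TrivOn T) :
    (g * h).TrivOn T := fun s hs => by
  simp [(hh s hs).1, (hg s hs).1, (hh s hs).2, (hg s hs).2]

theorem TrivOn.inv {g : LPerm S 𝒢} {T : Finset S} (hg : g.TrivOn T) : g⁻¹.TrivOn T :=
  fun s hs => by
    have h1 : g.perm.symm s = s := by rw [Equiv.symm_apply_eq, (hg s hs).1]
    exact ⟨h1, by rw [inv_lab, h1, (hg s hs).2, inv_one]⟩

theorem AgreeOn.trivOn {g h : LPerm S 𝒢} {T : Finset S} (hgh : g.AgreeOn h T) :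
    (g⁻¹ * h).TrivOn T := fun s hs => by
  obtain ⟨h1, h2⟩ := hgh s hs
  simp [← h1, h2]

theorem AgreeOn.mul_right {g h : LPerm S 𝒢} {T : Finset S} (hh : h.TrivOn T) :
    (g * h).AgreeOn g T := fun s hs => by
  obtain ⟨h1, h2⟩ := hh s hs
  simp [h1, h2]

/-- On `T`, where `g` and `h` agree, the labels of `g⁻¹ * h` are trivial; elsewhere they are the
labels of `h`, since `h` does not map other points to the image of `T` under `g`. -/
theorem LabelsIn.inv_mul {N : Set 𝒢} {g h : LPerm S 𝒢} {T : Finset S} (hN : 1 ∈ N)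
    (hh : h.LabelsIn N) (hgh : g.AgreeOn h T) (hg : ∀ s ∉ T, g.lab s = 1) :
    (g⁻¹ * h).LabelsIn N := by
  intro s
  by_cases hs : s ∈ T
  · rw [(hgh.trivOn s hs).2]
    exact hN
  · have h1 : g.perm.symm (h.perm s) ∉ T := by
      intro hT
      have h2 := (hgh _ hT).1
      rw [Equiv.apply_symm_apply] at h2
      rw [← h.perm.injective h2] at hT
      exact hs hT
    simpa [hg _ h1] using hh s

/-- A partial labelled permutation that agrees with `g` on `P` and is trivial on `Q` extends to all
of `S` without further labels. -/
theorem exists_agreeOn_trivOn [Fintype S] [DecidableEq S] (g : LPerm S 𝒢) {P Q : Finset S}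
    (hPQ : Disjoint P Q) (hg : Disjoint (P.image g.perm) Q) :
    ∃ k : LPerm S 𝒢, k.AgreeOn g P ∧ k.TrivOn Q ∧ ∀ s ∉ P, k.lab s = 1 := by
  obtain ⟨β, hβ⟩ := Finset.exists_equiv_extend_of_card_eq (α := S) (t := (Finset.univ : Finset S))
    (s := P ∪ Q) (f := fun s => if s ∈ P then g.perm s else s) (by simp) (by simp) (by
      intro a ha b hb hab
      have hPg : ∀ s ∈ P, g.perm s ∉ Q := fun s hs hQ =>
        Finset.disjoint_left.1 hg (Finset.mem_image_of_mem _ hs) hQ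
      simp only [Finset.coe_union, Set.mem_union, Finset.mem_coe] at ha hb
      by_cases h1 : a ∈ P <;> by_cases h2 : b ∈ P <;> simp only [h1, h2, if_true, if_false] at hab
      · exact g.perm.injective hab
      · exact absurd (hab ▸ hb.resolve_left h2) (hPg a h1)
      · exact absurd (hab ▸ ha.resolve_left h1) (hPg b h2)
      · exact hab)
  refine ⟨⟨β.trans (Equiv.subtypeUnivEquiv (fun _ => Finset.mem_univ _)),
    fun s => if s ∈ P then g.lab s else 1⟩, fun s hs => ?_, fun s hs => ?_, fun s hs => ?_⟩
  · have := hβ s (Finset.mem_union_left _ hs)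
    simpa [hs] using this
  · have h1 : s ∉ P := fun h => Finset.disjoint_left.1 hPQ h hs
    have := hβ s (Finset.mem_union_right _ hs)
    simpa [h1] using this
  · simp [hs]

/-- An `N`-labelled permutation `g` is the product of `k⁻¹ * g`, which is trivial on `P`, and of a
factor `k` that is trivial on `Q`. -/
theorem LabelsIn.exists_agreeOn [Fintype S] [DecidableEq S] {N : Set 𝒢} (hN : 1 ∈ N)
    {g : LPerm S 𝒢} (hg : g.LabelsIn N) (P Q : Finset S) (hPQ : Disjoint P Q)
    (hgPQ : Disjoint (P.image g.perm) Q) :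
    ∃ k : LPerm S 𝒢, LabelsIn N k ∧ LabelsIn N (k⁻¹ * g) ∧ k.AgreeOn g P ∧ k.TrivOn Q ∧
      ∀ s ∉ P, k.lab s = 1 := by
  obtain ⟨k, h1, h2, h3⟩ := exists_agreeOn_trivOn g hPQ hgPQ
  refine ⟨k, fun s => ?_, hg.inv_mul hN h1 h3, h1, h2, h3⟩
  by_cases hs : s ∈ P
  · rw [(h1 s hs).2]; exact hg s
  · rw [h3 s hs]; exact hN

/-- Among more than `|T| + |E|` disjoint blocks, one is disjoint from `T` and not listed in `E`. -/
theorem exists_disjoint_block [Fintype I] [DecidableEq S] [DecidableEq I] {blk : I → Finset S}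
    (hdisj : Pairwise fun i j => Disjoint (blk i) (blk j)) (T : Finset S) (E : Finset I)
    (h : T.card + E.card < Fintype.card I) : ∃ j ∉ E, Disjoint (blk j) T := by
  by_contra! hno
  have h1 : ∀ j : I, ∃ s, j ∉ E → s ∈ blk j ∧ s ∈ T := fun j => by
    by_cases hj : j ∈ E
    · rcases isEmpty_or_nonempty S with h0 | ⟨⟨s⟩⟩
      · have hT : T = ∅ := Finset.eq_empty_of_isEmpty T
        have : E.card < (Finset.univ : Finset I).card := by
          rw [Finset.card_univ]; omega
        obtain ⟨k, -, hk⟩ := Finset.exists_mem_notMem_of_card_lt_card this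
        exact absurd (by rw [hT]; exact Finset.disjoint_empty_right _) (hno k hk)
      · exact ⟨s, fun h => absurd hj h⟩
    · obtain ⟨s, hs⟩ := Finset.not_disjoint_iff.1 (hno j hj)
      exact ⟨s, fun _ => hs⟩
  choose s hs using h1
  have h2 : (Finset.univ \ E).card ≤ T.card :=
    Finset.card_le_card_of_injOn s
      (fun j hj => (hs j (by simpa using hj)).2) (by
        intro i hi j hj hij
        by_contra hne
        exact Finset.disjoint_left.1 (hdisj hne) (hs i (by simpa using hi)).1
          (hij ▸ (hs j (by simpa using hj)).1))
  rw [Finset.card_sdiff_of_subset (Finset.subset_univ E), Finset.card_univ] at h2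
  omega

/-- A map that is multiplicative on the `N`-labelled permutations that are trivial on `blk i`,
for each of sufficiently many disjoint blocks of at most `d` points, extends from these
permutations to a map that is multiplicative on all `N`-labelled permutations. The extension sends
`g = b * a`, with `a` trivial on one block and `b` trivial on another one, to `ψ b * ψ a`; the
number of blocks leaves room for a block that is in general position to those of two
factorizations. -/
theorem exists_extension [Fintype S] [DecidableEq S] [Fintype I] [DecidableEq I]
    {N : Set 𝒢} (hN : 1 ∈ N)
    {blk : I → Finset S} (hdisj : Pairwise fun i j => Disjoint (blk i) (blk j)) {d : ℕ}
    (hd : ∀ i, (blk i).card ≤ d) (hI : 2 * d + 3 ≤ Fintype.card I) {ψ : LPerm S 𝒢 → H}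
    (hψ : ∀ i g h, LabelsIn N g → LabelsIn N h → LabelsIn N (h * g) → TrivOn g (blk i) →
      TrivOn h (blk i) → ψ (h * g) = ψ h * ψ g) :
    ∃ ρ : LPerm S 𝒢 → H,
      (∀ g h, LabelsIn N g → LabelsIn N h → LabelsIn N (h * g) → ρ (h * g) = ρ h * ρ g) ∧
      (∀ i g, LabelsIn N g → TrivOn g (blk i) → ρ g = ψ g) := by
  classical
  have himg : ∀ (g : LPerm S 𝒢) (P : Finset S), (P.image g.perm).card = P.card := fun g P =>
    Finset.card_image_of_injective _ g.perm.injective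
  -- two factorizations through the same pair of blocks
  have hsame : ∀ i j (a b a' b' : LPerm S 𝒢), b * a = b' * a' → LabelsIn N a → LabelsIn N b →
      LabelsIn N a' → LabelsIn N b' → TrivOn a (blk i) → TrivOn a' (blk i) → TrivOn b (blk j) →
      TrivOn b' (blk j) → (∀ s ∉ blk i, b'.lab s = 1) → ψ b * ψ a = ψ b' * ψ a' := by
    intro i j a b a' b' he ha hb ha' hb' ta ta' tb tb' hlab
    have hag : b'.AgreeOn b (blk i) :=
      (AgreeOn.mul_right ta').symm.trans (he ▸ AgreeOn.mul_right ta)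
    have hm := hb.inv_mul hN hag hlab
    have h1 : ψ b = ψ b' * ψ (b'⁻¹ * b) := by
      rw [← hψ j _ _ hm hb' (by rwa [mul_inv_cancel_left]) (tb'.inv.mul tb) tb',
        mul_inv_cancel_left]
    have h2 : a' = (b'⁻¹ * b) * a := by rw [mul_assoc, he, inv_mul_cancel_left]
    rw [h1, mul_assoc, ← hψ i _ _ ha hm (h2 ▸ ha') ta hag.trivOn, ← h2]
  -- the image of a block is disjoint from the block fixed by the left factor
  have hoff : ∀ i j (a b : LPerm S 𝒢), i ≠ j → TrivOn a (blk i) → TrivOn b (blk j) →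
      Disjoint ((blk i).image (b * a).perm) (blk j) := by
    intro i j a b hij ta tb
    rw [Finset.disjoint_left]
    intro s hs hsj
    obtain ⟨s', hs', rfl⟩ := Finset.mem_image.1 hs
    rw [mul_perm, Equiv.Perm.mul_apply, (ta s' hs').1] at hsj
    have h1 := (tb _ hsj).1
    rw [b.perm.injective h1] at hsj
    exact Finset.disjoint_left.1 (hdisj hij) hs' hsj
  have huniq : ∀ i j i' j' (a b a' b' : LPerm S 𝒢), i ≠ j → i' ≠ j' → b * a = b' * a' →
      LabelsIn N (b * a) → LabelsIn N a → LabelsIn N b → LabelsIn N a' → LabelsIn N b' →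
      TrivOn a (blk i) → TrivOn b (blk j) → TrivOn a' (blk i') → TrivOn b' (blk j') →
      ψ b * ψ a = ψ b' * ψ a' := by
    intro i j i' j' a b a' b' hij hij' he hg ha hb ha' hb' ta tb ta' tb'
    set g := b * a with hgdef
    obtain ⟨l, hl, hl'⟩ := exists_disjoint_block hdisj
      ((blk i).image g.perm ∪ (blk i').image g.perm) {i, i'} (by
        have h1 := Finset.card_union_le ((blk i).image g.perm) ((blk i').image g.perm)
        have h2 := Finset.card_le_two (a := i) (b := i')
        have h3 := hd i
        have h4 := hd i'
        rw [himg, himg] at h1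
        omega)
    rw [Finset.mem_insert, Finset.mem_singleton, not_or] at hl
    rw [Finset.disjoint_union_right] at hl'
    obtain ⟨m, hm, hm', mag, mtriv, -⟩ := hg.exists_agreeOn hN (blk i ∪ blk i') (blk l)
      (Finset.disjoint_union_left.2 ⟨hdisj (Ne.symm hl.1), hdisj (Ne.symm hl.2)⟩)
      (by rw [Finset.image_union]; exact Finset.disjoint_union_left.2 ⟨hl'.1.symm, hl'.2.symm⟩)
    -- a factorization through `i`, `j` agrees with the one given by `m`
    have hside : ∀ i j (a b : LPerm S 𝒢), i ≠ j → l ≠ i → Disjoint (blk l) ((blk i).image g.perm) →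
        m.AgreeOn g (blk i) → b * a = g → LabelsIn N a → LabelsIn N b →
        TrivOn a (blk i) → TrivOn b (blk j) → ψ b * ψ a = ψ m * ψ (m⁻¹ * g) := by
      intro i j a b hij hli hl' mag he ha hb ta tb
      have h1 := hoff i j a b hij ta tb
      rw [he] at h1
      obtain ⟨n, hn, hn', nag, ntriv, nlab⟩ := hg.exists_agreeOn hN (blk i) (blk j ∪ blk l)
        (Finset.disjoint_union_right.2 ⟨hdisj hij, hdisj hli.symm⟩)
        (Finset.disjoint_union_right.2 ⟨h1, hl'.symm⟩)
      rw [hsame i j a b (n⁻¹ * g) n (by rw [he, mul_inv_cancel_left]) ha hb hn' hn ta nag.trivOn tb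
        (ntriv.mono Finset.subset_union_left) nlab,
        hsame i l (m⁻¹ * g) m (n⁻¹ * g) n (by simp) hm' hm hn' hn
          mag.trivOn nag.trivOn mtriv (ntriv.mono Finset.subset_union_right) nlab]
    rw [hside i j a b hij hl.1 hl'.1 (mag.mono Finset.subset_union_left) rfl ha hb ta tb,
      hside i' j' a' b' hij' hl.2 hl'.2 (mag.mono Finset.subset_union_right) he.symm ha' hb' ta'
        tb']
  have hexists : ∀ g : LPerm S 𝒢, LabelsIn N g → ∀ i, ∃ j, i ≠ j ∧
      Disjoint ((blk i).image g.perm) (blk j) := by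
    intro g hg i
    obtain ⟨j, hj, hj'⟩ := exists_disjoint_block hdisj ((blk i).image g.perm) {i} (by
      rw [himg, Finset.card_singleton]
      have := hd i
      omega)
    exact ⟨j, fun h => hj (by simp [h]), hj'.symm⟩
  have hinh : Nonempty I := Fintype.card_pos_iff.1 (by omega)
  obtain ⟨i₀⟩ := hinh
  have hval : ∀ g : LPerm S 𝒢, ∃ x : H, ∀ i j (a b : LPerm S 𝒢), i ≠ j → b * a = g →
      LabelsIn N g → LabelsIn N a → LabelsIn N b → TrivOn a (blk i) → TrivOn b (blk j) →
      x = ψ b * ψ a := by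
    intro g
    by_cases hg : LabelsIn N g
    · obtain ⟨j, hij, hj⟩ := hexists g hg i₀
      obtain ⟨k, hk, hk', kag, ktriv, -⟩ := hg.exists_agreeOn hN (blk i₀) (blk j) (hdisj hij) hj
      refine ⟨ψ k * ψ (k⁻¹ * g), fun i' j' a b hij' he _ ha hb ta tb => ?_⟩
      exact huniq i₀ j i' j' _ _ a b hij hij' (by simp [he]) (by simpa using hg) hk' hk ha hb
        kag.trivOn ktriv ta tb
    · exact ⟨1, fun _ _ _ _ _ _ h => absurd h hg⟩
  choose ρ hρ using hval
  have htriv1 : ∀ T : Finset S, TrivOn (1 : LPerm S 𝒢) T := fun T s _ => ⟨rfl, rfl⟩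
  have hlab1 : LabelsIn N (1 : LPerm S 𝒢) := fun _ => hN
  have hψ1 : ψ 1 = 1 := by
    have := hψ i₀ 1 1 hlab1 hlab1 (by simpa using hlab1) (htriv1 _) (htriv1 _)
    simpa using this
  have hρψ : ∀ i g, LabelsIn N g → TrivOn g (blk i) → ρ g = ψ g := by
    intro i g hg tg
    obtain ⟨j, hij, -⟩ := hexists g hg i
    rw [hρ g i j g 1 hij (one_mul g) hg hg hlab1 tg (htriv1 _), hψ1, one_mul]
  have hleft : ∀ j g h, LabelsIn N g → LabelsIn N h → LabelsIn N (h * g) → TrivOn h (blk j) →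
      ρ (h * g) = ψ h * ρ g := by
    intro j g h hg hh hhg th
    obtain ⟨i, hi, hi'⟩ := exists_disjoint_block hdisj ((blk j).image g.perm.symm) {j} (by
      rw [Finset.card_image_of_injective _ g.perm.symm.injective, Finset.card_singleton]
      have := hd j
      omega)
    have hij : i ≠ j := fun h => hi (by simp [h])
    have hdis : Disjoint ((blk i).image g.perm) (blk j) := by
      rw [Finset.disjoint_left]
      rintro _ hs hsj
      obtain ⟨s, hs', rfl⟩ := Finset.mem_image.1 hs
      exact Finset.disjoint_left.1 hi' hs' (Finset.mem_image.2 ⟨_, hsj, by simp⟩)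
    obtain ⟨k, hk, hk', kag, ktriv, klab⟩ := hg.exists_agreeOn hN (blk i) (blk j) (hdisj hij) hdis
    have hhk : LabelsIn N (h * k) := by
      intro s
      by_cases hs : s ∈ blk i
      · have := hhg s
        rw [mul_lab] at this ⊢
        rwa [(kag s hs).1, (kag s hs).2]
      · rw [mul_lab, klab s hs, mul_one]
        exact hh _
    rw [hρ g i j (k⁻¹ * g) k hij (by simp) hg hk' hk kag.trivOn ktriv,
      hρ (h * g) i j (k⁻¹ * g) (h * k) hij (by simp [mul_assoc]) hhg hk' hhk kag.trivOn
        (th.mul ktriv), hψ j k h hk hh hhk ktriv th, mul_assoc]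
  refine ⟨ρ, fun g h hg hh hhg => ?_, hρψ⟩
  obtain ⟨j, hij, hj⟩ := hexists h hh i₀
  obtain ⟨k, hk, hk', kag, ktriv, klab⟩ := hh.exists_agreeOn hN (blk i₀) (blk j) (hdisj hij) hj
  have hkg : LabelsIn N (k⁻¹ * h * g) := by
    intro s
    by_cases hs : g.perm s ∈ blk i₀
    · rw [mul_lab, (kag.trivOn _ hs).2, one_mul]
      exact hg s
    · have h1 : k.perm.symm (h.perm (g.perm s)) ∉ blk i₀ := by
        intro hT
        have h2 := (kag _ hT).1
        rw [Equiv.apply_symm_apply] at h2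
        rw [← h.perm.injective h2] at hT
        exact hs hT
      have := hhg s
      simpa [klab _ h1] using this
  have h1 : h * g = k * (k⁻¹ * h * g) := by simp [mul_assoc]
  rw [h1, hleft j _ k hkg hk (h1 ▸ hhg) ktriv, hleft i₀ g _ hg hk' hkg kag.trivOn,
    hρ h i₀ j (k⁻¹ * h) k hij (by simp) hh hk' hk kag.trivOn ktriv, mul_assoc]

end LPerm

/-! ### Cones and tables -/

namespace ConeTable

section Basic

variable {X Ω : Type*} (e : X × Ω ≃ Ω)

/-- The injection `Ω → Ω` given by a word, when the bijection `e : X × Ω ≃ Ω` lets every letter act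
by an injection and the images of the letters partition `Ω`. Its image is the cone of the word. -/
def word : List X → Ω → Ω
  | [], w => w
  | x :: v, w => e (x, word v w)

@[simp] theorem word_nil (w : Ω) : word e [] w = w := rfl

theorem word_append (u v : List X) (w : Ω) : word e (u ++ v) w = word e u (word e v w) := by
  induction u with
  | nil => rfl
  | cons x u ih => simp [word, ih]

theorem word_injective (v : List X) : Function.Injective (word e v) := by
  induction v with
  | nil => exact fun _ _ h => h
  | cons x v ih =>
    intro a b h
    have := e.injective h
    exact ih (Prod.ext_iff.1 this).2

theorem word_eq_word {u v : List X} {z z' : Ω} (h : word e u z = word e v z') :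
    (∃ s, v = u ++ s ∧ z = word e s z') ∨ (∃ s, u = v ++ s ∧ z' = word e s z) := by
  induction u generalizing v with
  | nil => exact Or.inl ⟨v, rfl, h⟩
  | cons x u ih =>
    cases v with
    | nil => exact Or.inr ⟨x :: u, rfl, h.symm⟩
    | cons y v =>
      have h1 := Prod.ext_iff.1 (e.injective h)
      have hxy : x = y := h1.1
      subst hxy
      rcases ih h1.2 with ⟨s, rfl, hs⟩ | ⟨s, rfl, hs⟩
      · exact Or.inl ⟨s, rfl, hs⟩
      · exact Or.inr ⟨s, rfl, hs⟩

theorem word_eq_word_of_length {u v : List X} {z z' : Ω} (h : word e u z = word e v z')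
    (hl : u.length = v.length) : u = v ∧ z = z' := by
  have huv : u = v := by
    rcases word_eq_word e h with ⟨s, rfl, -⟩ | ⟨s, rfl, -⟩ <;> simpa using hl
  subst huv
  exact ⟨rfl, word_injective e _ h⟩

theorem exists_eq_word (k : ℕ) (w : Ω) : ∃ v z, v.length = k ∧ w = word e v z := by
  induction k generalizing w with
  | zero => exact ⟨[], w, rfl, rfl⟩
  | succ k ih =>
    obtain ⟨v, z, hv, hz⟩ := ih (e.symm w).2
    refine ⟨(e.symm w).1 :: v, z, by simp [hv], ?_⟩
    simp [word, ← hz]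

theorem eq_nil_of_forall_exists [Nonempty Ω] [Nontrivial X] {s : List X}
    (h : ∀ w, ∃ z, w = word e s z) : s = [] := by
  cases s with
  | nil => rfl
  | cons x s =>
    obtain ⟨y, hy⟩ := exists_ne x
    obtain ⟨w₀⟩ := ‹Nonempty Ω›
    obtain ⟨z, hz⟩ := h (e (y, w₀))
    exact absurd (Prod.ext_iff.1 (e.injective hz)).1 hy

/-- On the cone of `v`, the permutation `g` acts as `vw ↦ u m(w)`; the permutation `m` is the label
of `g` at `v`. -/
def At (g : Equiv.Perm Ω) (v u : List X) (m : Equiv.Perm Ω) : Prop :=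
  ∀ w, g (word e v w) = word e u (m w)

variable {e}

theorem At.one (v : List X) : At e 1 v v 1 := fun _ => rfl

theorem At.mul {g h m m' : Equiv.Perm Ω} {v u t : List X} (hg : At e g v u m)
    (hh : At e h u t m') : At e (h * g) v t (m' * m) := fun w => by
  rw [Equiv.Perm.mul_apply, hg, hh, Equiv.Perm.mul_apply]

theorem At.inv {g m : Equiv.Perm Ω} {v u : List X} (hg : At e g v u m) : At e g⁻¹ u v m⁻¹ :=
  fun w => by
    rw [Equiv.Perm.inv_eq_iff_eq, hg, ← Equiv.Perm.mul_apply, mul_inv_cancel, Equiv.Perm.one_apply]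

theorem At.append {g m m' : Equiv.Perm Ω} {v u s t : List X} (hg : At e g v u m)
    (hm : At e m s t m') : At e g (v ++ s) (u ++ t) m' := fun w => by
  rw [word_append, hg, hm, word_append]

theorem At.eq_label {g m m' : Equiv.Perm Ω} {v u : List X} (h : At e g v u m)
    (h' : At e g v u m') : m = m' :=
  Equiv.ext fun w => word_injective e u ((h w).symm.trans (h' w))

theorem At.unique [Nonempty Ω] [Nontrivial X] {g m m' : Equiv.Perm Ω} {v u u' : List X}
    (h : At e g v u m) (h' : At e g v u' m') : u = u' ∧ m = m' := by
  suffices u = u' by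
    subst this
    exact ⟨rfl, h.eq_label h'⟩
  have key : ∀ {u u' : List X} {m m' : Equiv.Perm Ω} {s : List X}, At e g v u m → At e g v u' m' →
      u' = u ++ s → u = u' := by
    rintro u _ m m' s h h' rfl
    have : s = [] := eq_nil_of_forall_exists e fun w => ⟨m' (m⁻¹ w), by
      apply word_injective e u
      rw [← word_append, ← h', h, ← Equiv.Perm.mul_apply, mul_inv_cancel, Equiv.Perm.one_apply]⟩
    rw [this, List.append_nil]
  obtain ⟨w⟩ := ‹Nonempty Ω›
  rcases word_eq_word e ((h w).symm.trans (h' w)) with ⟨s, hs, -⟩ | ⟨s, hs, -⟩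
  · exact key h h' hs
  · exact (key h' h hs).symm

theorem At.unique_left [Nonempty Ω] [Nontrivial X] {g m m' : Equiv.Perm Ω} {v v' u : List X}
    (h : At e g v u m) (h' : At e g v' u m') : v = v' := (h.inv.unique h'.inv).1

variable (e)

/-- `N` contains `1` and is closed under inversion and under passing to the labels at letters. -/
structure IsLabelSet (N : Set (Equiv.Perm Ω)) : Prop where
  one_mem : 1 ∈ N
  inv_mem : ∀ m ∈ N, m⁻¹ ∈ N
  exists_at_letter : ∀ m ∈ N, ∀ x : X, ∃ y, ∃ m' ∈ N, At e m [x] [y] m'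

/-- The cones of the words in `A` partition `Ω`. -/
def IsPart (A : Finset (List X)) : Prop := ∀ w, ∃! v, v ∈ A ∧ ∃ z, w = word e v z

/-- `g` maps the cones of `A` to cones of `B`, with labels in `N`. -/
def Tab (N : Set (Equiv.Perm Ω)) (A B : Finset (List X)) (g : Equiv.Perm Ω) : Prop :=
  ∀ v ∈ A, ∃ u ∈ B, ∃ m ∈ N, At e g v u m

variable {e} {N M P : Set (Equiv.Perm Ω)} {A B C : Finset (List X)} {g h : Equiv.Perm Ω}

theorem IsLabelSet.exists_at (hN : IsLabelSet e N) (s : List X) {m : Equiv.Perm Ω} (hm : m ∈ N) :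
    ∃ t, t.length = s.length ∧ ∃ m' ∈ N, At e m s t m' := by
  induction s generalizing m with
  | nil => exact ⟨[], rfl, m, hm, fun _ => rfl⟩
  | cons x s ih =>
    obtain ⟨y, m₁, hm₁, h₁⟩ := hN.exists_at_letter m hm x
    obtain ⟨t, ht, m₂, hm₂, h₂⟩ := ih hm₁
    exact ⟨y :: t, by simp [ht], m₂, hm₂, h₁.append h₂⟩

theorem isLabelSet_one : IsLabelSet e {1} :=
  ⟨rfl, by simp, fun m hm x => ⟨x, 1, rfl, by rw [Set.mem_singleton_iff.1 hm]; exact .one _⟩⟩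

theorem IsPart.eq_of_word_eq (hA : IsPart e A) {v v' : List X} (hv : v ∈ A) (hv' : v' ∈ A)
    {z z' : Ω} (h : word e v z = word e v' z') : v = v' :=
  (hA (word e v z)).unique ⟨hv, z, rfl⟩ ⟨hv', z', h⟩

theorem IsPart.eq_nil_of_append_mem [Nonempty Ω] (hA : IsPart e A) {v s : List X} (hv : v ∈ A)
    (hv' : v ++ s ∈ A) : s = [] := by
  obtain ⟨w⟩ := ‹Nonempty Ω›
  have := hA.eq_of_word_eq hv hv' (z := word e s w) (z' := w) (word_append e v s w).symm
  simpa using this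

theorem IsPart.ext (hA : IsPart e A) (hgh : ∀ v ∈ A, ∀ w, g (word e v w) = h (word e v w)) :
    g = h := Equiv.ext fun w => by
  obtain ⟨v, ⟨hv, z, rfl⟩, -⟩ := hA w
  exact hgh v hv z

theorem Tab.mono (hg : Tab e N A B g) (hNM : N ⊆ M) : Tab e M A B g := fun v hv => by
  obtain ⟨u, hu, m, hm, h⟩ := hg v hv
  exact ⟨u, hu, m, hNM hm, h⟩

theorem Tab.of_one (hN : IsLabelSet e N) (hg : Tab e {1} A B g) : Tab e N A B g :=
  hg.mono (by simpa using hN.one_mem)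

theorem Tab.mul (hg : Tab e N A B g) (hh : Tab e M B C h)
    (hP : ∀ m ∈ N, ∀ m' ∈ M, m' * m ∈ P) : Tab e P A C (h * g) := fun v hv => by
  obtain ⟨u, hu, m, hm, h1⟩ := hg v hv
  obtain ⟨t, ht, m', hm', h2⟩ := hh u hu
  exact ⟨t, ht, _, hP m hm m' hm', h1.mul h2⟩

theorem Tab.mul_one (hg : Tab e N A B g) (hh : Tab e {1} B C h) : Tab e N A C (h * g) :=
  hg.mul hh (by simp)

theorem Tab.one_mul (hg : Tab e {1} A B g) (hh : Tab e N B C h) : Tab e N A C (h * g) :=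
  hg.mul hh (by simp)

theorem Tab.inv (hN : IsLabelSet e N) (hA : IsPart e A) (hB : IsPart e B) (hg : Tab e N A B g)
    [Nonempty Ω] : Tab e N B A g⁻¹ := fun u hu => by
  obtain ⟨z⟩ := ‹Nonempty Ω›
  obtain ⟨v, ⟨hv, y, hy⟩, -⟩ := hA (g⁻¹ (word e u z))
  obtain ⟨u', hu', m, hm, h⟩ := hg v hv
  have h1 : u = u' := by
    apply hB.eq_of_word_eq hu hu' (z := z) (z' := m y)
    rw [← h, ← hy, ← Equiv.Perm.mul_apply, mul_inv_cancel, Equiv.Perm.one_apply]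
  exact ⟨v, hv, m⁻¹, hN.inv_mem m hm, h1 ▸ h.inv⟩

theorem Tab.at_mem [Nonempty Ω] [Nontrivial X] (hg : Tab e N A B g) {v u : List X}
    {m : Equiv.Perm Ω} (hv : v ∈ A) (h : At e g v u m) : u ∈ B ∧ m ∈ N := by
  obtain ⟨u', hu', m', hm', h'⟩ := hg v hv
  obtain ⟨rfl, rfl⟩ := h.unique h'
  exact ⟨hu', hm'⟩

/-- The points of `Ω`, coded by a cone of the partition `A` and a point of `Ω`. -/
noncomputable def IsPart.equiv (hA : IsPart e A) : A × Ω ≃ Ω :=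
  Equiv.ofBijective (fun p => word e p.1.1 p.2) ⟨by
    rintro ⟨⟨v, hv⟩, z⟩ ⟨⟨v', hv'⟩, z'⟩ h
    have h1 := hA.eq_of_word_eq hv hv' h
    subst h1
    have h2 : z = z' := word_injective e v h
    rw [h2], fun w => by
    obtain ⟨v, ⟨hv, z, hz⟩, -⟩ := hA w
    exact ⟨(⟨v, hv⟩, z), hz.symm⟩⟩

theorem exists_at_of_equiv (hA : IsPart e A) (hB : IsPart e B) (α : A ≃ B)
    (c : A → Equiv.Perm Ω) : ∃ g : Equiv.Perm Ω, ∀ v : A, At e g v (α v) (c v) := by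
  refine ⟨hA.equiv.symm.trans ((Equiv.prodShear α c).trans hB.equiv), fun v w => ?_⟩
  have h1 : hA.equiv.symm (word e v w) = (v, w) := hA.equiv.symm_apply_apply (v, w)
  simp only [Equiv.trans_apply, h1]
  rfl

/-- A labelled injection from a part `D` of `A` to `B` extends to a permutation of `Ω` mapping the
cones of `A` to the cones of `B`, without labels outside `D`. -/
theorem exists_at_of_injOn (hA : IsPart e A) (hB : IsPart e B) (hAB : A.card = B.card)
    {D : Finset (List X)} (hD : D ⊆ A) {f : List X → List X} (hf : ∀ v ∈ D, f v ∈ B)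
    (hinj : Set.InjOn f D) (l : List X → Equiv.Perm Ω) :
    ∃ g : Equiv.Perm Ω, (∀ v ∈ D, At e g v (f v) (l v)) ∧
      ∀ v ∈ A, v ∉ D → ∃ u ∈ B, At e g v u 1 := by
  classical
  obtain ⟨α, hα⟩ := Finset.exists_equiv_extend_of_card_eq (α := A) (t := B)
    (s := Finset.univ.filter fun v : A => v.1 ∈ D) (f := fun v => f v.1) (by simpa using hAB)
    (by
      intro u hu
      obtain ⟨v, hv, rfl⟩ := Finset.mem_image.1 hu
      exact hf _ (by simpa using hv))
    (fun v hv v' hv' h => Subtype.ext (hinj (by simpa using hv) (by simpa using hv') h))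
  obtain ⟨g, hg⟩ := exists_at_of_equiv hA hB α (fun v => if v.1 ∈ D then l v.1 else 1)
  refine ⟨g, fun v hv => ?_, fun v hv hvD => ?_⟩
  · have h1 := hg ⟨v, hD hv⟩
    rw [hα _ (by simpa using hv), if_pos hv] at h1
    exact h1
  · have h1 := hg ⟨v, hv⟩
    rw [if_neg hvD] at h1
    exact ⟨_, (α ⟨v, hv⟩).2, h1⟩

end Basic

section Carets

variable {X Ω : Type*} {e : X × Ω ≃ Ω} [Fintype X] [DecidableEq X]
  {N M P : Set (Equiv.Perm Ω)} {A B C : Finset (List X)} {g h : Equiv.Perm Ω}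

/-- The one-letter extensions of a word. -/
def children (p : List X) : Finset (List X) := Finset.univ.image fun x => p ++ [x]

@[simp] theorem mem_children {p v : List X} : v ∈ children p ↔ ∃ x, v = p ++ [x] := by
  simp [children, eq_comm]

theorem card_children (p : List X) : (children p).card = Fintype.card X := by
  rw [children, Finset.card_image_of_injective _ (fun x y h => by simpa using h), Finset.card_univ]

theorem disjoint_children {p q : List X} (h : p ≠ q) : Disjoint (children p) (children q) := by
  rw [Finset.disjoint_left]
  intro v hv hv'
  obtain ⟨x, rfl⟩ := mem_children.1 hv
  obtain ⟨y, hy⟩ := mem_children.1 hv'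
  exact h (List.append_inj' hy rfl).1

/-- The partition `A` with the cones `px` merged to the cone of `p`. -/
def collapse (A : Finset (List X)) (p : List X) : Finset (List X) := insert p (A \ children p)

/-- The partition `A` with the cone of `v` split into the cones of `vx`. -/
def expand (A : Finset (List X)) (v : List X) : Finset (List X) := A.erase v ∪ children v

theorem IsPart.expand (hA : IsPart e A) {v : List X} (hv : v ∈ A) : IsPart e (expand A v) := by
  intro w
  obtain ⟨a, ⟨ha, z, rfl⟩, -⟩ := hA w
  by_cases hav : a = v
  · subst hav
    obtain ⟨s, y, hs, rfl⟩ := exists_eq_word e 1 z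
    obtain ⟨x, rfl⟩ := List.length_eq_one_iff.1 hs
    refine ⟨a ++ [x], ⟨Finset.mem_union_right _ (by simp), y, by rw [word_append]⟩, ?_⟩
    rintro b ⟨hb, z', hz'⟩
    rcases Finset.mem_union.1 hb with hb | hb
    · exact absurd (hA.eq_of_word_eq hv (Finset.mem_of_mem_erase hb) hz').symm
        (Finset.ne_of_mem_erase hb)
    · obtain ⟨x', rfl⟩ := mem_children.1 hb
      rw [← word_append] at hz'
      exact (word_eq_word_of_length e hz' (by simp)).1.symm
  · refine ⟨a, ⟨Finset.mem_union_left _ (Finset.mem_erase.2 ⟨hav, ha⟩), z, rfl⟩, ?_⟩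
    rintro b ⟨hb, z', hz'⟩
    rcases Finset.mem_union.1 hb with hb | hb
    · exact (hA.eq_of_word_eq ha (Finset.mem_of_mem_erase hb) hz').symm
    · obtain ⟨x', rfl⟩ := mem_children.1 hb
      rw [word_append] at hz'
      exact absurd (hA.eq_of_word_eq ha hv hz') hav

theorem IsPart.disjoint_erase_children [Nonempty Ω] (hA : IsPart e A) {v : List X} (hv : v ∈ A) :
    Disjoint (A.erase v) (children v) := by
  rw [Finset.disjoint_right]
  intro u hu hu'
  obtain ⟨x, rfl⟩ := mem_children.1 hu
  simpa using hA.eq_nil_of_append_mem hv (Finset.mem_of_mem_erase hu')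

theorem IsPart.card_expand [Nonempty Ω] (hA : IsPart e A) {v : List X} (hv : v ∈ A) :
    (ConeTable.expand A v).card + 1 = A.card + Fintype.card X := by
  rw [ConeTable.expand, Finset.card_union_of_disjoint (hA.disjoint_erase_children hv),
    card_children, Finset.card_erase_of_mem hv]
  have : 0 < A.card := Finset.card_pos.2 ⟨v, hv⟩
  omega

theorem IsPart.notMem_of_children [Nontrivial X] [Nonempty Ω] (hA : IsPart e A) {p : List X}
    (hp : children p ⊆ A) : p ∉ A := by
  intro h
  obtain ⟨x⟩ : Nonempty X := inferInstance
  simpa using hA.eq_nil_of_append_mem h (hp (mem_children.2 ⟨x, rfl⟩))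

theorem IsPart.collapse (hA : IsPart e A) {p : List X} (hp : children p ⊆ A) :
    IsPart e (collapse A p) := by
  intro w
  obtain ⟨a, ⟨ha, z, rfl⟩, -⟩ := hA w
  by_cases hap : a ∈ children p
  · obtain ⟨x, rfl⟩ := mem_children.1 hap
    refine ⟨p, ⟨Finset.mem_insert_self _ _, word e [x] z, by rw [word_append]⟩, ?_⟩
    rintro b ⟨hb, z', hz'⟩
    rcases Finset.mem_insert.1 hb with hb | hb
    · exact hb
    · obtain ⟨hb, hb'⟩ := Finset.mem_sdiff.1 hb
      exact absurd (hA.eq_of_word_eq ha hb hz' ▸ hap) hb'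
  · refine ⟨a, ⟨Finset.mem_insert_of_mem (Finset.mem_sdiff.2 ⟨ha, hap⟩), z, rfl⟩, ?_⟩
    rintro b ⟨hb, z', hz'⟩
    rcases Finset.mem_insert.1 hb with rfl | hb
    · obtain ⟨s, y, hs, rfl⟩ := exists_eq_word e 1 z'
      obtain ⟨x, rfl⟩ := List.length_eq_one_iff.1 hs
      rw [← word_append] at hz'
      have hx : b ++ [x] ∈ children b := mem_children.2 ⟨x, rfl⟩
      exact absurd (hA.eq_of_word_eq ha (hp hx) hz' ▸ hx) hap
    · exact (hA.eq_of_word_eq ha (Finset.mem_sdiff.1 hb).1 hz').symm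

theorem IsPart.card_collapse [Nontrivial X] [Nonempty Ω] (hA : IsPart e A) {p : List X}
    (hp : children p ⊆ A) :
    (ConeTable.collapse A p).card + Fintype.card X = A.card + 1 := by
  rw [ConeTable.collapse, Finset.card_insert_of_notMem
    (fun h => hA.notMem_of_children hp (Finset.mem_sdiff.1 h).1),
    Finset.card_sdiff_of_subset hp, card_children]
  have := Finset.card_le_card hp
  rw [card_children] at this
  omega

theorem IsPart.expand_collapse [Nontrivial X] [Nonempty Ω] (hA : IsPart e A) {p : List X}
    (hp : children p ⊆ A) :
    ConeTable.expand (ConeTable.collapse A p) p = A := by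
  rw [ConeTable.expand, ConeTable.collapse, Finset.erase_insert
    (fun h => hA.notMem_of_children hp (Finset.mem_sdiff.1 h).1),
    Finset.sdiff_union_of_subset hp]

theorem Tab.expand [Nontrivial X] [Nonempty Ω] (hN : IsLabelSet e N) (hg : Tab e N A B g)
    {v u : List X} {m : Equiv.Perm Ω} (hv : v ∈ A) (hm : At e g v u m) :
    Tab e N (expand A v) (expand B u) g := by
  intro a ha
  rcases Finset.mem_union.1 ha with ha | ha
  · obtain ⟨b, hb, m', hm', h⟩ := hg a (Finset.mem_of_mem_erase ha)
    refine ⟨b, Finset.mem_union_left _ (Finset.mem_erase.2 ⟨?_, hb⟩), m', hm', h⟩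
    rintro rfl
    exact Finset.ne_of_mem_erase ha (h.unique_left hm)
  · obtain ⟨x, rfl⟩ := mem_children.1 ha
    obtain ⟨y, m', hm', h⟩ := hN.exists_at_letter m (hg.at_mem hv hm).2 x
    exact ⟨u ++ [y], Finset.mem_union_right _ (by simp), m', hm', hm.append h⟩

theorem Tab.collapse [Nonempty Ω] (hA : IsPart e A) (hg : Tab e N A B g) {p q : List X}
    {m : Equiv.Perm Ω} (hp : children p ⊆ A) (hmN : m ∈ N) (hm : At e g p q m) :
    Tab e N (collapse A p) (collapse B q) g := by
  intro a ha
  rcases Finset.mem_insert.1 ha with rfl | ha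
  · exact ⟨q, Finset.mem_insert_self _ _, m, hmN, hm⟩
  · obtain ⟨ha, hap⟩ := Finset.mem_sdiff.1 ha
    obtain ⟨b, hb, m', hm', h⟩ := hg a ha
    refine ⟨b, Finset.mem_insert_of_mem (Finset.mem_sdiff.2 ⟨hb, fun hbq => hap ?_⟩), m', hm', h⟩
    -- a cone of `A` that is mapped into the cone of `q` lies in the cone of `p`
    obtain ⟨y, rfl⟩ := mem_children.1 hbq
    obtain ⟨w⟩ := ‹Nonempty Ω›
    obtain ⟨s, z, hs, hz⟩ := exists_eq_word e 1 (m⁻¹ (word e [y] (m' w)))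
    obtain ⟨x, rfl⟩ := List.length_eq_one_iff.1 hs
    have hx : p ++ [x] ∈ children p := mem_children.2 ⟨x, rfl⟩
    have h1 : word e a w = word e (p ++ [x]) z := by
      apply g.injective
      rw [h, word_append, word_append, hm, ← hz, ← Equiv.Perm.mul_apply, mul_inv_cancel,
        Equiv.Perm.one_apply]
    rwa [hA.eq_of_word_eq ha (hp hx) h1]

theorem Tab.children_subset [Nontrivial X] [Nonempty Ω] (hN : IsLabelSet e N)
    (hg : Tab e N A B g) {p q : List X} {m : Equiv.Perm Ω} (hp : children p ⊆ A)
    (hmN : m ∈ N) (hm : At e g p q m) : children q ⊆ B := by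
  intro u hu
  obtain ⟨y, rfl⟩ := mem_children.1 hu
  obtain ⟨x, m', hm', h⟩ := hN.exists_at_letter m⁻¹ (hN.inv_mem m hmN) y
  have h1 := (hm.inv.append h).inv
  rw [inv_inv] at h1
  exact (hg.at_mem (hp (mem_children.2 ⟨x, rfl⟩)) h1).1

/-- Below any word that lies strictly above a word of a partition there is a word all of whose
children belong to the partition. -/
theorem IsPart.exists_children_subset [Nonempty Ω] (hA : IsPart e A) {v s : List X}
    (hv : v ++ s ∈ A) (hs : s ≠ []) : ∃ r, children (v ++ r) ⊆ A := by
  classical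
  -- a longest word of `A` strictly below `v` has all its siblings in `A`
  obtain ⟨a, ha, hmax⟩ := (A.filter fun a => ∃ s, s ≠ [] ∧ a = v ++ s).exists_max_image List.length
    ⟨v ++ s, Finset.mem_filter.2 ⟨hv, s, hs, rfl⟩⟩
  obtain ⟨haA, s, hs, rfl⟩ := Finset.mem_filter.1 ha
  obtain ⟨r, x, rfl⟩ : ∃ r x, s = r ++ [x] := ⟨_, _, (List.dropLast_append_getLast hs).symm⟩
  refine ⟨r, fun u hu => ?_⟩
  obtain ⟨y, rfl⟩ := mem_children.1 hu
  obtain ⟨w⟩ := ‹Nonempty Ω›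
  obtain ⟨b, ⟨hb, z, hz⟩, -⟩ := hA (word e (v ++ r ++ [y]) w)
  rcases word_eq_word e hz with ⟨t, rfl, -⟩ | ⟨t, ht, -⟩
  · have h1 := hmax (v ++ r ++ [y] ++ t) (Finset.mem_filter.2 ⟨hb, r ++ [y] ++ t, by simp, by simp⟩)
    have h2 : t = [] := by
      rw [← List.length_eq_zero_iff]
      simp only [List.length_append, List.length_cons, List.length_nil] at h1
      omega
    simpa [h2] using hb
  · rcases List.eq_nil_or_concat t with rfl | ⟨t', y', rfl⟩
    · rw [ht]; simpa using hb
    · rw [List.concat_eq_append, ← List.append_assoc] at ht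
      have h1 := (List.append_inj' ht rfl).1
      rw [← List.append_assoc, h1, List.append_assoc] at haA
      simpa using hA.eq_nil_of_append_mem hb haA

end Carets

end ConeTable

/-! ### Extending multiplicative maps to tables of a partition with many carets -/

namespace ConeTable

variable {X Ω : Type*} (e : X × Ω ≃ Ω)

/-- The permutations that map the cones of some partition with `n` parts to the cones of
another one, with labels in `N`. -/
def tables (N : Set (Equiv.Perm Ω)) (n : ℕ) : Set (Equiv.Perm Ω) :=
  {g | ∃ A B, IsPart e A ∧ IsPart e B ∧ A.card = n ∧ B.card = n ∧ Tab e N A B g}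

/-- `ψ` respects the product of composable tables `A → B → C` with `n` rows, provided that the
labels of both factors and of the product lie in `N`. -/
def IsMultAt {H : Type*} [Group H] (N : Set (Equiv.Perm Ω)) (n : ℕ) (ψ : Equiv.Perm Ω → H) : Prop :=
  ∀ A B C, IsPart e A → IsPart e B → IsPart e C → A.card = n → B.card = n → C.card = n →
    ∀ g h, Tab e N A B g → Tab e N B C h → Tab e N A C (h * g) → ψ (h * g) = ψ h * ψ g

variable {e} {N : Set (Equiv.Perm Ω)} {A B C : Finset (List X)} {g h : Equiv.Perm Ω}
  {H : Type*} [Group H] {n n' : ℕ} {ψ : Equiv.Perm Ω → H}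

theorem at_of_letters {p q : List X} (h : ∀ x, At e g (p ++ [x]) (q ++ [x]) 1) : At e g p q 1 := by
  intro w
  obtain ⟨s, z, hs, rfl⟩ := exists_eq_word e 1 w
  obtain ⟨x, rfl⟩ := List.length_eq_one_iff.1 hs
  rw [← word_append, h, Equiv.Perm.one_apply, Equiv.Perm.one_apply, word_append]

/-- If no word of `A` lies strictly below a word of `A'`, then `A` is coarser than `A'`; this
forces equality if `A` has at least as many words as `A'`. -/
theorem IsPart.exists_append_mem [Nonempty Ω] [Nontrivial X] {A' : Finset (List X)}
    (hA : IsPart e A) (hA' : IsPart e A') (hcard : A'.card ≤ A.card) (hne : A' ≠ A) :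
    ∃ v ∈ A', ∃ s, s ≠ [] ∧ v ++ s ∈ A := by
  by_contra! hno
  have w₀ : Ω := Classical.arbitrary Ω
  have hpre : ∀ v ∈ A', ∃ a ∈ A, ∃ s, v = a ++ s := by
    intro v hv
    obtain ⟨a, ⟨ha, z, hz⟩, -⟩ := hA (word e v w₀)
    rcases word_eq_word e hz with ⟨s, rfl, -⟩ | ⟨s, rfl, -⟩
    · have hs : s = [] := by_contra fun hs => hno v hv s hs ha
      exact ⟨_, ha, [], by simp [hs]⟩
    · exact ⟨a, ha, s, rfl⟩
  choose! a ha s hs using hpre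
  have hcone : ∀ b ∈ A, ∀ w, ∃ v ∈ A', a v = b ∧ ∃ z, word e b w = word e v z := by
    intro b hb w
    obtain ⟨v, ⟨hv, z, hz⟩, -⟩ := hA' (word e b w)
    refine ⟨v, hv, ?_, z, hz⟩
    have h1 := hz
    rw [hs v hv, word_append] at h1
    exact (hA.eq_of_word_eq hb (ha v hv) h1).symm
  have hsurj : ∀ b ∈ A, ∃ v, ∃ (_ : v ∈ A'), a v = b := fun b hb => by
    obtain ⟨v, hv, h, -⟩ := hcone b hb w₀
    exact ⟨v, hv, h⟩
  have hinj := Finset.inj_on_of_surj_on_of_card_le (fun v (_ : v ∈ A') => a v)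
    (fun v hv => ha v hv) hsurj hcard
  have hnil : ∀ v ∈ A', s v = [] := fun v hv => eq_nil_of_forall_exists e fun w => by
    obtain ⟨v', hv', h1, z, h2⟩ := hcone (a v) (ha v hv) w
    have h3 : v' = v := hinj hv' hv h1
    have h4 : word e v z = word e (a v) (word e (s v) z) := by
      conv_lhs => rw [hs v hv, word_append]
    rw [h3, h4] at h2
    exact ⟨z, word_injective e _ h2⟩
  refine hne (Finset.eq_of_subset_of_card_le (fun v hv => ?_) ?_)
  · have h1 := hs v hv
    rw [hnil v hv, List.append_nil] at h1
    rw [h1]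
    exact ha v hv
  · exact Finset.card_le_card_of_surjOn a fun b hb => by
      obtain ⟨v, hv, h⟩ := hsurj b hb
      exact ⟨v, hv, h⟩

variable [Fintype X] [DecidableEq X]

/-- Carets of `A` can be mapped to carets of `B` by a table without labels. -/
theorem exists_tab_of_children (hA : IsPart e A) (hB : IsPart e B) (hAB : A.card = B.card)
    {D : Finset (List X)} {σ : List X → List X} (hD : ∀ p ∈ D, children p ⊆ A)
    (hσ : ∀ p ∈ D, children (σ p) ⊆ B) (hinj : Set.InjOn σ D) :
    ∃ a, Tab e {1} A B a ∧ ∀ p ∈ D, At e a p (σ p) 1 := by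
  have hf : ∀ (p : List X) (x : X), σ (p ++ [x]).dropLast ++ (p ++ [x]).drop ((p ++ [x]).length - 1)
      = σ p ++ [x] := by simp
  obtain ⟨a, ha, ha'⟩ := exists_at_of_injOn hA hB hAB (D := D.biUnion children)
    (f := fun v => σ v.dropLast ++ v.drop (v.length - 1)) (Finset.biUnion_subset.2 hD) (by
      intro v hv
      obtain ⟨p, hp, hv⟩ := Finset.mem_biUnion.1 hv
      obtain ⟨x, rfl⟩ := mem_children.1 hv
      rw [hf]
      exact hσ p hp (by simp)) (by
      intro v hv v' hv' h
      obtain ⟨p, hp, hv⟩ := Finset.mem_biUnion.1 hv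
      obtain ⟨x, rfl⟩ := mem_children.1 hv
      obtain ⟨p', hp', hv'⟩ := Finset.mem_biUnion.1 hv'
      obtain ⟨x', rfl⟩ := mem_children.1 hv'
      dsimp only at h
      rw [hf, hf] at h
      obtain ⟨h1, h2⟩ := List.append_inj' h rfl
      rw [hinj hp hp' h1, h2]) (fun _ => 1)
  refine ⟨a, fun v hv => ?_, fun p hp => at_of_letters fun x => ?_⟩
  · by_cases hvD : v ∈ D.biUnion children
    · have h1 := ha v hvD
      obtain ⟨p, hp, hv'⟩ := Finset.mem_biUnion.1 hvD
      obtain ⟨x, rfl⟩ := mem_children.1 hv'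
      rw [hf] at h1
      exact ⟨_, hσ p hp (by simp), 1, rfl, h1⟩
    · obtain ⟨u, hu, h1⟩ := ha' v hv hvD
      exact ⟨u, hu, 1, rfl, h1⟩
  · have h1 := ha (p ++ [x]) (Finset.mem_biUnion.2 ⟨p, hp, by simp⟩)
    rwa [hf] at h1

variable [Nontrivial X] [Nonempty Ω]

theorem mem_tables_of_children (hN : IsLabelSet e N) (hn : n' + 1 = n + Fintype.card X)
    (hA : IsPart e A) (hB : IsPart e B) (hAn : A.card = n') (hBn : B.card = n')
    (hg : Tab e N A B g) {p q : List X} {m : Equiv.Perm Ω} (hp : children p ⊆ A) (hm : m ∈ N)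
    (hpq : At e g p q m) : g ∈ tables e N n := by
  have hq := hg.children_subset hN hp hm hpq
  refine ⟨_, _, hA.collapse hp, hB.collapse hq, ?_, ?_, hg.collapse hA hp hm hpq⟩
  · have := hA.card_collapse hp
    omega
  · have := hB.card_collapse hq
    omega

/-- Tables that respect a caret can be composed after collapsing the caret. -/
theorem IsMultAt.of_children (hψ : IsMultAt e N n ψ) (hN : IsLabelSet e N)
    (hn : n' + 1 = n + Fintype.card X) (hA : IsPart e A) (hB : IsPart e B) (hC : IsPart e C)
    (hAn : A.card = n') (hBn : B.card = n') (hCn : C.card = n') (hg : Tab e N A B g)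
    (hh : Tab e N B C h) (hhg : Tab e N A C (h * g)) {p q r : List X} {m m' : Equiv.Perm Ω}
    (hp : children p ⊆ A) (hm : m ∈ N) (hm' : m' ∈ N) (hmm' : m' * m ∈ N)
    (hpq : At e g p q m) (hqr : At e h q r m') : ψ (h * g) = ψ h * ψ g := by
  have hq := hg.children_subset hN hp hm hpq
  have hr := hh.children_subset hN hq hm' hqr
  have h1 := hA.card_collapse hp
  have h2 := hB.card_collapse hq
  have h3 := hC.card_collapse hr
  exact hψ _ _ _ (hA.collapse hp) (hB.collapse hq) (hC.collapse hr) (by omega) (by omega)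
    (by omega) g h (hg.collapse hA hp hm hpq) (hh.collapse hB hq hm' hqr)
    (hhg.collapse hA hp hmm' (hpq.mul hqr))

/-- On the tables `C → C`, where `C` contains many carets, a multiplicative map on smaller tables
can be extended from those tables that respect a caret; and these generate all tables `C → C`. -/
theorem IsMultAt.exists_extension_self (hψ : IsMultAt e N n ψ) (hN : IsLabelSet e N)
    (hn : n' + 1 = n + Fintype.card X) (hC : IsPart e C) (hCn : C.card = n')
    {I : Finset (List X)} (hI : ∀ p ∈ I, children p ⊆ C)
    (hIcard : 2 * Fintype.card X + 3 ≤ I.card) :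
    ∃ ρ : Equiv.Perm Ω → H,
      (∀ g h, Tab e N C C g → Tab e N C C h → Tab e N C C (h * g) → ρ (h * g) = ρ h * ρ g) ∧
      (∀ g, ∀ p ∈ I, ∀ q ∈ I, ∀ m ∈ N, Tab e N C C g → At e g p q m → ρ g = ψ g) ∧
      (∀ g, Tab e N C C g → g ∈ Subgroup.closure (tables e N n)) := by
  have htoP := fun L : LPerm C (Equiv.Perm Ω) => exists_at_of_equiv hC hC L.perm L.lab
  choose toP htoP using htoP
  have htoP_mul : ∀ L L', toP (L * L') = toP L * toP L' := fun L L' =>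
    hC.ext fun v hv w => by
      rw [htoP (L * L') ⟨v, hv⟩ w, Equiv.Perm.mul_apply, htoP L' ⟨v, hv⟩ w, htoP L]
      rfl
  have htoP_inj : Function.Injective toP := by
    intro L L' h
    have key := fun v : C => (htoP L v).unique (h ▸ htoP L' v)
    exact LPerm.ext (Equiv.ext fun v => Subtype.ext (key v).1) (funext fun v => (key v).2)
  have htab : ∀ L, L.LabelsIn N → Tab e N C C (toP L) := fun L hL v hv =>
    ⟨_, (L.perm ⟨v, hv⟩).2, _, hL ⟨v, hv⟩, htoP L ⟨v, hv⟩⟩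
  have hlab : ∀ L, Tab e N C C (toP L) → L.LabelsIn N := fun L hL v =>
    (hL.at_mem v.2 (htoP L v)).2
  have hofP : ∀ g, Tab e N C C g → ∃ L : LPerm C (Equiv.Perm Ω), toP L = g := by
    intro g hg
    choose u hu m _ h using hg
    let f : C → C := fun v => ⟨u v.1 v.2, hu v.1 v.2⟩
    have hf : Function.Injective f := fun v v' hvv' => by
      have h1 := h v'.1 v'.2
      have h2 : u v.1 v.2 = u v'.1 v'.2 := Subtype.ext_iff.1 hvv'
      rw [← h2] at h1
      exact Subtype.ext ((h v.1 v.2).unique_left h1)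
    refine ⟨⟨Equiv.ofBijective f (Finite.injective_iff_bijective.1 hf), fun v => m v.1 v.2⟩,
      hC.ext fun v hv w => ?_⟩
    rw [htoP _ ⟨v, hv⟩ w, h v hv w]
    rfl
  let blk : I → Finset C := fun p => Finset.univ.filter fun v => v.1 ∈ children p.1
  have hmem : ∀ (p : I) (x : X), ∃ hx, (⟨p.1 ++ [x], hx⟩ : C) ∈ blk p := fun p x =>
    ⟨hI p.1 p.2 (by simp), by simp [blk]⟩
  have hblk : Pairwise fun i j => Disjoint (blk i) (blk j) := by
    intro i j hij
    rw [Finset.disjoint_left]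
    intro v hv hv'
    exact Finset.disjoint_left.1 (disjoint_children fun h => hij (Subtype.ext h))
      (Finset.mem_filter.1 hv).2 (Finset.mem_filter.1 hv').2
  have hcard : ∀ i, (blk i).card ≤ Fintype.card X := fun i => by
    rw [← card_children i.1]
    exact Finset.card_le_card_of_injOn Subtype.val (fun v hv => (Finset.mem_filter.1 hv).2)
      (Subtype.val_injective.injOn)
  have htriv : ∀ (p : I) L, L.TrivOn (blk p) → At e (toP L) p.1 p.1 1 := fun p L hL =>
    at_of_letters fun x => by
      obtain ⟨hx, hx'⟩ := hmem p x
      have h1 := htoP L ⟨_, hx⟩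
      rwa [(hL _ hx').1, (hL _ hx').2] at h1
  obtain ⟨ρ, hρ, hρψ⟩ := LPerm.exists_extension (ψ := fun L => ψ (toP L)) hN.one_mem hblk hcard
    (by simpa using hIcard) (by
      intro p g h hg hh hhg tg th
      rw [htoP_mul]
      exact hψ.of_children hN hn hC hC hC hCn hCn hCn (htab g hg) (htab h hh)
        (htoP_mul h g ▸ htab _ hhg) (hI p.1 p.2) hN.one_mem hN.one_mem
        (by simpa using hN.one_mem) (htriv p g tg) (htriv p h th))
  refine ⟨fun g => ρ (Function.invFun toP g), ?_, ?_, ?_⟩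
  · intro g h hg hh hhg
    obtain ⟨L, rfl⟩ := hofP g hg
    obtain ⟨L', rfl⟩ := hofP h hh
    rw [← htoP_mul] at hhg
    simp only [← htoP_mul, Function.leftInverse_invFun htoP_inj _]
    exact hρ _ _ (hlab _ hg) (hlab _ hh) (hlab _ hhg)
  · intro g p hp q hq m hm hg hpq
    obtain ⟨L, rfl⟩ := hofP g hg
    simp only [Function.leftInverse_invFun htoP_inj _]
    have h3 : (Finset.card {p, q}) < I.card := by
      have := Finset.card_le_two (a := p) (b := q)
      omega
    obtain ⟨l, hl, hlpq⟩ := Finset.exists_mem_notMem_of_card_lt_card h3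
    rw [Finset.mem_insert, Finset.mem_singleton, not_or] at hlpq
    have hpl : (⟨p, hp⟩ : I) ≠ ⟨l, hl⟩ := fun h => hlpq.1 (Subtype.ext_iff.1 h).symm
    obtain ⟨k, hk, hk', kag, ktriv, -⟩ := (hlab L hg).exists_agreeOn hN.one_mem
      (blk ⟨p, hp⟩) (blk ⟨l, hl⟩) (hblk hpl) (by
        rw [Finset.disjoint_left]
        intro u hu hul
        obtain ⟨v, hv, rfl⟩ := Finset.mem_image.1 hu
        obtain ⟨x, hx⟩ := mem_children.1 (Finset.mem_filter.1 hv).2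
        obtain ⟨y, m', -, h1⟩ := hN.exists_at_letter m hm x
        have h2 := (htoP L v).unique (hx ▸ hpq.append h1)
        refine Finset.disjoint_left.1 (disjoint_children fun h => hlpq.2 h.symm) ?_
          (Finset.mem_filter.1 hul).2
        rw [h2.1]
        simp)
    have h4 : L = k * (k⁻¹ * L) := by simp
    have h5 : At e (toP k) p q m := by
      have h6 := (htriv ⟨p, hp⟩ _ kag.trivOn).inv.mul hpq
      have h7 : toP L = toP k * toP (k⁻¹ * L) := by rw [← htoP_mul, ← h4]
      rwa [h7, mul_assoc, mul_inv_cancel, mul_one, inv_one, mul_one] at h6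
    have h8 := hψ.of_children hN hn hC hC hC hCn hCn hCn (htab _ hk') (htab _ hk)
      (by rwa [← htoP_mul, ← h4]) (hI p hp) hN.one_mem hm (by rwa [mul_one])
      (htriv ⟨p, hp⟩ _ kag.trivOn) h5
    rw [← htoP_mul, ← h4] at h8
    rw [h8, ← hρψ _ _ hk' kag.trivOn, ← hρψ _ _ hk ktriv,
      ← hρ _ _ hk' hk (by rw [← h4]; exact hlab L hg), ← h4]
  · intro g hg
    obtain ⟨L, rfl⟩ := hofP g hg
    obtain ⟨p, hp⟩ : I.Nonempty := Finset.card_pos.1 (by omega)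
    obtain ⟨l, hl, hl'⟩ := LPerm.exists_disjoint_block hblk ((blk ⟨p, hp⟩).image L.perm)
      {⟨p, hp⟩} (by
        rw [Finset.card_image_of_injective _ L.perm.injective, Finset.card_singleton,
          Fintype.card_coe]
        have := hcard ⟨p, hp⟩
        omega)
    obtain ⟨k, hk, hk', kag, ktriv, -⟩ := (hlab L hg).exists_agreeOn hN.one_mem
      (blk ⟨p, hp⟩) (blk l) (hblk fun h => hl (by simp [h])) hl'.symm
    have h4 : L = k * (k⁻¹ * L) := by simp
    rw [h4, htoP_mul]
    exact mul_mem
      (Subgroup.subset_closure (mem_tables_of_children hN hn hC hC hCn hCn (htab _ hk)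
        (hI l.1 l.2) hN.one_mem (htriv l k ktriv)))
      (Subgroup.subset_closure (mem_tables_of_children hN hn hC hC hCn hCn (htab _ hk')
        (hI p hp) hN.one_mem (htriv ⟨p, hp⟩ _ kag.trivOn)))

end ConeTable

/-! ### Extending multiplicative maps to all larger tables -/

namespace ConeTable

variable {X Ω : Type*} {e : X × Ω ≃ Ω} {N : Set (Equiv.Perm Ω)} {A B C : Finset (List X)}
  {g h : Equiv.Perm Ω} {H : Type*} [Group H] {n n' : ℕ} {ψ : Equiv.Perm Ω → H}

/-- The partition `B` of a table `A → B` is determined by `A` and the permutation. -/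
theorem Tab.eq_right [Nontrivial X] [Nonempty Ω] (hA : IsPart e A) (hB : IsPart e B)
    (hg : Tab e N A B g) {B' : Finset (List X)} (hN : IsLabelSet e N) (hg' : Tab e N A B' g)
    (hcard : B'.card = B.card) : B = B' := by
  refine Finset.eq_of_subset_of_card_le (fun u hu => ?_) hcard.le
  obtain ⟨v, hv, m, hm, h⟩ := hg.inv hN hA hB u hu
  have h1 := h.inv
  rw [inv_inv] at h1
  exact (hg'.at_mem hv h1).1

variable [Fintype X] [DecidableEq X]

/-- `a` identifies `A` with `C` without labels and maps some caret of `A` to a caret from `I`. -/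
def IsChart (e : X × Ω ≃ Ω) (C I A : Finset (List X)) (a : Equiv.Perm Ω) : Prop :=
  Tab e {1} A C a ∧ ∃ p c, children p ⊆ A ∧ c ∈ I ∧ At e a p c 1

theorem IsPart.exists_children_subset_of_card [Nonempty Ω] (hA : IsPart e A)
    (hcard : 2 ≤ A.card) :
    ∃ p, children p ⊆ A := by
  obtain ⟨v, hv, hv'⟩ : ∃ v ∈ A, v ≠ [] := by
    by_contra! hno
    have : A ⊆ {[]} := fun v hv => by simpa using hno v hv
    have := Finset.card_le_card this
    simp at this
    omega
  obtain ⟨r, hr⟩ := hA.exists_children_subset (v := []) hv hv'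
  exact ⟨_, hr⟩

theorem exists_isChart (hA : IsPart e A) (hC : IsPart e C) (hAC : A.card = C.card)
    {I : Finset (List X)} (hI : ∀ p ∈ I, children p ⊆ C) {p c : List X} (hp : children p ⊆ A)
    (hc : c ∈ I) : ∃ a, IsChart e C I A a ∧ At e a p c 1 := by
  obtain ⟨a, ha, hpc⟩ := exists_tab_of_children hA hC hAC (D := {p}) (σ := fun _ => c)
    (by simpa using hp) (by simpa using hI c hc) (by simp)
  exact ⟨a, ⟨ha, p, c, hp, hc, hpc p (by simp)⟩, hpc p (by simp)⟩

theorem Tab.conj_chart [Nonempty Ω] (hA : IsPart e A) (hC : IsPart e C) {I : Finset (List X)}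
    {a b : Equiv.Perm Ω} (hg : Tab e N A B g) (ha : IsChart e C I A a) (hb : IsChart e C I B b) :
    Tab e N C C (b * g * a⁻¹) :=
  (ha.1.inv isLabelSet_one hA hC).one_mul (hg.mul_one hb.1)

variable [Nontrivial X] [Nonempty Ω]

section Chart

variable (hψ : IsMultAt e N n ψ) (hN : IsLabelSet e N) (hn : n' + 1 = n + Fintype.card X)
  (hC : IsPart e C) (hCn : C.card = n') {I : Finset (List X)} (hI : ∀ p ∈ I, children p ⊆ C)
  {ρ : Equiv.Perm Ω → H}
  (hρ : ∀ g h, Tab e N C C g → Tab e N C C h → Tab e N C C (h * g) → ρ (h * g) = ρ h * ρ g)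
  (hρψ : ∀ g, ∀ p ∈ I, ∀ q ∈ I, ∀ m ∈ N, Tab e N C C g → At e g p q m → ρ g = ψ g)

include hψ hN hn hC hCn hI hρ hρψ

/-- The change of charts is computed by `ψ`: for charts at the same caret by the multiplicativity
of `ψ`, and for charts at different carets by inserting a chart at both of them. -/
theorem chart_change (hA : IsPart e A) (hAn : A.card = n') (hI2 : 2 ≤ I.card)
    {a a' : Equiv.Perm Ω} (ha : IsChart e C I A a) (ha' : IsChart e C I A a') :
    ρ (a' * a⁻¹) = ψ a' * (ψ a)⁻¹ := by
  have htab : ∀ {a a' : Equiv.Perm Ω}, Tab e {1} A C a → Tab e {1} A C a' →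
      Tab e N C C (a' * a⁻¹) := fun ha ha' =>
    ((ha.inv isLabelSet_one hA hC).mul_one ha').of_one hN
  have hsame : ∀ {a a' : Equiv.Perm Ω} {p c c' : List X}, Tab e {1} A C a → Tab e {1} A C a' →
      children p ⊆ A → c ∈ I → c' ∈ I → At e a p c 1 → At e a' p c' 1 →
      ρ (a' * a⁻¹) = ψ a' * (ψ a)⁻¹ := by
    intro a a' p c c' ha ha' hp hc hc' hpc hpc'
    have h1 : At e (a' * a⁻¹) c c' 1 := by simpa using hpc.inv.mul hpc'
    have h2 := hψ.of_children hN hn hA hC hC hAn hCn hCn (ha.of_one hN) (htab ha ha')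
      (by rw [inv_mul_cancel_right]; exact ha'.of_one hN) hp hN.one_mem hN.one_mem
      (by simpa using hN.one_mem) hpc h1
    rw [inv_mul_cancel_right] at h2
    rw [hρψ _ c hc c' hc' 1 hN.one_mem (htab ha ha') h1, h2, mul_inv_cancel_right]
  obtain ⟨ha, p, c, hp, hc, hpc⟩ := ha
  obtain ⟨ha', p', c', hp', hc', hpc'⟩ := ha'
  by_cases hpp : p = p'
  · subst hpp
    exact hsame ha ha' hp hc hc' hpc hpc'
  · obtain ⟨c₁, hc₁, hcc₁⟩ := Finset.exists_mem_ne hI2 c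
    obtain ⟨m, hm, hmD⟩ := exists_tab_of_children hA hC (hAn.trans hCn.symm) (D := {p, p'})
      (σ := fun r => if r = p then c else c₁) (by simp [hp, hp'])
      (by simp [Ne.symm hpp, hI c hc, hI c₁ hc₁]) (by
        intro r hr r' hr' hrr
        simp only [Finset.coe_insert, Finset.coe_singleton, Set.mem_insert_iff,
          Set.mem_singleton_iff] at hr hr'
        rcases hr with rfl | rfl <;> rcases hr' with rfl | rfl <;>
          simp_all [Ne.symm hcc₁, Ne.symm hpp])
    have h1 : At e m p c 1 := by simpa using hmD p (by simp)
    have h2 : At e m p' c₁ 1 := by simpa [Ne.symm hpp] using hmD p' (by simp)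
    have h3 : a' * a⁻¹ = (a' * m⁻¹) * (m * a⁻¹) := by simp [mul_assoc]
    rw [h3, hρ _ _ (htab ha hm) (htab hm ha') (h3 ▸ htab ha ha'), hsame ha hm hp hc hc hpc h1,
      hsame hm ha' hp' hc₁ hc' h2 hpc']
    group

/-- The value of a table `A → B`, computed in charts of `A` and `B`, does not depend on the
charts. -/
theorem chart_value_unique (hA : IsPart e A) (hB : IsPart e B) (hAn : A.card = n')
    (hBn : B.card = n') (hI2 : 2 ≤ I.card) (hg : Tab e N A B g) {a a' b b' : Equiv.Perm Ω}
    (ha : IsChart e C I A a) (ha' : IsChart e C I A a') (hb : IsChart e C I B b)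
    (hb' : IsChart e C I B b') :
    (ψ b)⁻¹ * ρ (b * g * a⁻¹) * ψ a = (ψ b')⁻¹ * ρ (b' * g * a'⁻¹) * ψ a' := by
  have h1 := chart_change hψ hN hn hC hCn hI hρ hρψ hA hAn hI2 ha' ha
  have h2 := chart_change hψ hN hn hC hCn hI hρ hρψ hB hBn hI2 hb hb'
  have t1 : Tab e N C C (a * a'⁻¹) :=
    ((ha'.1.inv isLabelSet_one hA hC).mul_one ha.1).of_one hN
  have t2 : Tab e {1} C C (b' * b⁻¹) := (hb.1.inv isLabelSet_one hB hC).mul_one hb'.1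
  have t3 : Tab e N C C (b * g * a⁻¹) := hg.conj_chart hA hC ha hb
  have t4 : Tab e N C C (b' * g * a'⁻¹) := hg.conj_chart hA hC ha' hb'
  have t5 : Tab e N C C (b' * g * a⁻¹) := hg.conj_chart hA hC ha hb'
  have e1 : b' * g * a'⁻¹ = b' * g * a⁻¹ * (a * a'⁻¹) := by group
  have e2 : b' * g * a⁻¹ = (b' * b⁻¹) * (b * g * a⁻¹) := by group
  rw [e1, hρ _ _ t1 t5 (e1 ▸ t4), e2, hρ _ _ t3 (t2.of_one hN) (e2 ▸ t5), h1, h2]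
  group

/-- The value computed in charts is the old one for a table that respects a caret. -/
theorem chart_value_eq (hA : IsPart e A) (hB : IsPart e B) (hAn : A.card = n')
    (hBn : B.card = n') (hI2 : 2 ≤ I.card) (hg : Tab e N A B g) {p q : List X}
    {m : Equiv.Perm Ω} (hp : children p ⊆ A) (hm : m ∈ N) (hpq : At e g p q m)
    {a b : Equiv.Perm Ω} (ha : IsChart e C I A a) (hb : IsChart e C I B b) :
    (ψ b)⁻¹ * ρ (b * g * a⁻¹) * ψ a = ψ g := by
  have hq := hg.children_subset hN hp hm hpq
  obtain ⟨c, hc⟩ : I.Nonempty := Finset.card_pos.1 (by omega)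
  obtain ⟨a', ha', hpc⟩ := exists_isChart hA hC (hAn.trans hCn.symm) hI hp hc
  obtain ⟨b', hb', hqc⟩ := exists_isChart hB hC (hBn.trans hCn.symm) hI hq hc
  rw [chart_value_unique hψ hN hn hC hCn hI hρ hρψ hA hB hAn hBn hI2 hg ha ha' hb hb']
  have t1 := hg.conj_chart hA hC ha' hb'
  have h1 : At e (b' * g * a'⁻¹) c c m := by simpa using hpc.inv.mul (hpq.mul hqc)
  have h2 := hψ.of_children hN hn hA hC hC hAn hCn hCn (ha'.1.of_one hN) t1
    (by rw [inv_mul_cancel_right]; exact hg.mul_one hb'.1) hp hN.one_mem hm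
    (by simpa using hm) hpc h1
  have h3 := hψ.of_children hN hn hA hB hC hAn hBn hCn hg (hb'.1.of_one hN)
    (hg.mul_one hb'.1) hp hm hN.one_mem (by simpa using hm) hpq hqc
  rw [inv_mul_cancel_right, h3] at h2
  rw [hρψ _ c hc c hc m hm t1 h1, mul_assoc, ← h2, inv_mul_cancel_left]

end Chart

/-- A map that is multiplicative on tables with `n` rows extends to tables with `n'` rows, one
caret more, provided that some partition with `n'` parts contains many carets. -/
theorem IsMultAt.exists_extension (hψ : IsMultAt e N n ψ) (hN : IsLabelSet e N)
    (hn1 : 1 ≤ n) (hn : n' + 1 = n + Fintype.card X) (hC : IsPart e C) (hCn : C.card = n')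
    {I : Finset (List X)} (hI : ∀ p ∈ I, children p ⊆ C)
    (hIcard : 2 * Fintype.card X + 3 ≤ I.card) :
    ∃ ψ' : Equiv.Perm Ω → H, IsMultAt e N n' ψ' ∧ ∀ g ∈ tables e N n, ψ' g = ψ g := by
  obtain ⟨ρ, hρ, hρψ, -⟩ := hψ.exists_extension_self hN hn hC hCn hI hIcard
  have hX : 2 ≤ Fintype.card X := Fintype.one_lt_card
  have hI2 : 2 ≤ I.card := by omega
  have hchart : ∀ A, IsPart e A → A.card = n' → ∃ a, IsChart e C I A a := by
    intro A hA hAn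
    obtain ⟨p, hp⟩ := hA.exists_children_subset_of_card (by omega)
    obtain ⟨c, hc⟩ : I.Nonempty := Finset.card_pos.1 (by omega)
    obtain ⟨a, ha, -⟩ := exists_isChart hA hC (hAn.trans hCn.symm) hI hp hc
    exact ⟨a, ha⟩
  have hval : ∀ g, ∃ x : H, ∀ A B, IsPart e A → IsPart e B → A.card = n' → B.card = n' →
      Tab e N A B g → ∀ a b, IsChart e C I A a → IsChart e C I B b →
      x = (ψ b)⁻¹ * ρ (b * g * a⁻¹) * ψ a := by
    intro g
    by_cases hg : ∃ A B, IsPart e A ∧ IsPart e B ∧ A.card = n' ∧ B.card = n' ∧ Tab e N A B g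
    · obtain ⟨A, B, hA, hB, hAn, hBn, hg⟩ := hg
      obtain ⟨a, ha⟩ := hchart A hA hAn
      obtain ⟨b, hb⟩ := hchart B hB hBn
      refine ⟨(ψ b)⁻¹ * ρ (b * g * a⁻¹) * ψ a, fun A' B' hA' hB' hAn' hBn' hg' a' b' ha' hb' => ?_⟩
      by_cases hAA : A = A'
      · subst hAA
        obtain rfl := hg.eq_right hA hB hN hg' (hBn'.trans hBn.symm)
        exact chart_value_unique hψ hN hn hC hCn hI hρ hρψ hA hB hAn hBn hI2 hg ha ha' hb hb'
      · -- two different tables of the same size respect carets, so both values are `ψ g`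
        have key : ∀ {A B A' B' : Finset (List X)} {a b : Equiv.Perm Ω}, IsPart e A → IsPart e B →
            IsPart e A' → A.card = n' → B.card = n' → A'.card = n' → A' ≠ A →
            Tab e N A B g → Tab e N A' B' g → IsChart e C I A a → IsChart e C I B b →
            (ψ b)⁻¹ * ρ (b * g * a⁻¹) * ψ a = ψ g := by
          intro A B A' B' a b hA hB hA' hAn hBn hAn' hne hg hg' ha hb
          obtain ⟨v, hv, s, hs, hvs⟩ := hA.exists_append_mem hA' (hAn'.trans hAn.symm).le hne
          obtain ⟨r, hr⟩ := hA.exists_children_subset hvs hs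
          obtain ⟨u, hu, m, hm, h1⟩ := hg' v hv
          obtain ⟨t, -, m', hm', h2⟩ := hN.exists_at r hm
          exact chart_value_eq hψ hN hn hC hCn hI hρ hρψ hA hB hAn hBn hI2 hg hr hm'
            (h1.append h2) ha hb
        rw [key hA hB hA' hAn hBn hAn' (Ne.symm hAA) hg hg' ha hb,
          key hA' hB' hA hAn' hBn' hAn hAA hg' hg ha' hb']
    · exact ⟨1, fun A B hA hB hAn hBn hg' => absurd ⟨A, B, hA, hB, hAn, hBn, hg'⟩ hg⟩
  choose ψ' hψ' using hval
  refine ⟨ψ', ?_, ?_⟩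
  · intro A B D hA hB hD hAn hBn hDn g h hg hh hhg
    obtain ⟨a, ha⟩ := hchart A hA hAn
    obtain ⟨b, hb⟩ := hchart B hB hBn
    obtain ⟨c, hc⟩ := hchart D hD hDn
    have e1 : c * (h * g) * a⁻¹ = (c * h * b⁻¹) * (b * g * a⁻¹) := by group
    rw [hψ' _ A D hA hD hAn hDn hhg a c ha hc, hψ' _ A B hA hB hAn hBn hg a b ha hb,
      hψ' _ B D hB hD hBn hDn hh b c hb hc, e1,
      hρ _ _ (hg.conj_chart hA hC ha hb) (hh.conj_chart hB hC hb hc)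
        (e1 ▸ hhg.conj_chart hA hC ha hc)]
    group
  · rintro g ⟨A, B, hA, hB, hAn, hBn, hg⟩
    obtain ⟨v, hv⟩ : A.Nonempty := Finset.card_pos.1 (by omega)
    obtain ⟨u, hu, m, hm, h⟩ := hg v hv
    have h1 := hA.card_expand hv
    have h2 := hB.card_expand hu
    obtain ⟨a, ha⟩ := hchart _ (hA.expand hv) (by omega)
    obtain ⟨b, hb⟩ := hchart _ (hB.expand hu) (by omega)
    have hg' := hg.expand hN hv h
    rw [hψ' g _ _ (hA.expand hv) (hB.expand hu) (by omega) (by omega) hg' a b ha hb]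
    exact chart_value_eq hψ hN hn hC hCn hI hρ hρψ (hA.expand hv) (hB.expand hu) (by omega)
      (by omega) hI2 hg' Finset.subset_union_right hm h ha hb

/-- The tables with `n` rows generate those with `n'` rows: a table is a product of charts, of the
inverses of charts, and of a table `C → C`. -/
theorem tables_subset_closure (hN : IsLabelSet e N) (hn1 : 1 ≤ n)
    (hn : n' + 1 = n + Fintype.card X) (hC : IsPart e C) (hCn : C.card = n')
    {I : Finset (List X)} (hI : ∀ p ∈ I, children p ⊆ C)
    (hIcard : 2 * Fintype.card X + 3 ≤ I.card) :
    tables e N n' ⊆ Subgroup.closure (tables e N n) := by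
  rintro g ⟨A, B, hA, hB, hAn, hBn, hg⟩
  have hid : IsMultAt e N n (fun g : Equiv.Perm Ω => g) := fun _ _ _ _ _ _ _ _ _ _ _ _ _ _ => rfl
  obtain ⟨-, -, -, hclos⟩ := hid.exists_extension_self hN hn hC hCn hI hIcard
  have hX : 2 ≤ Fintype.card X := Fintype.one_lt_card
  obtain ⟨c, hc⟩ : I.Nonempty := Finset.card_pos.1 (by omega)
  have hchart : ∀ A, IsPart e A → A.card = n' →
      ∃ a, IsChart e C I A a ∧ a ∈ Subgroup.closure (tables e N n) := by
    intro A hA hAn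
    obtain ⟨p, hp⟩ := hA.exists_children_subset_of_card (by omega)
    obtain ⟨a, ha, hpc⟩ := exists_isChart hA hC (hAn.trans hCn.symm) hI hp hc
    exact ⟨a, ha, Subgroup.subset_closure
      (mem_tables_of_children hN hn hA hC hAn hCn (ha.1.of_one hN) hp hN.one_mem hpc)⟩
  obtain ⟨a, ha, ha'⟩ := hchart A hA hAn
  obtain ⟨b, hb, hb'⟩ := hchart B hB hBn
  have e1 : g = b⁻¹ * (b * g * a⁻¹) * a := by group
  rw [e1]
  exact mul_mem (mul_mem (inv_mem hb') (hclos _ (hg.conj_chart hA hC ha hb))) ha'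

end ConeTable

/-! ### Partitions with many carets and finiteness of the set of small tables -/

namespace ConeTable

variable {X Ω : Type*} {e : X × Ω ≃ Ω} {N : Set (Equiv.Perm Ω)} {A B C : Finset (List X)}
  {g h : Equiv.Perm Ω}

theorem isPart_nil : IsPart e {[]} := fun w =>
  ⟨[], ⟨by simp, w, rfl⟩, fun v hv => by simpa using hv.1⟩

/-- A permutation with labels in `N` at the words of a partition maps its cones to the cones of
another partition. -/
theorem IsPart.exists_tab [DecidableEq X] [Nontrivial X] [Nonempty Ω] (hA : IsPart e A)
    (hg : ∀ v ∈ A, ∃ u, ∃ m ∈ N, At e g v u m) :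
    ∃ B, IsPart e B ∧ B.card = A.card ∧ Tab e N A B g ∧ ∀ u ∈ B, ∃ v ∈ A, ∃ m, At e g v u m := by
  choose! u m hm hu using hg
  refine ⟨A.image u, fun w => ?_, Finset.card_image_of_injOn fun v hv v' hv' h => ?_,
    fun v hv => ⟨u v, Finset.mem_image_of_mem _ hv, m v, hm v hv, hu v hv⟩, fun t ht => ?_⟩
  · obtain ⟨v, ⟨hv, z, hz⟩, huniq⟩ := hA (g⁻¹ w)
    refine ⟨u v, ⟨Finset.mem_image_of_mem _ hv, m v z, ?_⟩, ?_⟩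
    · rw [← hu v hv, ← hz, ← Equiv.Perm.mul_apply, mul_inv_cancel, Equiv.Perm.one_apply]
    · rintro t ⟨ht, y, rfl⟩
      obtain ⟨v', hv', rfl⟩ := Finset.mem_image.1 ht
      rw [huniq v' ⟨hv', _, (hu v' hv').inv y⟩]
  · have h1 := hu v' hv'
    rw [← h] at h1
    exact (hu v hv).unique_left h1
  · obtain ⟨v, hv, rfl⟩ := Finset.mem_image.1 ht
    exact ⟨v, hv, m v, hu v hv⟩

variable [Fintype X] [DecidableEq X]

/-- For every `j`, every sufficiently large admissible number of parts is attained by a partition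
with `j` carets and a word outside these carets. -/
theorem exists_isPart_carets [Nontrivial X] [Nonempty Ω] (e : X × Ω ≃ Ω) (j : ℕ) :
    ∃ k₀, ∀ k, k₀ ≤ k → ∃ C, IsPart e C ∧ C.card = 1 + k * (Fintype.card X - 1) ∧
      ∃ I : Finset (List X), I.card = j ∧ (∀ p ∈ I, children p ⊆ C) ∧
        ∃ q ∈ C, ∀ p ∈ I, q ∉ children p := by
  have hX : 2 ≤ Fintype.card X := Fintype.one_lt_card
  have hcard : ∀ {A : Finset (List X)} {k : ℕ} {q : List X}, IsPart e A → q ∈ A →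
      A.card = 1 + k * (Fintype.card X - 1) →
      (expand A q).card = 1 + (k + 1) * (Fintype.card X - 1) := by
    intro A k q hA hq hAk
    have h1 := hA.card_expand hq
    rw [Nat.add_mul, Nat.one_mul]
    omega
  have hkeep : ∀ {A : Finset (List X)} {p q : List X}, children p ⊆ A → q ∉ children p →
      children p ⊆ expand A q := fun hp hq v hv =>
    Finset.mem_union_left _ (Finset.mem_erase.2 ⟨fun h => hq (h ▸ hv), hp hv⟩)
  induction j with
  | zero =>
    refine ⟨0, fun k hk => ?_⟩
    clear hk
    suffices ∃ C, IsPart e C ∧ C.card = 1 + k * (Fintype.card X - 1) by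
      obtain ⟨C, hC, hCk⟩ := this
      obtain ⟨q, hq⟩ : C.Nonempty := Finset.card_pos.1 (by omega)
      exact ⟨C, hC, hCk, ∅, rfl, by simp, q, hq, by simp⟩
    induction k with
    | zero => exact ⟨{[]}, isPart_nil, by simp⟩
    | succ k ih =>
      obtain ⟨C, hC, hCk⟩ := ih
      obtain ⟨q, hq⟩ : C.Nonempty := Finset.card_pos.1 (by omega)
      exact ⟨expand C q, hC.expand hq, hcard hC hq hCk⟩
  | succ j ih =>
    obtain ⟨k₀, ih⟩ := ih
    refine ⟨k₀ + 2, fun k hk => ?_⟩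
    obtain ⟨k, rfl⟩ := Nat.exists_eq_add_of_le' (Nat.le_of_add_left_le hk)
    obtain ⟨C, hC, hCk, I, hIj, hI, q, hq, hqI⟩ := ih k (by omega)
    obtain ⟨x, y, hxy⟩ := exists_pair_ne X
    have hqx : q ++ [x] ∈ expand C q := Finset.mem_union_right _ (by simp)
    have hqy : q ++ [y] ∈ expand C q := Finset.mem_union_right _ (by simp)
    -- the words of `I` differ from `q`, which belongs to the partition
    have hIq : ∀ p ∈ I, p ≠ q := fun p hp h => hC.notMem_of_children (hI p hp) (h ▸ hq)
    have hchild : ∀ p ∈ I, ∀ z, q ++ [z] ∉ children p := fun p hp z hz => by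
      obtain ⟨z', hz'⟩ := mem_children.1 hz
      exact hIq p hp (List.append_inj' hz' rfl).1.symm
    have hnew : q ++ [x] ∉ I := fun h => by
      have h1 := hI _ h (mem_children.2 ⟨x, rfl⟩)
      rw [List.append_assoc] at h1
      simpa using hC.eq_nil_of_append_mem hq h1
    refine ⟨expand (expand C q) (q ++ [x]), (hC.expand hq).expand hqx,
      hcard (hC.expand hq) hqx (hcard hC hq hCk), insert (q ++ [x]) I,
      by rw [Finset.card_insert_of_notMem hnew, hIj], ?_, q ++ [y], ?_, ?_⟩
    · intro p hp
      rcases Finset.mem_insert.1 hp with rfl | hp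
      · exact Finset.subset_union_right
      · exact hkeep (hkeep (hI p hp) (hqI p hp)) (hchild p hp x)
    · exact Finset.mem_union_left _ (Finset.mem_erase.2 ⟨by simpa using hxy.symm, hqy⟩)
    · intro p hp
      rcases Finset.mem_insert.1 hp with rfl | hp
      · simp
      · exact hchild p hp y

/-- There are finitely many partitions with `n` parts, as each arises from a smaller one by
splitting a cone. -/
theorem finite_setOf_isPart [Nontrivial X] [Nonempty Ω] (e : X × Ω ≃ Ω) (n : ℕ) :
    {A | IsPart e A ∧ A.card = n}.Finite := by
  have hX : 2 ≤ Fintype.card X := Fintype.one_lt_card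
  induction n using Nat.strong_induction_on with
  | _ n ih =>
  by_cases hn : 2 ≤ n
  · refine Set.Finite.subset (Set.Finite.biUnion (ih (n + 1 - Fintype.card X) (by omega))
      fun A' _ => (A'.finite_toSet.image fun p => expand A' p)) ?_
    rintro A ⟨hA, hAn⟩
    obtain ⟨p, hp⟩ := hA.exists_children_subset_of_card (by omega)
    have h1 := hA.card_collapse hp
    exact Set.mem_biUnion (x := collapse A p) ⟨hA.collapse hp, by omega⟩
      ⟨p, Finset.mem_insert_self _ _, hA.expand_collapse hp⟩
  · refine Set.Finite.subset (Set.toFinite {∅, {[]}}) ?_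
    rintro A ⟨hA, hAn⟩
    rcases Finset.eq_empty_or_nonempty A with rfl | ⟨v, hv⟩
    · simp
    · have h1 : A = {v} := Finset.eq_singleton_iff_unique_mem.2
        ⟨hv, fun u hu => Finset.card_le_one.1 (by omega) u hu v hv⟩
      subst h1
      have : v = [] := eq_nil_of_forall_exists e fun w => by
        obtain ⟨u, ⟨hu, z, hz⟩, -⟩ := hA w
        rw [Finset.mem_singleton.1 hu] at hz
        exact ⟨z, hz⟩
      simp [this]

theorem finite_tables [Nontrivial X] [Nonempty Ω] (e : X × Ω ≃ Ω) (hN : N.Finite) (n : ℕ) :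
    (tables e N n).Finite := by
  have h1 : (tables e N n) ⊆ ⋃ A ∈ {A | IsPart e A ∧ A.card = n},
      ⋃ B ∈ {B | IsPart e B ∧ B.card = n}, {g | IsPart e A ∧ Tab e N A B g} := by
    rintro g ⟨A, B, hA, hB, hAn, hBn, hg⟩
    simp only [Set.mem_iUnion]
    exact ⟨A, ⟨hA, hAn⟩, B, ⟨hB, hBn⟩, hA, hg⟩
  refine Set.Finite.subset ((finite_setOf_isPart e n).biUnion fun A _ =>
    (finite_setOf_isPart e n).biUnion fun B _ => ?_) h1
  -- a table is determined by its rows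
  let rows : Equiv.Perm Ω → Set (List X × List X × Equiv.Perm Ω) := fun g =>
    {r | r.1 ∈ A ∧ r.2.1 ∈ B ∧ r.2.2 ∈ N ∧ At e g r.1 r.2.1 r.2.2}
  refine Set.Finite.of_finite_image (f := rows) (Set.Finite.subset
    (A.finite_toSet.prod (B.finite_toSet.prod hN)).finite_subsets ?_) ?_
  · rintro _ ⟨g, -, rfl⟩ r hr
    exact ⟨hr.1, hr.2.1, hr.2.2.1⟩
  · rintro g ⟨hA, hg⟩ h - hgh
    refine hA.ext fun v hv w => ?_
    obtain ⟨u, hu, m, hm, hat⟩ := hg v hv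
    have hrow : (v, u, m) ∈ rows g := ⟨hv, hu, hm, hat⟩
    rw [hgh] at hrow
    rw [hat, hrow.2.2.2]

/-- The set of all words of length `D`. -/
def level (X : Type*) [Fintype X] [DecidableEq X] : ℕ → Finset (List X)
  | 0 => {[]}
  | D + 1 => (level X D).biUnion children

theorem mem_level {D : ℕ} {v : List X} : v ∈ level X D ↔ v.length = D := by
  induction D generalizing v with
  | zero => simp [level]
  | succ D ih =>
    simp only [level, Finset.mem_biUnion, mem_children, ih]
    constructor
    · rintro ⟨u, rfl, x, rfl⟩
      simp
    · intro hv
      rcases List.eq_nil_or_concat v with rfl | ⟨u, x, rfl⟩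
      · simp at hv
      · exact ⟨u, by simpa using hv, x, by simp⟩

theorem card_level (D : ℕ) : (level X D).card = Fintype.card X ^ D := by
  induction D with
  | zero => rfl
  | succ D ih =>
    rw [level, Finset.card_biUnion fun p _ q _ hpq => disjoint_children hpq]
    simp [card_children, ih, pow_succ]

theorem isPart_level (D : ℕ) : IsPart e (level X D) := fun w => by
  obtain ⟨v, z, hv, rfl⟩ := exists_eq_word e D w
  refine ⟨v, ⟨mem_level.2 hv, z, rfl⟩, ?_⟩
  rintro u ⟨hu, z', hz'⟩
  exact (word_eq_word_of_length e hz' (hv.trans (mem_level.1 hu).symm)).1.symm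

theorem tables_mono [Nontrivial X] [Nonempty Ω] (hN : IsLabelSet e N) {n n' : ℕ} (hn1 : 1 ≤ n)
    (hn : n' + 1 = n + Fintype.card X) : tables e N n ⊆ tables e N n' := by
  rintro g ⟨A, B, hA, hB, hAn, hBn, hg⟩
  obtain ⟨v, hv⟩ : A.Nonempty := Finset.card_pos.1 (by omega)
  obtain ⟨u, hu, m, hm, h⟩ := hg v hv
  have h1 := hA.card_expand hv
  have h2 := hB.card_expand hu
  exact ⟨_, _, hA.expand hv, hB.expand hu, by omega, by omega, hg.expand hN hv h⟩

/-- Two permutations with labels in `N` at all sufficiently long words, and their product, are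
given by composable tables of a common size. -/
theorem exists_composable [Nontrivial X] [Nonempty Ω] (hN : IsLabelSet e N)
    (hg : ∃ D, ∀ v : List X, D ≤ v.length → ∃ u, ∃ m ∈ N, At e g v u m)
    (hh : ∃ D, ∀ v : List X, D ≤ v.length → ∃ u, ∃ m ∈ N, At e h v u m)
    (hhg : ∃ D, ∀ v : List X, D ≤ v.length → ∃ u, ∃ m ∈ N, At e (h * g) v u m) (k₀ : ℕ) :
    ∃ k, k₀ ≤ k ∧ ∃ A B C, IsPart e A ∧ IsPart e B ∧ IsPart e C ∧
      A.card = 1 + k * (Fintype.card X - 1) ∧ B.card = 1 + k * (Fintype.card X - 1) ∧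
      C.card = 1 + k * (Fintype.card X - 1) ∧ Tab e N A B g ∧ Tab e N B C h ∧
      Tab e N A C (h * g) := by
  obtain ⟨D₁, hg⟩ := hg
  obtain ⟨D₂, hh⟩ := hh
  obtain ⟨D₃, hhg⟩ := hhg
  have hX : 2 ≤ Fintype.card X := Fintype.one_lt_card
  obtain ⟨D, hD⟩ : ∃ D, D = D₁ + D₂ + D₃ + k₀ := ⟨_, rfl⟩
  obtain ⟨B, hB, hBA, hAB, hBu⟩ := (isPart_level (e := e) (X := X) D).exists_tab (N := N) (g := g)
    fun v hv => hg v (by rw [mem_level.1 hv]; omega)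
  have hlong : ∀ u ∈ B, D₂ ≤ u.length := by
    intro u hu
    obtain ⟨v, hv, m, hm⟩ := hBu u hu
    rw [mem_level] at hv
    obtain ⟨t, m₁, hm₁, h1⟩ := hg (v.take D₁) (by simp; omega)
    obtain ⟨s, hs, m₂, -, h2⟩ := hN.exists_at (v.drop D₁) hm₁
    have h3 := h1.append h2
    rw [List.take_append_drop] at h3
    rw [(hm.unique h3).1, List.length_append, hs, List.length_drop]
    omega
  obtain ⟨C, hC, hCB, hBC, -⟩ := hB.exists_tab (N := N) (g := h) fun v hv => hh v (hlong v hv)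
  -- the number of words of length `D` is `1 + k (|X| - 1)` with `k = 1 + |X| + … + |X| ^ (D - 1)`
  have hcard : (level X D).card =
      1 + (∑ i ∈ Finset.range D, Fintype.card X ^ i) * (Fintype.card X - 1) := by
    rw [card_level]
    have h1 := geom_sum_mul_add (Fintype.card X - 1) D
    rw [Nat.sub_add_cancel (by omega)] at h1
    rw [← h1, add_comm]
  refine ⟨∑ i ∈ Finset.range D, Fintype.card X ^ i, ?_, level X D, B, C, isPart_level D, hB, hC,
    hcard, hBA.trans hcard, hCB.trans (hBA.trans hcard), hAB, hBC, fun v hv => ?_⟩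
  · calc k₀ ≤ ∑ i ∈ Finset.range D, 1 := by simp; omega
      _ ≤ _ := Finset.sum_le_sum fun i _ => Nat.one_le_pow _ _ (by omega)
  · obtain ⟨u, hu, m, hm, h1⟩ := hAB v hv
    obtain ⟨t, ht, m', hm', h2⟩ := hBC u hu
    obtain ⟨t', m'', hm'', h3⟩ := hhg v (by rw [mem_level.1 hv]; omega)
    exact ⟨t', ((h1.mul h2).unique h3).1 ▸ ht, m'', hm'', h3⟩

/-! ### Finite presentability of groups of tables -/

/-- The group of all permutations given by tables with labels in a finite set `N` is finitely
presented. -/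
theorem isFinitelyPresented_of_isLabelSet [Nontrivial X] [Nonempty Ω] (hN : IsLabelSet e N)
    (hNfin : N.Finite) (Γ : Subgroup (Equiv.Perm Ω))
    (hΓ : ∀ A B g, IsPart e A → IsPart e B → Tab e N A B g → g ∈ Γ)
    (hΓ' : ∀ g ∈ Γ, ∃ D, ∀ v : List X, D ≤ v.length → ∃ u, ∃ m ∈ N, At e g v u m) :
    Group.IsFinitelyPresented Γ := by
  have hX : 2 ≤ Fintype.card X := Fintype.one_lt_card
  set sz : ℕ → ℕ := fun k => 1 + k * (Fintype.card X - 1) with hsz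
  have hsucc : ∀ k, sz (k + 1) + 1 = sz k + Fintype.card X := fun k => by
    simp only [hsz, Nat.add_mul, Nat.one_mul]
    omega
  have hsz1 : ∀ k, 1 ≤ sz k := fun k => Nat.le_add_right _ _
  obtain ⟨k₀, hk₀⟩ := exists_isPart_carets e (2 * Fintype.card X + 3)
  have hmono : ∀ {i j}, i ≤ j → tables e N (sz i) ⊆ tables e N (sz j) := fun hij =>
    monotone_nat_of_le_succ (f := fun k => tables e N (sz k))
      (fun k => tables_mono hN (hsz1 k) (hsucc k)) hij
  have hclos : ∀ j, tables e N (sz (k₀ + j)) ⊆ Subgroup.closure (tables e N (sz k₀)) := by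
    intro j
    induction j with
    | zero => exact Subgroup.subset_closure
    | succ j ih =>
      obtain ⟨C, hC, hCk, I, hIj, hI, -⟩ := hk₀ (k₀ + j + 1) (by omega)
      exact (tables_subset_closure hN (hsz1 _) (hsucc (k₀ + j)) hC hCk hI hIj.ge).trans
        ((Subgroup.closure_le _).2 ih)
  have hcomp := fun (g h : Γ) => exists_composable hN (hΓ' g g.2) (hΓ' h h.2)
    (hΓ' _ (h * g).2) k₀
  have hmem : ∀ g : Γ, ∃ j, g.1 ∈ tables e N (sz (k₀ + j)) := fun g => by
    obtain ⟨k, hk, A, B, C, hA, hB, -, hAk, hBk, -, hg, -⟩ := hcomp g 1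
    obtain ⟨j, rfl⟩ := Nat.exists_eq_add_of_le hk
    exact ⟨j, A, B, hA, hB, hAk, hBk, hg⟩
  have htabΓ : ∀ n, tables e N n ⊆ Γ := by
    rintro n g ⟨A, B, hA, hB, -, -, hg⟩
    exact hΓ A B g hA hB hg
  refine Group.isFinitelyPresented_of_extends (F := {g : Γ | g.1 ∈ tables e N (sz k₀)})
    ((finite_tables e hNfin _).preimage Subtype.val_injective.injOn) ?_ ?_
  · rw [eq_top_iff]
    rintro g -
    obtain ⟨j, hj⟩ := hmem g
    have h1 : (Subgroup.closure {g : Γ | g.1 ∈ tables e N (sz k₀)}).map Γ.subtype =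
        Subgroup.closure (tables e N (sz k₀)) := by
      rw [MonoidHom.map_closure]
      congr 1
      ext g
      exact ⟨by rintro ⟨g, hg, rfl⟩; exact hg, fun hg => ⟨⟨g, htabΓ _ hg⟩, hg, rfl⟩⟩
    have h2 := hclos j hj
    rw [← h1] at h2
    obtain ⟨g', hg', he⟩ := h2
    rwa [← Subtype.ext (he : g'.1 = g.1)]
  · intro H _ ψ hψ
    classical
    have h0 : IsMultAt e N (sz (k₀ + 0)) fun g => if hg : g ∈ Γ then ψ ⟨g, hg⟩ else 1 := by
      intro A B C hA hB hC hAn hBn hCn g h hg hh hhg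
      have m1 := hΓ A B g hA hB hg
      have m2 := hΓ B C h hB hC hh
      simp only [dif_pos m1, dif_pos m2, dif_pos (mul_mem m2 m1)]
      exact hψ ⟨h, m2⟩ ⟨B, C, hB, hC, hBn, hCn, hh⟩ ⟨g, m1⟩ ⟨A, B, hA, hB, hAn, hBn, hg⟩
        ⟨A, C, hA, hC, hAn, hCn, hhg⟩
    have hstep : ∀ j (φ : {φ : Equiv.Perm Ω → H // IsMultAt e N (sz (k₀ + j)) φ}),
        ∃ φ' : {φ : Equiv.Perm Ω → H // IsMultAt e N (sz (k₀ + (j + 1))) φ},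
          ∀ g ∈ tables e N (sz (k₀ + j)), φ'.1 g = φ.1 g := by
      intro j φ
      obtain ⟨C, hC, hCk, I, hIj, hI, -⟩ := hk₀ (k₀ + j + 1) (by omega)
      obtain ⟨φ', h1, h2⟩ := φ.2.exists_extension hN (hsz1 _) (hsucc (k₀ + j)) hC hCk hI hIj.ge
      exact ⟨⟨φ', h1⟩, h2⟩
    choose next hnext using hstep
    let φ : ∀ j, {φ : Equiv.Perm Ω → H // IsMultAt e N (sz (k₀ + j)) φ} := fun j =>
      Nat.rec ⟨_, h0⟩ next j
    have hφ : ∀ {i j g}, i ≤ j → g ∈ tables e N (sz (k₀ + i)) → (φ j).1 g = (φ i).1 g := by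
      intro i j g hij hg
      induction j, hij using Nat.le_induction with
      | base => rfl
      | succ j hij ih => rw [← ih]; exact hnext j (φ j) g (hmono (by omega) hg)
    choose idx hidx using hmem
    have hval : ∀ (g : Γ) j, g.1 ∈ tables e N (sz (k₀ + j)) → (φ (idx g)).1 g = (φ j).1 g := by
      intro g j hj
      rcases le_total (idx g) j with h | h
      · exact (hφ h (hidx g)).symm
      · exact hφ h hj
    refine ⟨MonoidHom.mk' (fun g => (φ (idx g)).1 g) fun h g => ?_, fun a ha => ?_⟩
    · obtain ⟨k, hk, A, B, C, hA, hB, hC, hAk, hBk, hCk, hg, hh, hhg⟩ := hcomp g h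
      obtain ⟨j, rfl⟩ := Nat.exists_eq_add_of_le hk
      rw [hval (h * g) j ⟨A, C, hA, hC, hAk, hCk, hhg⟩, hval g j ⟨A, B, hA, hB, hAk, hBk, hg⟩,
        hval h j ⟨B, C, hB, hC, hBk, hCk, hh⟩]
      exact (φ j).2 A B C hA hB hC hAk hBk hCk g h hg hh hhg
    · have h1 := hval a 0 ha
      rw [MonoidHom.mk'_apply, h1]
      exact dif_pos a.2

end ConeTable

/-! ### Contracting self-similar permutation groups -/

namespace ConeTable

variable {X Ω : Type*} {e : X × Ω ≃ Ω}

theorem isLabelSet_subgroup {𝒢 : Subgroup (Equiv.Perm Ω)}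
    (h𝒢 : ∀ g ∈ 𝒢, ∀ x : X, ∃ y, ∃ h ∈ 𝒢, At e g [x] [y] h) : IsLabelSet e (𝒢 : Set _) :=
  ⟨𝒢.one_mem, fun _ => 𝒢.inv_mem, h𝒢⟩

/-- The labels of a contracting group can be taken from a finite set that is closed under
inversion and under passing to labels: all labels of the elements of the given finite set and
of their inverses. -/
theorem exists_isLabelSet_finite [Finite X] [Nontrivial X] [Nonempty Ω]
    {𝒢 : Subgroup (Equiv.Perm Ω)} (h𝒢 : ∀ g ∈ 𝒢, ∀ x : X, ∃ y, ∃ h ∈ 𝒢, At e g [x] [y] h)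
    {N₀ : Set (Equiv.Perm Ω)} (hN₀ : N₀.Finite) (hN₀𝒢 : N₀ ⊆ 𝒢)
    (hcontr : ∀ g ∈ 𝒢, ∃ n, ∀ v : List X, n ≤ v.length → ∃ u, ∃ h ∈ N₀, At e g v u h) :
    ∃ N : Set (Equiv.Perm Ω), N.Finite ∧ IsLabelSet e N ∧ N₀ ⊆ N ∧ N ⊆ 𝒢 := by
  have h𝒢' := isLabelSet_subgroup h𝒢
  set S : Set (Equiv.Perm Ω) := insert 1 (N₀ ∪ (fun g => g⁻¹) '' N₀) with hS
  have hSfin : S.Finite := (hN₀.union (hN₀.image _)).insert 1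
  have hS𝒢 : ∀ s ∈ S, s ∈ 𝒢 := by
    rintro s (rfl | hs | ⟨s, hs, rfl⟩)
    · exact 𝒢.one_mem
    · exact hN₀𝒢 hs
    · exact 𝒢.inv_mem (hN₀𝒢 hs)
  have hSinv : ∀ s ∈ S, s⁻¹ ∈ S := by
    rintro s (rfl | hs | ⟨s, hs, rfl⟩)
    · rw [inv_one]; exact Set.mem_insert _ _
    · exact Or.inr (Or.inr ⟨s, hs, rfl⟩)
    · simp only [inv_inv]; exact Or.inr (Or.inl hs)
  have hlab : ∀ s ∈ S, ∀ v u m, At e s v u m → m ∈ 𝒢 := by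
    intro s hs v u m h
    obtain ⟨t, -, m', hm', h'⟩ := h𝒢'.exists_at v (hS𝒢 s hs)
    rw [(h.unique h').2]
    exact hm'
  refine ⟨{m | ∃ s ∈ S, ∃ v u, At e s v u m}, ?_, ⟨?_, ?_, ?_⟩, ?_, ?_⟩
  · choose! n hn using hcontr
    have h1 : {m | ∃ s ∈ S, ∃ v u, At e s v u m} ⊆
        N₀ ∪ ⋃ s ∈ S, ⋃ v ∈ {v : List X | v.length < n s}, {m | ∃ u, At e s v u m} := by
      rintro m ⟨s, hs, v, u, h⟩
      rcases le_or_gt (n s) v.length with hv | hv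
      · obtain ⟨t, m', hm', h'⟩ := hn s (hS𝒢 s hs) v hv
        rw [(h.unique h').2]
        exact Or.inl hm'
      · refine Or.inr ?_
        simp only [Set.mem_iUnion]
        exact ⟨s, hs, v, hv, u, h⟩
    refine Set.Finite.subset (hN₀.union (hSfin.biUnion fun s _ =>
      (List.finite_length_lt X (n s)).biUnion fun v _ => Set.Subsingleton.finite ?_)) h1
    rintro m ⟨u, h⟩ m' ⟨u', h'⟩
    exact (h.unique h').2
  · exact ⟨1, Set.mem_insert _ _, [], [], At.one []⟩
  · rintro m ⟨s, hs, v, u, h⟩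
    exact ⟨s⁻¹, hSinv s hs, u, v, h.inv⟩
  · rintro m ⟨s, hs, v, u, h⟩ x
    obtain ⟨y, m', -, h'⟩ := h𝒢 m (hlab s hs v u m h) x
    exact ⟨y, m', ⟨s, hs, v ++ [x], u ++ [y], h.append h'⟩, h'⟩
  · exact fun m hm => ⟨m, Or.inr (Or.inl hm), [], [], fun _ => rfl⟩
  · rintro m ⟨s, hs, v, u, h⟩
    exact hlab s hs v u m h

/-- Let `𝒢` be a contracting self-similar group of permutations of `Ω`. The group `Γ` of all
permutations given by tables with labels in `𝒢` is finitely presented. -/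
theorem isFinitelyPresented_of_contracting [Finite X] (hX : Subsingleton X → Subsingleton Ω)
    (𝒢 : Subgroup (Equiv.Perm Ω)) (h𝒢 : ∀ g ∈ 𝒢, ∀ x : X, ∃ y, ∃ h ∈ 𝒢, At e g [x] [y] h)
    {N₀ : Set (Equiv.Perm Ω)} (hN₀ : N₀.Finite) (hN₀𝒢 : N₀ ⊆ 𝒢)
    (hcontr : ∀ g ∈ 𝒢, ∃ n, ∀ v : List X, n ≤ v.length → ∃ u, ∃ h ∈ N₀, At e g v u h)
    (Γ : Subgroup (Equiv.Perm Ω))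
    (hΓ : ∀ A B g, IsPart e A → IsPart e B → Tab e (𝒢 : Set _) A B g → g ∈ Γ)
    (hΓ' : ∀ g ∈ Γ, ∃ D, ∀ v : List X, D ≤ v.length → ∃ u, ∃ m ∈ 𝒢, At e g v u m) :
    Group.IsFinitelyPresented Γ := by
  classical
  rcases subsingleton_or_nontrivial Ω with h | hΩ
  · infer_instance
  have : Nontrivial X := by
    rcases subsingleton_or_nontrivial X with h | h
    · exact absurd (hX h) (not_subsingleton Ω)
    · exact h
  have := Fintype.ofFinite X
  obtain ⟨N, hNfin, hN, hN₀N, hN𝒢⟩ := exists_isLabelSet_finite h𝒢 hN₀ hN₀𝒢 hcontr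
  refine isFinitelyPresented_of_isLabelSet hN hNfin Γ
    (fun A B g hA hB hg => hΓ A B g hA hB (hg.mono hN𝒢)) fun g hg => ?_
  obtain ⟨D, hD⟩ := hΓ' g hg
  choose! u m hm hat using hD
  choose! n hn using hcontr
  refine ⟨D + (level X D).sup fun v => n (m v), fun w hw => ?_⟩
  have hv : (w.take D).length = D := by simp; omega
  have h1 := hat (w.take D) hv.ge
  obtain ⟨t, h, hh, h2⟩ := hn (m (w.take D)) (hm _ hv.ge) (w.drop D) (by
    have := Finset.le_sup (f := fun v => n (m v)) (mem_level.2 hv)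
    rw [List.length_drop]
    omega)
  have h3 := h1.append h2
  rw [List.take_append_drop] at h3
  exact ⟨_, h, hN₀N hh, h3⟩

end ConeTable

/-! ### Groups of homeomorphisms and groups of permutations -/

/-- A homeomorphism as a permutation of the points. -/
def Homeomorph.toPermHom (Ω : Type*) [TopologicalSpace Ω] : (Ω ≃ₜ Ω) →* Equiv.Perm Ω where
  toFun g := g.toEquiv
  map_one' := rfl
  map_mul' _ _ := rfl

theorem Homeomorph.toPermHom_injective (Ω : Type*) [TopologicalSpace Ω] :
    Function.Injective (Homeomorph.toPermHom Ω) := fun _ _ h => Homeomorph.toEquiv_injective h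

/-! ### The group `V_G` of a contracting self-similar group -/

namespace SelfSimilar

open InfWord ConeTable

variable {G X : Type*} [Group G] [MulAction G (List X)]

/-- Infinite words as pairs of the first letter and the rest. -/
def InfWord.consEquiv (X : Type*) : X × InfWord X ≃ InfWord X where
  toFun p := prepend [p.1] p.2
  invFun w := (w 0, fun n => w (n + 1))
  left_inv p := by
    refine Prod.ext rfl (funext fun n => ?_)
    simp [prepend]
  right_inv w := by
    funext n
    cases n <;> simp [prepend]

theorem word_consEquiv (v : List X) (w : InfWord X) :
    word (InfWord.consEquiv X) v w = prepend v w := by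
  induction v with
  | nil => simp
  | cons x v ih =>
    rw [word, ih, ← List.singleton_append, prepend_append]
    rfl

/-- The action of a self-similar group on infinite words. -/
def IsSelfSimilar.permHom (hG : IsSelfSimilar G X) : G →* Equiv.Perm (InfWord X) where
  toFun g := ⟨infAct g, infAct g⁻¹,
    fun w => by rw [← hG.infAct_mul, inv_mul_cancel, hG.infAct_one],
    fun w => by rw [← hG.infAct_mul, mul_inv_cancel, hG.infAct_one]⟩
  map_one' := Equiv.ext fun w => hG.infAct_one w
  map_mul' g h := Equiv.ext fun w => hG.infAct_mul g h w

theorem IsSelfSimilar.at_permHom (hG : IsSelfSimilar G X) {g h : G} {v : List X}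
    (e : IsSection g v h) : At (InfWord.consEquiv X) (hG.permHom g) v (g • v) (hG.permHom h) :=
  fun w => by
    rw [word_consEquiv, word_consEquiv]
    exact hG.infAct_prepend e w

theorem IsSelfSimilar.exists_at_letter (hG : IsSelfSimilar G X) :
    ∀ g ∈ hG.permHom.range, ∀ x : X, ∃ y, ∃ h ∈ hG.permHom.range,
      At (InfWord.consEquiv X) g [x] [y] h := by
  rintro _ ⟨g, rfl⟩ x
  obtain ⟨h, y, hxy⟩ := hG.exists_cons g x
  have h1 : g • [x] = [y] := by rw [hxy, hG.smul_nil]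
  exact ⟨y, _, ⟨h, rfl⟩, h1 ▸ hG.at_permHom (g := g) (v := [x]) fun w => by
    rw [h1, List.singleton_append, hxy]; rfl⟩

/-- A map on infinite words is continuous if sufficiently long prefixes of the argument determine
arbitrarily long prefixes of the value. -/
theorem continuous_of_prepend [Nonempty (InfWord X)] {f : InfWord X → InfWord X}
    (hf : ∀ M, ∃ L, ∀ v : List X, v.length = L → ∃ u : List X, M ≤ u.length ∧
      ∀ w, ∃ z, f (prepend v w) = prepend u z) : Continuous f := by
  let _ : TopologicalSpace X := ⊥
  have : DiscreteTopology X := ⟨rfl⟩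
  obtain ⟨w₀⟩ := ‹Nonempty (InfWord X)›
  refine continuous_pi fun n => ?_
  obtain ⟨L, hL⟩ := hf (n + 1)
  have h1 : (fun w => f w n) = (fun t : Fin L → X => f (prepend (List.ofFn t) w₀) n) ∘
      fun w : InfWord X => fun i : Fin L => w i := by
    funext w
    show f w n = f (prepend (w.take L) w₀) n
    obtain ⟨z, hz⟩ := exists_eq_prepend w L
    obtain ⟨u, hu, hfu⟩ := hL (w.take L) (length_take _ _)
    obtain ⟨y, hy⟩ := hfu z
    obtain ⟨y', hy'⟩ := hfu w₀
    rw [← hz] at hy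
    rw [hy, hy']
    have : n < u.length := hu
    simp [prepend, this]
  rw [h1]
  exact continuous_of_discreteTopology.comp (continuous_pi fun i => continuous_apply (i : ℕ))

variable [Finite X]

theorem mem_map_VG_of_tab (hG : IsSelfSimilar G X) {A B : Finset (List X)}
    {g : Equiv.Perm (InfWord X)} (hA : IsPart (InfWord.consEquiv X) A)
    (hB : IsPart (InfWord.consEquiv X) B)
    (hg : Tab (InfWord.consEquiv X) (hG.permHom.range : Set _) A B g) :
    g ∈ (VG hG).map (Homeomorph.toPermHom _) := by
  rcases isEmpty_or_nonempty (InfWord X) with h | hne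
  · rw [Subsingleton.elim g 1]
    exact one_mem _
  -- sections of the rows of a table describe `g` below every long word, with long words as values
  have hlev : ∀ {A B : Finset (List X)} {g : Equiv.Perm (InfWord X)},
      IsPart (InfWord.consEquiv X) A → Tab (InfWord.consEquiv X) (hG.permHom.range : Set _) A B g →
      ∀ M, ∃ L, ∀ v : List X, v.length = L → ∃ (u : List X) (h : G), M ≤ u.length ∧
        ∀ w, g (prepend v w) = prepend u (infAct h w) := by
    intro A B g hA hg M
    refine ⟨A.sup List.length + M, fun v hv => ?_⟩
    have w₀ := Classical.arbitrary (InfWord X)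
    obtain ⟨a, ⟨ha, z, hz⟩, -⟩ := hA (word (InfWord.consEquiv X) v w₀)
    have hal : a.length ≤ A.sup List.length := Finset.le_sup (f := List.length) ha
    obtain ⟨s, rfl⟩ : ∃ s, v = a ++ s := by
      rcases word_eq_word _ hz with ⟨s, rfl, -⟩ | ⟨s, hs, -⟩
      · refine ⟨[], ?_⟩
        rw [List.length_append] at hal
        have : s = [] := List.length_eq_zero_iff.1 (by omega)
        simp [this]
      · exact ⟨s, hs⟩
    obtain ⟨u, -, -, ⟨h, rfl⟩, h1⟩ := hg a ha
    obtain ⟨k, hk⟩ := hG.exists_section h s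
    refine ⟨u ++ h • s, k, ?_, fun w => ?_⟩
    · rw [List.length_append, hG.length_smul]
      rw [List.length_append] at hv
      omega
    · have h2 := h1.append (hG.at_permHom hk) w
      rwa [word_consEquiv, word_consEquiv] at h2
  have hcont : ∀ {A B : Finset (List X)} {g : Equiv.Perm (InfWord X)},
      IsPart (InfWord.consEquiv X) A → Tab (InfWord.consEquiv X) (hG.permHom.range : Set _) A B g →
      Continuous g := by
    intro A B g hA hg
    refine continuous_of_prepend fun M => ?_
    obtain ⟨L, hL⟩ := hlev hA hg M
    refine ⟨L, fun v hv => ?_⟩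
    obtain ⟨u, h, hu, huw⟩ := hL v hv
    exact ⟨u, hu, fun w => ⟨_, huw w⟩⟩
  have hg' := hg.inv (isLabelSet_subgroup hG.exists_at_letter) hA hB
  refine ⟨⟨g, hcont hA hg, hcont hB hg'⟩, ?_, rfl⟩
  obtain ⟨L, hL⟩ := hlev hA hg 0
  refine IsLevelTable.hasTable (N := L) hG fun v hv => ?_
  obtain ⟨u, h, -, huw⟩ := hL v hv
  exact ⟨u, h, huw⟩

theorem isFinitelyPresented_VG (hG : IsSelfSimilar G X) (hc : IsContracting G X) :
    Group.IsFinitelyPresented (VG hG) := by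
  have hinj := Homeomorph.toPermHom_injective (InfWord X)
  suffices Group.IsFinitelyPresented ((VG hG).map (Homeomorph.toPermHom _)) from
    Group.IsFinitelyPresented.equiv ((VG hG).equivMapOfInjective _ hinj).symm
  obtain ⟨N, hN, hNc⟩ := hc
  refine isFinitelyPresented_of_contracting (e := InfWord.consEquiv X) (N₀ := hG.permHom '' N)
    (fun _ => ⟨fun w w' => funext fun n => Subsingleton.elim _ _⟩) hG.permHom.range
    hG.exists_at_letter (hN.image _) ?_ ?_ _
    (fun A B g hA hB hg => mem_map_VG_of_tab hG hA hB hg) ?_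
  · rintro _ ⟨g, -, rfl⟩
    exact ⟨g, rfl⟩
  · rintro _ ⟨g, rfl⟩
    obtain ⟨n, hn⟩ := hNc g
    refine ⟨n, fun v hv => ?_⟩
    obtain ⟨h, hh, hs⟩ := hn v hv
    exact ⟨_, _, ⟨h, hh, rfl⟩, hG.at_permHom hs⟩
  · rintro _ ⟨g, hg, rfl⟩
    obtain ⟨L, hL⟩ := HasTable.exists_level hG hg
    refine ⟨L, fun v hv => ?_⟩
    obtain ⟨u, h, huw⟩ := hL (v.take L) (by simp; omega)
    obtain ⟨k, hk⟩ := hG.exists_section h (v.drop L)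
    have h1 : At (InfWord.consEquiv X) (Homeomorph.toPermHom _ g) (v.take L) u (hG.permHom h) :=
      fun w => by
        rw [word_consEquiv, word_consEquiv]
        exact huw w
    have h2 := h1.append (hG.at_permHom hk)
    rw [List.take_append_drop] at h2
    exact ⟨_, _, ⟨k, rfl⟩, h2⟩

end SelfSimilar

/-! ### Coding the boundary of the preimage tree by words -/

namespace PreimageTree

open scoped unitInterval
open Boundary ConeTable

section

variable {M : Type*} {f : M → M} {t : M}

theorem graft_vertex_add {v : M} (n k : ℕ) (hv : f^[n] v = t) (z : Boundary f v) :
    (graft n hv z).vertex (n + k) = z.vertex k := by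
  show f^[n - (n + k)] (z.vertex (n + k - n)) = z.vertex k
  rw [show n - (n + k) = 0 by omega, show n + k - n = k by omega]
  rfl

theorem graft_injective {v : M} (n : ℕ) (hv : f^[n] v = t) : Function.Injective (graft n hv) :=
  fun z z' h => Boundary.ext <| funext fun k => by
    rw [← graft_vertex_add n k hv z, h, graft_vertex_add]

theorem exists_eq_graft {v : M} {n : ℕ} (w : Boundary f t) (h : w.vertex n = v)
    (hv : f^[n] v = t) : ∃ z, w = graft n hv z := by
  subst h
  exact ⟨w.tail n, (w.graft_tail n).symm⟩

theorem isOpen_vertex_mem (n : ℕ) (s : Set M) : IsOpen {w : Boundary f t | w.vertex n ∈ s} := by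
  refine (iInf_le (fun n : ℕ => TopologicalSpace.induced (fun w : Boundary f t => w.vertex n) ⊥) n)
    _ ?_
  exact ⟨s, trivial, rfl⟩

end

variable {M : Type*} [TopologicalSpace M] {f : M → M} (hf : IsCoveringMap f) {t : M}

theorem exists_lift_path (hf : IsCoveringMap f) (k : ℕ) {v u : M} (γ : Path v u) (z : M)
    (hz : f^[k] z = v) : ∃ (y : M) (Γ : Path z y), ∀ s, f^[k] (Γ s) = γ s :=
  ⟨_, ⟨liftIterate hf k γ z hz, liftIterate_zero .., rfl⟩, iterate_liftIterate hf k γ z hz⟩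

/-- The map `S_γ : ∂T_v → ∂T_u` as a bijection. -/
noncomputable def transportEquiv {v u : M} (γ : Path v u) : Boundary f v ≃ Boundary f u where
  toFun := transport hf γ
  invFun := transport hf γ.symm
  left_inv z := by
    have := transport_symm hf γ.symm z
    rwa [Path.symm_symm] at this
  right_inv z := transport_symm hf γ z

@[simp] theorem transportEquiv_apply {v u : M} (γ : Path v u) (z : Boundary f v) :
    transportEquiv hf γ z = transport hf γ z := rfl

/-- The permutations `S_γ` of `∂T_t` given by the loops `γ` at `t`. -/
noncomputable def loopGroup (t : M) : Subgroup (Equiv.Perm (Boundary f t)) where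
  carrier := Set.range fun γ : Path t t => transportEquiv hf γ
  one_mem' := ⟨Path.refl t, Equiv.ext fun z => transport_refl hf z⟩
  mul_mem' := by
    rintro _ _ ⟨γ, rfl⟩ ⟨δ, rfl⟩
    exact ⟨δ.trans γ, Equiv.ext fun z => transport_trans hf δ γ z⟩
  inv_mem' := by
    rintro _ ⟨γ, rfl⟩
    exact ⟨γ.symm, Equiv.ext fun _ => rfl⟩

/-- The coding of `∂T_t` by the alphabet `f⁻¹(t)`, given by a choice of paths `ℓ x` from `t` to
the letters `x`: the letter `x` acts by `S_{ℓ x} : ∂T_t → ∂T_x ⊆ ∂T_t`. -/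
noncomputable def letterEquiv (ℓ : ∀ x : {x // f x = t}, Path t x.1) :
    {x // f x = t} × Boundary f t ≃ Boundary f t :=
  Equiv.ofBijective (fun p => graft 1 p.1.2 (transport hf (ℓ p.1) p.2)) ⟨by
    rintro ⟨x, z⟩ ⟨x', z'⟩ h
    have hx : x = x' := by
      have := congrArg (fun w : Boundary f t => w.vertex 1) h
      exact Subtype.ext
        ((graft_apply_self 1 _ _).symm.trans (this.trans (graft_apply_self 1 _ _)))
    subst hx
    have := (transportEquiv hf (ℓ x)).injective (graft_injective 1 _ h)
    exact Prod.ext rfl this, fun w => by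
    let x : {x // f x = t} := ⟨w.vertex 1, w.iterate_apply_self 1⟩
    obtain ⟨z, hz⟩ := exists_eq_graft (n := 1) w rfl x.2
    refine ⟨(x, transport hf (ℓ x).symm z), ?_⟩
    dsimp only
    rw [transport_symm, hz]⟩

variable (ℓ : ∀ x : {x // f x = t}, Path t x.1)

/-- The word `v` acts by `S_γ : ∂T_t → ∂T_y ⊆ ∂T_t`, for a path `γ` from `t` to a vertex `y`. -/
def IsWordPath (v : List {x // f x = t}) {y : M} (γ : Path t y) : Prop :=
  ∃ hy : f^[v.length] y = t, ∀ z, word (letterEquiv hf ℓ) v z = graft v.length hy (transport hf γ z)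

variable {hf ℓ}

theorem isWordPath_nil : IsWordPath hf ℓ [] (Path.refl t) :=
  ⟨rfl, fun z => by rw [transport_refl]; exact (graft_zero z).symm⟩

theorem isWordPath_singleton (x : {x // f x = t}) : IsWordPath hf ℓ [x] (ℓ x) :=
  ⟨x.2, fun _ => rfl⟩

/-- The path of `a ++ b` is the path of `b` followed by a lift of the path of `a`. -/
theorem IsWordPath.append {a b : List {x // f x = t}} {y y' u : M} {α : Path t y} {β : Path t y'}
    {γ : Path y' u} (ha : IsWordPath hf ℓ a α) (hb : IsWordPath hf ℓ b β)
    (hγ : ∀ s, f^[b.length] (γ s) = α s) : IsWordPath hf ℓ (a ++ b) (β.trans γ) := by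
  obtain ⟨hy, ha⟩ := ha
  obtain ⟨hy', hb⟩ := hb
  have hu : f^[b.length] u = y := by
    have := hγ 1
    rwa [γ.target, α.target] at this
  have hl : (a ++ b).length = a.length + b.length := List.length_append
  have hu' : f^[(a ++ b).length] u = t := by
    rw [hl, Function.iterate_add_apply, hu, hy]
  refine ⟨hu', fun z => ?_⟩
  rw [word_append, ha, hb, transport_graft hf α γ b.length hy' hu hγ, transport_trans,
    graft_graft hy hu hl hu']

theorem IsWordPath.vertex_eq {v : List {x // f x = t}} {y : M} {γ : Path t y}
    (h : IsWordPath hf ℓ v γ) (z : Boundary f t) :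
    (word (letterEquiv hf ℓ) v z).vertex v.length = y := by
  obtain ⟨hy, h⟩ := h
  rw [h, graft_apply_self]

theorem exists_isWordPath (v : List {x // f x = t}) : ∃ (y : M) (γ : Path t y),
    IsWordPath hf ℓ v γ := by
  induction v with
  | nil => exact ⟨t, _, isWordPath_nil⟩
  | cons x v ih =>
    obtain ⟨y, γ, h⟩ := ih
    obtain ⟨u, Γ, hΓ⟩ := exists_lift_path hf v.length (ℓ x) y h.1
    exact ⟨u, _, (isWordPath_singleton x).append h hΓ⟩

/-- Every vertex of the tree is the vertex of some word. -/
theorem exists_isWordPath_of_vertex (k : ℕ) {u : M} (hu : f^[k] u = t) :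
    ∃ (v : List {x // f x = t}) (γ : Path t u), v.length = k ∧ IsWordPath hf ℓ v γ := by
  induction k generalizing u with
  | zero =>
    obtain rfl : u = t := hu
    exact ⟨[], _, rfl, isWordPath_nil⟩
  | succ k ih =>
    let x : {x // f x = t} := ⟨f^[k] u, by rw [← Function.iterate_succ_apply' f, hu]⟩
    obtain ⟨y, Γ, hΓ⟩ := exists_lift_path hf k (ℓ x).symm u rfl
    obtain ⟨v, γ, rfl, h⟩ := ih (u := y) (by
      have := hΓ 1
      rwa [Γ.target, Path.target] at this)
    refine ⟨[x] ++ v, γ.trans Γ.symm, by simp, (isWordPath_singleton x).append h fun s => ?_⟩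
    show f^[v.length] (Γ (σ s)) = ℓ x s
    rw [hΓ]
    show ℓ x (σ (σ s)) = ℓ x s
    rw [unitInterval.symm_symm]

/-- If `g` is a map `S_δ` below the vertex of the word `v`, then its label at `v` is given by a
loop. -/
theorem IsWordPath.at_of_eqTransportOn {v q : List {x // f x = t}} {y u : M} {γ : Path t y}
    {γ' : Path t u} (h : IsWordPath hf ℓ v γ) (h' : IsWordPath hf ℓ q γ')
    {g : Equiv.Perm (Boundary f t)} {n m : ℕ} {hv : f^[n] y = t} {hu : f^[m] u = t} {δ : Path y u}
    (hg : EqTransportOn hf g hv hu δ) (hn : v.length = n) (hm : q.length = m) :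
    At (letterEquiv hf ℓ) g v q (transportEquiv hf ((γ.trans δ).trans γ'.symm)) := by
  subst hn hm
  obtain ⟨_, h⟩ := h
  obtain ⟨_, h'⟩ := h'
  intro z
  rw [h, hg, h', transportEquiv_apply, transport_trans, transport_trans, transport_symm]

/-- The label of `S_α` at `v`, for a loop `α`, is given by the path of `v`, the lift of `α` and the
inverse of the path of a word of the endpoint. -/
theorem at_transportEquiv {v q : List {x // f x = t}} {y u : M} {γ : Path t y}
    {γ' : Path t u} (h : IsWordPath hf ℓ v γ) (h' : IsWordPath hf ℓ q γ') (hq : q.length = v.length)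
    {α : Path t t} {δ : Path y u} (hδ : ∀ s, f^[v.length] (δ s) = α s) :
    At (letterEquiv hf ℓ) (transportEquiv hf α) v q
      (transportEquiv hf ((γ.trans δ).trans γ'.symm)) :=
  h.at_of_eqTransportOn h' (hv := h.1) (hu := hq ▸ h'.1) (δ := δ)
    (fun z => transport_graft hf α δ v.length h.1 (hq ▸ h'.1) hδ z) rfl hq

theorem exists_at_of_eqTransportOn {v : List {x // f x = t}} {y u : M} {γ : Path t y}
    (h : IsWordPath hf ℓ v γ) {g : Equiv.Perm (Boundary f t)} {n m : ℕ} {hv : f^[n] y = t}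
    {hu : f^[m] u = t} {δ : Path y u} (hg : EqTransportOn hf g hv hu δ) (hn : v.length = n) :
    ∃ q, ∃ k ∈ loopGroup hf t, At (letterEquiv hf ℓ) g v q k := by
  obtain ⟨q, γ', hq, h'⟩ := exists_isWordPath_of_vertex (hf := hf) (ℓ := ℓ) m hu
  exact ⟨q, _, ⟨_, rfl⟩, h.at_of_eqTransportOn h' hg hn hq⟩

theorem exists_at_letter_of_mem_loopGroup : ∀ g ∈ loopGroup hf t, ∀ x : {x // f x = t},
    ∃ y, ∃ h ∈ loopGroup hf t, At (letterEquiv hf ℓ) g [x] [y] h := by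
  rintro _ ⟨α, rfl⟩ x
  have hx := isWordPath_singleton (hf := hf) (ℓ := ℓ) x
  obtain ⟨u, δ, hδ⟩ := exists_lift_path hf 1 α x.1 x.2
  have hu : f u = t := by
    have := hδ 1
    rwa [δ.target, α.target] at this
  exact ⟨⟨u, hu⟩, _, ⟨_, rfl⟩, at_transportEquiv hx (isWordPath_singleton ⟨u, hu⟩) rfl hδ⟩

/-- A permutation given by a table with labels from loops is locally of the form `S_γ`. -/
theorem isLocallyTransport_of_tab {A B : Finset (List {x // f x = t})}
    {g : Equiv.Perm (Boundary f t)} (hA : IsPart (letterEquiv hf ℓ) A)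
    (hg : Tab (letterEquiv hf ℓ) (loopGroup hf t : Set _) A B g) : IsLocallyTransport hf g := by
  intro w
  obtain ⟨v, ⟨hv, z, rfl⟩, -⟩ := hA w
  obtain ⟨u, -, -, ⟨α, rfl⟩, hat⟩ := hg v hv
  obtain ⟨y, γ, hy, hγ⟩ := exists_isWordPath (hf := hf) (ℓ := ℓ) v
  obtain ⟨y', γ', hy', hγ'⟩ := exists_isWordPath (hf := hf) (ℓ := ℓ) u
  refine ⟨_, _, y, y', hy, hy', (γ.symm.trans α).trans γ', ⟨_, (hγ z).symm⟩, fun x => ?_⟩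
  have h1 := hat (transport hf γ.symm x)
  rw [hγ, hγ', transport_symm] at h1
  rw [h1, transport_trans, transport_trans]
  rfl

/-- The `k`-th vertex of `S_γ z` depends only on the `k`-th vertex of `z`. -/
theorem transport_vertex_congr {v u : M} (γ : Path v u) {z z' : Boundary f v} {k : ℕ}
    (h : z.vertex k = z'.vertex k) :
    (transport hf γ z).vertex k = (transport hf γ z').vertex k :=
  transport_apply hf γ z k (Γ := liftIterate hf k γ (z'.vertex k) (z'.iterate_apply_self k))
    (iterate_liftIterate hf k γ _ (z'.iterate_apply_self k))
    ((liftIterate_zero hf k γ _ (z'.iterate_apply_self k)).trans h.symm)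

theorem IsLocallyTransport.continuous {g : Boundary f t → Boundary f t}
    (hg : IsLocallyTransport hf g) : Continuous g := by
  refine continuous_iInf_rng.2 fun j => continuous_induced_rng.2 ?_
  have hconst : IsLocallyConstant fun w => (g w).vertex j := by
    refine (IsLocallyConstant.iff_exists_open _).2 fun w => ?_
    obtain ⟨n, m, v, u, hv, hu, γ, ⟨z, rfl⟩, h⟩ := hg w
    refine ⟨_, isOpen_vertex_mem (n + j) {(graft n hv z).vertex (n + j)}, rfl, fun w' hw' => ?_⟩
    have hw'' : w'.vertex (n + j) = (graft n hv z).vertex (n + j) := hw'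
    have hn : w'.vertex n = v := by
      rw [← w'.iterate_apply n j, hw'', Boundary.iterate_apply, graft_apply_self]
    obtain ⟨z', rfl⟩ := exists_eq_graft w' hn hv
    rw [graft_vertex_add, graft_vertex_add] at hw''
    have key : ∀ x : Boundary f t, x.vertex j = f^[m] (x.vertex (m + j)) := fun x => by
      rw [add_comm m j, Boundary.iterate_apply]
    rw [h, h, key (graft m hu (transport hf γ z')), key (graft m hu (transport hf γ z)),
      graft_vertex_add, graft_vertex_add, transport_vertex_congr γ hw'']
  exact @IsLocallyConstant.continuous _ _ _ ⊥ _ hconst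

/-- By compactness, the elements of `V_f` have labels from loops at all sufficiently long words:
otherwise there were an infinite sequence of letters such that no prefix of it has this property,
while the point with this code has a neighbourhood on which the element is of the form `S_γ`. -/
theorem exists_at_of_isLocallyTransport [Finite {x // f x = t}] [Nonempty (Boundary f t)]
    {g : Equiv.Perm (Boundary f t)} (hg : IsLocallyTransport hf g) :
    ∃ D, ∀ v : List {x // f x = t}, D ≤ v.length →
      ∃ u, ∃ m ∈ loopGroup hf t, At (letterEquiv hf ℓ) g v u m := by
  have := Fintype.ofFinite {x // f x = t}
  let Good : List {x // f x = t} → Prop := fun v => ∃ D, ∀ s : List {x // f x = t}, D ≤ s.length →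
      ∃ u, ∃ m ∈ loopGroup hf t, At (letterEquiv hf ℓ) g (v ++ s) u m
  have hstep : ∀ v, ¬ Good v → ∃ x, ¬ Good (v ++ [x]) := by
    intro v hv
    by_contra! hno
    choose D hD using hno
    refine hv ⟨Finset.univ.sup D + 1, fun s hs => ?_⟩
    cases s with
    | nil => simp at hs
    | cons x s =>
      have h1 := hD x s (by
        have := Finset.le_sup (f := D) (Finset.mem_univ x)
        simp only [List.length_cons] at hs
        omega)
      rwa [List.append_assoc] at h1
  suffices Good [] from this
  by_contra hnil
  obtain ⟨z⟩ := ‹Nonempty (Boundary f t)›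
  have : Nonempty {x // f x = t} := ⟨⟨z.vertex 1, z.iterate_apply_self 1⟩⟩
  choose! next hnext using hstep
  let p : ℕ → List {x // f x = t} := fun n => Nat.rec [] (fun _ v => v ++ [next v]) n
  have hp : ∀ n, ¬ Good (p n) := fun n => by
    induction n with
    | zero => exact hnil
    | succ n ih => exact hnext _ ih
  have hlen : ∀ n, (p n).length = n := fun n => by
    induction n with
    | zero => rfl
    | succ n ih => show (p n ++ [next (p n)]).length = n + 1; simp [ih]
  -- the path through the vertices of the words `p n`
  let w : Boundary f t := ⟨fun n => (word (letterEquiv hf ℓ) (p n) z).vertex n, z.vertex_zero,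
    fun n => by
      obtain ⟨y, γ, hγ⟩ := exists_isWordPath (hf := hf) (ℓ := ℓ) (p n)
      have h1 := hγ.vertex_eq z
      have h2 := hγ.vertex_eq (word (letterEquiv hf ℓ) [next (p n)] z)
      rw [← word_append] at h2
      rw [hlen] at h1 h2
      exact (Boundary.map_vertex_succ _ n).trans (h2.trans h1.symm)⟩
  obtain ⟨n, m, v, u, hv, hu, δ, ⟨z', hz'⟩, h⟩ := hg w
  obtain ⟨y, γ, hγ⟩ := exists_isWordPath (hf := hf) (ℓ := ℓ) (p n)
  have hy : v = y := by
    have h1 := hγ.vertex_eq z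
    rw [hlen] at h1
    rw [← graft_apply_self n hv z', hz', ← h1]
  subst hy
  obtain ⟨q, k, hk, hat⟩ := exists_at_of_eqTransportOn hγ h (hlen n)
  refine hp n ⟨0, fun s _ => ?_⟩
  obtain ⟨s', -, k', hk', h'⟩ :=
    (isLabelSet_subgroup (exists_at_letter_of_mem_loopGroup (hf := hf) (ℓ := ℓ))).exists_at s hk
  exact ⟨_, k', hk', hat.append h'⟩

theorem mem_map_VF_of_tab [Nonempty (Boundary f t)] {A B : Finset (List {x // f x = t})}
    {g : Equiv.Perm (Boundary f t)} (hA : IsPart (letterEquiv hf ℓ) A)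
    (hB : IsPart (letterEquiv hf ℓ) B)
    (hg : Tab (letterEquiv hf ℓ) (loopGroup hf t : Set _) A B g) :
    g ∈ (VF hf t).map (Homeomorph.toPermHom _) := by
  have h1 := isLocallyTransport_of_tab hA hg
  have h2 := isLocallyTransport_of_tab hB
    (hg.inv (isLabelSet_subgroup exists_at_letter_of_mem_loopGroup) hA hB)
  exact ⟨⟨g, h1.continuous, h2.continuous⟩, h1, rfl⟩

/-- If `t` has a single preimage, then its tree of preimages is a ray. -/
theorem subsingleton_boundary (ℓ : ∀ x : {x // f x = t}, Path t x.1) (hf : IsCoveringMap f)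
    (h : Subsingleton {x // f x = t}) : Subsingleton (Boundary f t) := by
  refine ⟨fun w w' => Boundary.ext <| funext fun n => ?_⟩
  obtain ⟨v, z, hv, rfl⟩ := exists_eq_word (letterEquiv hf ℓ) n w
  obtain ⟨v', z', hv', rfl⟩ := exists_eq_word (letterEquiv hf ℓ) n w'
  obtain rfl : v = v' := List.ext_getElem (hv.trans hv'.symm) fun _ _ _ => Subsingleton.elim _ _
  obtain ⟨y, γ, hγ⟩ := exists_isWordPath (hf := hf) (ℓ := ℓ) v
  rw [← hv, hγ.vertex_eq, hγ.vertex_eq]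

end PreimageTree

/-! ### Expanding maps -/

theorem Path.forall_trans {M : Type*} [TopologicalSpace M] {x y z : M} {α : Path x y}
    {β : Path y z} {p : M → Prop} (hα : ∀ s, p (α s)) (hβ : ∀ s, p (β s)) :
    ∀ s, p ((α.trans β) s) := by
  refine Set.forall_mem_range.1 fun y hy => ?_
  rw [Path.trans_range] at hy
  rcases hy with ⟨s, rfl⟩ | ⟨s, rfl⟩
  · exact hα s
  · exact hβ s

namespace PreimageTree

open scoped unitInterval
open Boundary ConeTable

variable {M : Type*} [TopologicalSpace M] {f : M → M}

/-- `D` is a continuous metric for which a single application of `f` expands distances below `ε` at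
least by the factor `c > 1`. -/
structure IsExpandingDist (f : M → M) (D : M → M → ℝ) (c ε : ℝ) : Prop where
  one_lt : 1 < c
  pos : 0 < ε
  self : ∀ x, D x x = 0
  symm : ∀ x y, D x y = D y x
  triangle : ∀ x y z, D x z ≤ D x y + D y z
  continuous : Continuous fun p : M × M => D p.1 p.2
  eq_of_nonpos : ∀ {x y}, D x y ≤ 0 → x = y
  expand : ∀ {x y}, D x y < ε → c * D x y ≤ D (f x) (f y)

/-- If `fⁿ` expands a metric `d` by the factor `cⁿ`, then `f` expands the metric
`∑ i < n, c⁻ⁱ d(fⁱ x, fⁱ y)` by the factor `c`. -/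
theorem IsExpanding.exists_isExpandingDist (hf : Continuous f) (h : IsExpanding f) :
    ∃ D c ε, IsExpandingDist f D c ε := by
  obtain ⟨d, rfl, L, ε, n, hL, hε, hn, h⟩ := h
  have hL0 : 0 < L := zero_lt_one.trans hL
  set c : ℝ := L ^ (n : ℝ)⁻¹ with hc
  have hcn : c ^ n = L := Real.rpow_inv_natCast_pow hL0.le hn.ne'
  have hc1 : 1 < c := Real.one_lt_rpow hL (by positivity)
  have hc0 : 0 < c := zero_lt_one.trans hc1
  let D : M → M → ℝ := fun x y => ∑ i ∈ Finset.range n, c⁻¹ ^ i * dist (f^[i] x) (f^[i] y)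
  have hle : ∀ x y, dist x y ≤ D x y := fun x y => by
    have := Finset.single_le_sum (f := fun i => c⁻¹ ^ i * dist (f^[i] x) (f^[i] y))
      (fun i _ => by positivity) (Finset.mem_range.2 hn)
    simpa [D] using this
  refine ⟨D, c, ε, hc1, hε, fun x => by simp [D], fun x y => by simp [D, dist_comm], ?_, ?_, ?_, ?_⟩
  · intro x y z
    rw [← Finset.sum_add_distrib]
    refine Finset.sum_le_sum fun i _ => ?_
    rw [← mul_add]
    exact mul_le_mul_of_nonneg_left (dist_triangle _ _ _) (by positivity)
  · refine continuous_finsetSum _ fun i _ => ?_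
    have := hf.iterate i
    fun_prop
  · intro x y hxy
    exact dist_le_zero.1 ((hle x y).trans hxy)
  · intro x y hxy
    have h1 := h x y ((hle x y).trans_lt hxy)
    have h2 : c * (D x y + c⁻¹ ^ n * dist (f^[n] x) (f^[n] y)) = c * dist x y + D (f x) (f y) := by
      rw [← Finset.sum_range_succ (fun i => c⁻¹ ^ i * dist (f^[i] x) (f^[i] y)),
        Finset.sum_range_succ', mul_add, Finset.mul_sum, add_comm]
      congr 1
      · simp
      · refine Finset.sum_congr rfl fun i _ => ?_
        rw [pow_succ, Function.iterate_succ_apply, Function.iterate_succ_apply]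
        field_simp
    have h3 : dist x y ≤ c⁻¹ ^ n * dist (f^[n] x) (f^[n] y) := by
      rw [inv_pow, hcn, inv_mul_eq_div, le_div_iff₀ hL0, mul_comm]
      exact h1
    have h4 := mul_le_mul_of_nonneg_left h3 hc0.le
    rw [mul_add] at h2
    linarith

namespace IsExpandingDist

variable {D : M → M → ℝ} {c ε : ℝ} (hD : IsExpandingDist f D c ε)

include hD

theorem nonneg (x y : M) : 0 ≤ D x y := by
  have h := hD.triangle x y x
  rw [hD.self, hD.symm y x] at h
  linarith

theorem continuous_comp {Z : Type*} [TopologicalSpace Z] {g h : Z → M} (hg : Continuous g)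
    (hh : Continuous h) : Continuous fun z => D (g z) (h z) :=
  hD.continuous.comp (hg.prodMk hh)

/-- A connected set whose image under `f` is `ρ`-small is itself `ρ / c`-small: the distances
between its points are at most `ρ / c` or at least `ε`, hence the former. -/
theorem le_div_of_map_le {Γ : C(I, M)} {J : Set I} (hJ : IsPreconnected J) {s : I} (hs : s ∈ J)
    {ρ : ℝ} (hρ : ρ < ε) (h : ∀ r ∈ J, D (f (Γ r)) (f (Γ s)) ≤ ρ) :
    ∀ r ∈ J, D (Γ r) (Γ s) ≤ ρ / c := by
  have hc0 : 0 < c := zero_lt_one.trans hD.one_lt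
  have hρ0 : 0 ≤ ρ := (hD.nonneg _ _).trans (h s hs)
  have key : ∀ r ∈ J, D (Γ r) (Γ s) < ε → D (Γ r) (Γ s) ≤ ρ / c := fun r hr hlt => by
    rw [le_div_iff₀ hc0, mul_comm]
    exact (hD.expand hlt).trans (h r hr)
  have hρc : ρ / c ≤ ρ := div_le_self hρ0 hD.one_lt.le
  obtain ⟨m, hm, hm'⟩ := exists_between hρ
  have hφ : Continuous fun r => D (Γ r) (Γ s) := hD.continuous_comp Γ.continuous continuous_const
  have hsub : J ⊆ {r | D (Γ r) (Γ s) < m} :=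
    hJ.subset_left_of_subset_union (isOpen_lt hφ continuous_const)
      (v := {r | m < D (Γ r) (Γ s)}) (isOpen_lt continuous_const hφ)
      (Set.disjoint_left.2 fun r h1 h2 => lt_asymm (Set.mem_ofPred.1 h1) h2)
      (fun r hr => by
        rcases lt_trichotomy (D (Γ r) (Γ s)) m with h1 | h1 | h1
        · exact Or.inl h1
        · have := key r hr (h1 ▸ hm')
          linarith
        · exact Or.inr h1)
      ⟨s, hs, by
        show D (Γ s) (Γ s) < m
        rw [hD.self]
        linarith⟩
  exact fun r hr => key r hr (lt_trans (hsub hr) hm')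

theorem le_div_pow_of_iterate_le (hf : Continuous f) (k : ℕ) {Γ : C(I, M)} {J : Set I}
    (hJ : IsPreconnected J) {s : I} (hs : s ∈ J) {ρ : ℝ} (hρ : ρ < ε)
    (h : ∀ r ∈ J, D (f^[k] (Γ r)) (f^[k] (Γ s)) ≤ ρ) :
    ∀ r ∈ J, D (Γ r) (Γ s) ≤ ρ / c ^ k := by
  induction k generalizing Γ with
  | zero => simpa using h
  | succ k ih =>
    have hρ0 : 0 ≤ ρ := (hD.nonneg _ _).trans (h s hs)
    have h1 := ih (Γ := ⟨fun s => f (Γ s), by fun_prop⟩) h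
    have h2 : ρ / c ^ k ≤ ρ := div_le_self hρ0 (one_le_pow₀ hD.one_lt.le)
    rw [pow_succ, ← div_div]
    exact hD.le_div_of_map_le hJ hs (h2.trans_lt hρ) h1

end IsExpandingDist

/-- All lifts of `γ` by the `k`-th iteration of `f` stay within `η` of their starting points. -/
def HasShortLifts (f : M → M) (D : M → M → ℝ) (k : ℕ) (γ : I → M) (η : ℝ) : Prop :=
  ∀ Γ : C(I, M), (∀ s, f^[k] (Γ s) = γ s) → ∀ s, D (Γ s) (Γ 0) ≤ η

section

variable {D : M → M → ℝ} {c ε : ℝ} (hD : IsExpandingDist f D c ε) (hf : IsCoveringMap f)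

include hD hf

theorem HasShortLifts.trans {k : ℕ} {x y z : M} {α : Path x y} {β : Path y z} {η η' : ℝ}
    (hα : HasShortLifts f D k α η)
    (hβ : HasShortLifts f D k β η') :
    HasShortLifts f D k (α.trans β) (η + η') := by
  intro Γ hΓ s
  obtain ⟨x₀, hx₀⟩ : ∃ x₀, x₀ = Γ 0 := ⟨_, rfl⟩
  obtain ⟨a, A, hA⟩ := exists_lift_path hf k α x₀ (by rw [hx₀, hΓ, Path.source])
  have ha : f^[k] a = y := by
    have := hA 1
    rwa [A.target, α.target] at this
  obtain ⟨b, B, hB⟩ := exists_lift_path hf k β a ha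
  have hΓs : ∀ s, Γ s = (A.trans B) s := DFunLike.congr_fun <|
    lift_iterate_unique hf k (Δ := (A.trans B).toContinuousMap) (fun s => by
      rw [hΓ]
      show _ = f^[k] ((A.trans B) s)
      rw [Path.trans_apply, Path.trans_apply]
      split_ifs
      · exact (hA _).symm
      · exact (hB _).symm) (hx₀.symm.trans (A.trans B).source.symm)
  have h1 : ∀ s, D (A s) x₀ ≤ η := fun s => by
    have := hα A.toContinuousMap hA s
    rwa [show A.toContinuousMap 0 = x₀ from A.source] at this
  have h2 : ∀ s, D (B s) a ≤ η' := fun s => by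
    have := hβ B.toContinuousMap hB s
    rwa [show B.toContinuousMap 0 = a from B.source] at this
  have hη' : 0 ≤ η' := (hD.nonneg _ _).trans (h2 0)
  have h3 := h1 1
  rw [A.target] at h3
  rw [← hx₀, hΓs]
  exact Path.forall_trans (p := fun y => D y x₀ ≤ η + η') (fun s => by linarith [h1 s])
    (fun s => by linarith [h2 s, hD.triangle (B s) a x₀]) s

/-- Lifts of a fixed path by high iterations of `f` are short: the path is a concatenation of
finitely many small pieces, and each piece is contracted. -/
theorem exists_hasShortLifts (γ : C(I, M)) {η : ℝ} (hη : 0 < η) :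
    ∃ k₀, ∀ k, k₀ ≤ k → HasShortLifts f D k γ η := by
  have hc0 : 0 < c := zero_lt_one.trans hD.one_lt
  obtain ⟨ρ, hρ0, hρ⟩ := exists_between hD.pos
  have hφ : UniformContinuous fun p : I × I => D (γ p.1) (γ p.2) :=
    CompactSpace.uniformContinuous_of_continuous
      (hD.continuous_comp (γ.continuous.comp continuous_fst) (γ.continuous.comp continuous_snd))
  obtain ⟨δ, hδ, hφδ⟩ := Metric.uniformContinuous_iff.1 hφ ρ hρ0
  obtain ⟨n, hn⟩ := exists_nat_one_div_lt hδ
  have hn0 : (0 : ℝ) < n + 1 := by positivity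
  have hsmall : ∀ q r : I, q ≤ r → (r : ℝ) - q ≤ 1 / (n + 1) → D (γ r) (γ q) ≤ ρ := by
    intro q r hqr h
    have h1 := @hφδ (r, q) (q, q) (by
      rw [Prod.dist_eq, dist_self, max_eq_left dist_nonneg, Subtype.dist_eq, Real.dist_eq,
        abs_of_nonneg (sub_nonneg.2 (Subtype.coe_le_coe.2 hqr))]
      exact h.trans_lt hn)
    rw [Real.dist_eq, hD.self, sub_zero, abs_of_nonneg (hD.nonneg _ _)] at h1
    exact h1.le
  have key : ∀ k, ∀ Γ : C(I, M), (∀ s, f^[k] (Γ s) = γ s) → ∀ i : ℕ, ∀ s : I,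
      (s : ℝ) ≤ i / (n + 1) → D (Γ s) (Γ 0) ≤ i * (ρ / c ^ k) := by
    intro k Γ hΓ i
    have hρk : 0 ≤ ρ / c ^ k := by positivity
    induction i with
    | zero =>
      intro s hs
      have hs0 : s = 0 := Subtype.ext (le_antisymm (by
        rw [Nat.cast_zero, zero_div] at hs
        exact hs) s.2.1)
      simp [hs0, hD.self]
    | succ i ih =>
      intro s hs
      push_cast at hs ⊢
      rcases le_or_gt (s : ℝ) (i / (n + 1)) with h | h
      · linarith [ih s h]
      · let q : I := ⟨i / (n + 1), by positivity, h.le.trans s.2.2⟩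
        have hqs : q ≤ s := h.le
        have h1 := ih q le_rfl
        have h2 := hD.le_div_pow_of_iterate_le hf.continuous k (Γ := Γ)
          (isPreconnected_Icc (a := q) (b := s)) (Set.left_mem_Icc.2 hqs) hρ (fun r hr => by
            rw [hΓ, hΓ]
            refine hsmall q r hr.1 ?_
            have h3 : (r : ℝ) ≤ s := hr.2
            have h4 : (q : ℝ) = i / (n + 1) := rfl
            rw [h4]
            rw [add_div] at hs
            linarith) s (Set.right_mem_Icc.2 hqs)
        linarith [hD.triangle (Γ s) (Γ q) (Γ 0)]
  obtain ⟨k₀, hk₀⟩ := pow_unbounded_of_one_lt ((n + 1) * ρ / η) hD.one_lt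
  refine ⟨k₀, fun k hk Γ hΓ s => (key k Γ hΓ (n + 1) s ?_).trans ?_⟩
  · push_cast
    rw [div_self hn0.ne']
    exact s.2.2
  · have h1 : (n + 1) * ρ / η < c ^ k :=
      hk₀.trans_le (pow_le_pow_right₀ hD.one_lt.le hk)
    rw [div_lt_iff₀ hη] at h1
    push_cast
    rw [← mul_div_assoc, div_le_iff₀ (by positivity), mul_comm η]
    exact h1.le

/-- Two short paths with the same endpoints act in the same way: by induction on the levels, the
ends of the corresponding lifts are close to each other and have the same image under `f`. -/
theorem transport_eq_of_short {a b : M} {τ τ' : Path a b} {ρ : ℝ} (hρ : 2 * ρ < ε)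
    (hτ : ∀ s, D (τ s) a ≤ ρ) (hτ' : ∀ s, D (τ' s) a ≤ ρ) (z : Boundary f a) :
    transport hf τ z = transport hf τ' z := by
  have hρ0 : 0 ≤ ρ := (hD.nonneg _ _).trans (hτ 0)
  have hend : ∀ ζ : Path a b, (∀ s, D (ζ s) a ≤ ρ) → ∀ k,
      D ((transport hf ζ z).vertex k) (z.vertex k) ≤ ρ := by
    intro ζ hζ k
    obtain ⟨y, Γ, hΓ⟩ := exists_lift_path hf k ζ _ (z.iterate_apply_self k)
    rw [transport_apply hf ζ z k (Γ := Γ.toContinuousMap) hΓ Γ.source]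
    have h1 := hD.le_div_pow_of_iterate_le hf.continuous k (Γ := Γ.toContinuousMap)
      (J := Set.univ) isPreconnected_univ (s := 0) trivial (ρ := ρ) (by linarith)
      (fun r _ => by
        show D (f^[k] (Γ r)) (f^[k] (Γ 0)) ≤ ρ
        rw [hΓ, hΓ, ζ.source]
        exact hζ r) 1 trivial
    have h2 : Γ.toContinuousMap 0 = z.vertex k := Γ.source
    rw [h2] at h1
    exact h1.trans (div_le_self hρ0 (one_le_pow₀ hD.one_lt.le))
  refine Boundary.ext <| funext fun k => ?_
  induction k with
  | zero => rw [Boundary.vertex_zero, Boundary.vertex_zero]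
  | succ k ih =>
    have h1 := hend τ hτ (k + 1)
    have h2 := hend τ' hτ' (k + 1)
    rw [hD.symm] at h2
    have h3 := hD.expand (((hD.triangle _ _ _).trans (add_le_add h1 h2)).trans_lt (by linarith))
    rw [(transport hf τ z).map_vertex_succ, (transport hf τ' z).map_vertex_succ, ih,
      hD.self] at h3
    exact hD.eq_of_nonpos (nonpos_of_mul_nonpos_right h3 (zero_lt_one.trans hD.one_lt))

variable {t : M} (ℓ : ∀ x : {x // f x = t}, Path t x.1)

/-- Every word is realized by a path with short lifts by a fixed iteration of `f`, as the lifts of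
the paths of the letters form a geometric series. -/
theorem exists_isWordPath_hasShortLifts [Finite {x // f x = t}] {η : ℝ} (hη : 0 < η)
    (hηε : η < ε) : ∃ K, ∀ v : List {x // f x = t}, ∃ (y : M) (γ : Path t y),
      IsWordPath hf ℓ v γ ∧ HasShortLifts f D K γ η := by
  have hc0 : 0 < c := zero_lt_one.trans hD.one_lt
  -- a letter contributes `η - η / c`, and the preceding word `η / c`, by one more contraction
  have hη' : 0 < η - η / c := sub_pos.2 (div_lt_self hη hD.one_lt)
  have := Fintype.ofFinite {x // f x = t}
  choose k hk using fun x => exists_hasShortLifts hD hf (ℓ x).toContinuousMap hη'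
  refine ⟨Finset.univ.sup k, fun v => ?_⟩
  set K := Finset.univ.sup k with hK
  induction v using List.reverseRecOn with
  | nil =>
    refine ⟨t, _, isWordPath_nil, fun Γ hΓ s => ?_⟩
    have h1 := lift_iterate_unique hf K (Γ := Γ) (Δ := ContinuousMap.const I (Γ 0))
      (fun s => (hΓ s).trans (hΓ 0).symm) rfl
    rw [h1]
    exact (hD.self _).trans_le hη.le
  | append_singleton v x ih =>
    obtain ⟨y, γ, hγ, hs⟩ := ih
    obtain ⟨u, δ, hδ⟩ := exists_lift_path hf 1 γ x.1 x.2
    refine ⟨u, _, hγ.append (isWordPath_singleton x) hδ, ?_⟩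
    have h1 : HasShortLifts f D K (ℓ x) (η - η / c) :=
      hk x K (Finset.le_sup (Finset.mem_univ x))
    have h2 : HasShortLifts f D K δ (η / c) := fun Γ hΓ s => by
      have hc := hf.continuous
      have h3 := hs ⟨fun s => f (Γ s), by fun_prop⟩ fun s => by
        show f^[K] (f (Γ s)) = γ s
        rw [← Function.iterate_succ_apply, Function.iterate_succ_apply', hΓ]
        exact hδ s
      exact hD.le_div_of_map_le isPreconnected_univ (s := 0) trivial hηε (fun r _ => h3 r) s trivial
    have h4 := h1.trans hD hf h2
    rwa [sub_add_cancel] at h4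

/-- The maps given by loops are contracting: their labels at long words are, for a fixed number
`K`, given by a path of the first word of length `K`, a short path, and the inverse of a path of a
second word of length `K`. For fixed words the result does not depend on the short path. -/
theorem exists_finite_contracting [Finite {x // f x = t}] [Nonempty (Boundary f t)] :
    ∃ N₀ : Set (Equiv.Perm (Boundary f t)), N₀.Finite ∧ N₀ ⊆ loopGroup hf t ∧
      ∀ g ∈ loopGroup hf t, ∃ n, ∀ v : List {x // f x = t}, n ≤ v.length →
        ∃ u, ∃ h ∈ N₀, At (letterEquiv hf ℓ) g v u h := by
  have hε := hD.pos
  obtain ⟨K, hK⟩ := exists_isWordPath_hasShortLifts hD hf ℓ (η := ε / 16) (by positivity)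
    (by linarith)
  choose Y P hP using exists_isWordPath (hf := hf) (ℓ := ℓ)
  -- the short path is composed of three paths that deviate from an endpoint by `ε / 16`; hence all
  -- its points are within `4 * (ε / 16)` of its origin
  let N : List {x // f x = t} → List {x // f x = t} → Set (Equiv.Perm (Boundary f t)) :=
    fun p q => {T | ∃ τ : Path (Y p) (Y q), (∀ s, D (τ s) (Y p) ≤ ε / 4) ∧
      T = transportEquiv hf (((P p).trans τ).trans (P q).symm)}
  have hN : ∀ p q, (N p q).Subsingleton := by
    rintro p q _ ⟨τ, hτ, rfl⟩ _ ⟨τ', hτ', rfl⟩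
    refine Equiv.ext fun z => ?_
    simp only [transportEquiv_apply, transport_trans]
    rw [transport_eq_of_short hD hf (by linarith) hτ hτ']
  have hfin : {v : List {x // f x = t} | v.length = K}.Finite := List.finite_length_eq _ K
  refine ⟨⋃ p ∈ {v : List {x // f x = t} | v.length = K},
    ⋃ q ∈ {v : List {x // f x = t} | v.length = K}, N p q,
    hfin.biUnion fun p _ => hfin.biUnion fun q _ => (hN p q).finite, ?_, ?_⟩
  · refine Set.iUnion₂_subset fun p _ => Set.iUnion₂_subset fun q _ => ?_
    rintro _ ⟨τ, -, rfl⟩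
    exact ⟨_, rfl⟩
  rintro _ ⟨α, rfl⟩
  obtain ⟨k₀, hk₀⟩ := exists_hasShortLifts hD hf α.toContinuousMap (η := ε / 16) (by positivity)
  -- the path of a long word is the chosen path of its last `K` letters followed by a short path
  have hsplit : ∀ v : List {x // f x = t}, K ≤ v.length → ∃ p, p.length = K ∧
      ∃ (y : M) (δ : Path (Y p) y), IsWordPath hf ℓ v ((P p).trans δ) ∧
        ∀ s, D (δ s) (Y p) ≤ ε / 16 := by
    intro v hv
    obtain ⟨a, b, rfl, hb⟩ : ∃ a b, v = a ++ b ∧ b.length = K :=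
      ⟨v.take (v.length - K), v.drop (v.length - K), (List.take_append_drop _ _).symm, by
        rw [List.length_drop]; omega⟩
    obtain ⟨y, γ, hγ, hs⟩ := hK a
    obtain ⟨u, δ, hδ⟩ := exists_lift_path hf b.length γ (Y b) (hP b).1
    refine ⟨b, hb, u, δ, hγ.append (hP b) hδ, fun s => ?_⟩
    have := hs δ.toContinuousMap (by rw [← hb]; exact hδ) s
    rwa [show δ.toContinuousMap 0 = Y b from δ.source] at this
  refine ⟨k₀ + K, fun v hv => ?_⟩
  obtain ⟨p, hp, y, δ, hvδ, hδ⟩ := hsplit v (by omega)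
  obtain ⟨u, τ, hτ⟩ := exists_lift_path hf v.length α y hvδ.1
  have hu : f^[v.length] u = t := by
    have := hτ 1
    rwa [τ.target, α.target] at this
  obtain ⟨q, γ, hq, hqγ⟩ := exists_isWordPath_of_vertex (hf := hf) (ℓ := ℓ) v.length hu
  obtain ⟨p', hp', u', δ', hqδ', hδ'⟩ := hsplit q (by omega)
  obtain ⟨z⟩ := ‹Nonempty (Boundary f t)›
  obtain rfl : u = u' := (hqγ.vertex_eq z).symm.trans (hqδ'.vertex_eq z)
  have hτ' : ∀ s, D (τ s) y ≤ ε / 16 := fun s => by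
    have := hk₀ v.length (by omega) τ.toContinuousMap hτ s
    rwa [show τ.toContinuousMap 0 = y from τ.source] at this
  refine ⟨q, _, Set.mem_biUnion hp (Set.mem_biUnion hp'
    ⟨(δ.trans τ).trans δ'.symm, fun s => ?_, ?_⟩), at_transportEquiv hvδ hqδ' hq hτ⟩
  · have h1 := hδ 1
    have h2 := hτ' 1
    have h3 := hδ' 1
    rw [Path.target] at h1 h2 h3
    rw [hD.symm] at h3
    refine Path.forall_trans (p := fun x => D x (Y p) ≤ ε / 4)
      (Path.forall_trans (p := fun x => D x (Y p) ≤ ε / 4) (fun s => ?_) (fun s => ?_))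
      (fun s => ?_) s
    · linarith [hδ s]
    · linarith [hτ' s, hD.triangle (τ s) y (Y p)]
    · have h4 : D (δ'.symm s) (Y p') ≤ ε / 16 := hδ' _
      linarith [hD.triangle (δ'.symm s) (Y p') (Y p), hD.triangle (Y p') u (Y p),
        hD.triangle u y (Y p)]
  · refine Equiv.ext fun z => ?_
    simp only [transportEquiv_apply, transport_trans, Path.trans_symm]

end

/-! ### The group `V_f` of an expanding covering -/

variable [CompactSpace M]

theorem finite_fiber [T1Space M] (hf : IsCoveringMap f) (t : M) : Finite {x // f x = t} := by
  have := (hf t).discreteTopology_fiber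
  have hcl : IsClosed (f ⁻¹' {t}) := isClosed_singleton.preimage hf.continuous
  have := isCompact_iff_compactSpace.1 hcl.isCompact
  exact finite_of_compact_of_discrete (X := f ⁻¹' {t})

theorem isFinitelyPresented_VF [T1Space M] [PathConnectedSpace M] (hf : IsCoveringMap f)
    (h : IsExpanding f) (t : M) : Group.IsFinitelyPresented (VF hf t) := by
  have := finite_fiber hf t
  rcases isEmpty_or_nonempty (Boundary f t) with hemp | hne
  · have : Finite (Boundary f t ≃ₜ Boundary f t) :=
      Finite.of_injective _ (Homeomorph.toPermHom_injective _)
    infer_instance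
  let ℓ : ∀ x : {x // f x = t}, Path t x.1 := fun x => PathConnectedSpace.somePath t x.1
  obtain ⟨D, c, ε, hD⟩ := h.exists_isExpandingDist hf.continuous
  obtain ⟨N₀, hN₀, hN₀𝒢, hcontr⟩ := exists_finite_contracting hD hf ℓ
  have key : Group.IsFinitelyPresented ((VF hf t).map (Homeomorph.toPermHom _)) :=
    isFinitelyPresented_of_contracting (e := letterEquiv hf ℓ)
      (subsingleton_boundary ℓ hf) (loopGroup hf t) exists_at_letter_of_mem_loopGroup hN₀ hN₀𝒢
      hcontr _ (fun A B g hA hB hg => mem_map_VF_of_tab hA hB hg) (by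
        rintro _ ⟨g, hg, rfl⟩
        exact exists_at_of_isLocallyTransport hg)
  exact Group.IsFinitelyPresented.equiv
    (Subgroup.equivMapOfInjective _ _ (Homeomorph.toPermHom_injective _)).symm

end PreimageTree

theorem mainTheorem2 :
    (∀ (G X : Type*) [Group G] [MulAction G (List X)] [Finite X]
      (hG : SelfSimilar.IsSelfSimilar G X), SelfSimilar.IsContracting G X →
        Group.IsFinitelyPresented (SelfSimilar.VG hG)) ∧
    (∀ (M : Type*) [MetricSpace M] [CompactSpace M] [PathConnectedSpace M] (f : M → M)
      (hf : IsCoveringMap f), PreimageTree.IsExpanding f →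
        ∀ t : M, Group.IsFinitelyPresented (PreimageTree.VF hf t)) :=
  ⟨fun _ _ _ _ _ hG hc => SelfSimilar.isFinitelyPresented_VG hG hc,
    fun _ _ _ _ _ hf h t => PreimageTree.isFinitelyPresented_VF hf h t⟩
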